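/- Let $k$ be an algebraically closed field of odd characteristic $p$, let $n=p^st$ be even with $s\ge 0$ and $p\nmid t$, and let $\xi\in k$ be a primitive $t$-th root of unity. Let $D_n=\langle a,b\mid a^n=b^2=(ab)^2=1\rangle$ and $C_n=\langle a\rangle$. All modules are finite dimensional. A Yetter–Drinfeld $kD_n$-module is a left $kD_n$-module $M$ which is also a right $kD_n$-comodule such that $\sum h_1m_0\otimes h_2m_1=\sum (h_2m)_0\otimes(h_2m)_1h_1$ for all $h\in kD_n$, $m\in M$. For $g\in D_n$ and a module $N$ over $kC_{D_n}(g)$, where $C_{D_n}(g)$ is the centralizer of $g$, let $D(N)=kD_n\otimes_{kC_{D_n}(g)}N$ with coaction $x\otimes v\mapsto (x\otimes v)\otimes xgx^{-1}$. The quantum double $D(kD_n)$ has the basis $\phi_g\otimes h$ ($g,h\in D_n$) and the product $(\phi_g\otimes h)(\phi_{g'}\otimes h')=\delta_{g,hg'h^{-1}}\,\phi_g\otimes hh'$. A Yetter–Drinfeld module $M$ becomes a $D(kD_n)$-module by letting $\phi_g\otimes h$ send $m$ to the degree $g$ component of $hm$. For $1\le r\le p^s$ and $0\le i\le t-1$ let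 $A_{r,i}$ be the $r\times r$ upper triangular Jordan block with eigenvalue $\xi^i$, and let $T_{r,i}=(t_{uv})$ be the upper triangular $r\times r$ matrix with $t_{rr}=1$, $t_{uv}=-\xi^i t_{u+1,v}-t_{u+1,v+1}$ for $u<r$ (where $t_{u+1,r+1}=0$). Define the following modules. * $V_{r,i}$ and $V'_{r,i}$, for $i\in\{0,t/2\}$: the $kD_n$-modules given by $a\mapsto A_{r,i}$, $b\mapsto T_{r,i}$ and by $a\mapsto A_{r,i}$, $b\mapsto -T_{r,i}$, respectively. * $Q_{r,j}$, for $0\le j\le t-1$: the $kC_n$-module given by $a\mapsto A_{r,j}$. * $W_{2r,i}=kD_n\otimes_{kC_n}Q_{r,i}$, for $1\le i\le t/2-1$. * $V_1,\dots,V_4$: the four one-dimensional modules over $C_{D_n}(b)=\{1,a^{n/2},b,a^{n/2}b\}$, where $a^{n/2}$ and $b$ act by the four pairs of signs. * $U_1,\dots,U_4$: the four one-dimensional modules over $C_{D_n}(ab)=\{1,a^{n/2},ab,a^{n/2}ab\}$, where $a^{n/2}$ and $ab$ act by the four pairs of signs. * $Q^l_{r,j}=Q_{r,j}$, viewed as a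 module over $C_{D_n}(a^l)=C_n$, for $1\le l\le n/2-1$. The modules $V=V_{r,0},V'_{r,0},V_{r,t/2},V'_{r,t/2},W_{2r,i}$ are Yetter–Drinfeld modules with coaction $v\mapsto v\otimes 1$. Write $D(V)$ for the same $kD_n$-module with coaction $v\mapsto v\otimes a^{n/2}$. **Theorem.** The family $$\left\{\begin{array}{c}V_{r,0},\ V'_{r,0},\ V_{r,t/2},\ V'_{r,t/2},\ W_{2r,i},\\ D(V_{r,0}),\ D(V'_{r,0}),\ D(V_{r,t/2}),\ D(V'_{r,t/2}),\ D(W_{2r,i}),\\ D(V_m),\ D(U_m),\ D(Q^l_{r,j})\end{array}\ \middle|\ \begin{array}{l}1\le r\le p^s,\ 1\le i\le t/2-1,\\ 0\le j\le t-1,\ 1\le m\le 4,\\ 1\le l\le n/2-1\end{array}\right\}$$ is a complete set of pairwise non-isomorphic indecomposable Yetter–Drinfeld $kD_n$-modules: every member is indecomposable, members with different labels are not isomorphic, and every finite-dimensional indecomposable Yetter–Drinfeld $kD_n$-module is isomorphic to a member. The modules $D(V_m)$ and $D(U_m)$ are simple. Equivalently, the corresponding $D(kD_n)$-modules form a complete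 set of pairwise non-isomorphic finite-dimensional indecomposable $D(kD_n)$-modules. -/

import Mathlib

open scoped TensorProduct

universe u v w w'

noncomputable section

/-! ## Yetter-Drinfeld modules over a Hopf algebra -/

/-- A (left-right) Yetter-Drinfeld module over the Hopf algebra `H`: a left `H`-module which is a
right `H`-comodule (with coaction `m ↦ ∑ m₀ ⊗ m₁`) such that
`∑ h₁ m₀ ⊗ h₂ m₁ = ∑ (h₂ m)₀ ⊗ (h₂ m)₁ h₁` for all `h` and `m`, where `Δ h = ∑ h₁ ⊗ h₂`. -/
structure YDModule (k : Type u) (H : Type v) [Field k] [Ring H] [HopfAlgebra k H] where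
  carrier : Type w
  [addCommGroup : AddCommGroup carrier]
  [module : Module k carrier]
  action : H →ₐ[k] Module.End k carrier
  coaction : carrier →ₗ[k] carrier ⊗[k] H
  coassoc : ∀ m, TensorProduct.assoc k carrier H H (coaction.rTensor H (coaction m)) =
    (Coalgebra.comul (R := k) (A := H)).lTensor carrier (coaction m)
  counit_coaction : ∀ m, TensorProduct.rid k carrier
    ((Coalgebra.counit (R := k) (A := H)).lTensor carrier (coaction m)) = m
  compat : ∀ (h : H) (m : carrier) (S : Coalgebra.Repr k h (H × H)),
    ∑ x ∈ S.index, TensorProduct.map (action (S.left x)) (LinearMap.mulLeft k (S.right x))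
        (coaction m) =
      ∑ x ∈ S.index, (LinearMap.mulRight k (S.left x)).lTensor carrier
        (coaction (action (S.right x) m))

attribute [instance] YDModule.addCommGroup YDModule.module

namespace YDModule

section Basic

variable {k : Type u} {H : Type v} [Field k] [Ring H] [HopfAlgebra k H]

/-- Two Yetter-Drinfeld modules are isomorphic if there is a bijective `k`-linear map between them
that is `H`-linear and `H`-colinear. -/
def IsIso (X : YDModule.{u, v, w} k H) (Y : YDModule.{u, v, w'} k H) : Prop :=
  ∃ e : X.carrier ≃ₗ[k] Y.carrier,
    (∀ h m, e (X.action h m) = Y.action h (e m)) ∧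
    (∀ m, Y.coaction (e m) = (e : X.carrier →ₗ[k] Y.carrier).rTensor H (X.coaction m))

/-- A Yetter-Drinfeld submodule: a submodule that is also a subcomodule. -/
def IsSub (X : YDModule.{u, v, w} k H) (W : Submodule k X.carrier) : Prop :=
  (∀ h, ∀ m ∈ W, X.action h m ∈ W) ∧
    ∀ m ∈ W, X.coaction m ∈ LinearMap.range (W.subtype.rTensor H)

/-- `X` is nonzero and is not the direct sum of two nonzero Yetter-Drinfeld submodules. -/
def IsIndecomposable (X : YDModule.{u, v, w} k H) : Prop :=
  Nontrivial X.carrier ∧ ∀ W₁ W₂ : Submodule k X.carrier, X.IsSub W₁ → X.IsSub W₂ →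
    IsCompl W₁ W₂ → W₁ = ⊥ ∨ W₂ = ⊥

/-- `X` is nonzero and has no Yetter-Drinfeld submodules besides `0` and `X`. -/
def IsSimple (X : YDModule.{u, v, w} k H) : Prop :=
  Nontrivial X.carrier ∧ ∀ W : Submodule k X.carrier, X.IsSub W → W = ⊥ ∨ W = ⊤

end Basic

/-! ## Yetter-Drinfeld modules over a group algebra -/

section GroupAlgebra

variable {k : Type u} {G : Type v} [Field k] [Group G]

/-- A representation of `G` with a coaction for which the homogeneous vectors `m` (those with
`m ↦ m ⊗ g` for some `g`) in a spanning set `S` satisfy `x m ↦ x m ⊗ x g x⁻¹` for all `x`. -/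
def ofHomogeneous {M : Type w} [AddCommGroup M] [Module k M] (ρ : Representation k G M)
    (δ : M →ₗ[k] M ⊗[k] MonoidAlgebra k G) (S : Set M) (hS : Submodule.span k S = ⊤)
    (hδ : ∀ m ∈ S, ∃ g : G, ∀ x : G,
      δ (ρ x m) = ρ x m ⊗ₜ[k] MonoidAlgebra.single (x * g * x⁻¹) (1 : k)) :
    YDModule.{u, max u v, w} k (MonoidAlgebra k G) where
  carrier := M
  action := ρ.asAlgebraHom
  coaction := δ
  coassoc := by
    intro m
    have hm : m ∈ Submodule.span k S := hS ▸ Submodule.mem_top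
    induction hm using Submodule.span_induction with
    | mem m hm =>
      obtain ⟨g, hg⟩ := hδ m hm
      have h1 := hg 1
      simp only [map_one, Module.End.one_apply, one_mul, inv_one, mul_one] at h1
      simp [h1]
    | zero => simp
    | add a b _ _ ha hb => simp only [map_add, ha, hb]
    | smul c a _ ha => simp only [map_smul, ha]
  counit_coaction := by
    intro m
    have hm : m ∈ Submodule.span k S := hS ▸ Submodule.mem_top
    induction hm using Submodule.span_induction with
    | mem m hm =>
      obtain ⟨g, hg⟩ := hδ m hm
      have h1 := hg 1
      simp only [map_one, Module.End.one_apply, one_mul, inv_one, mul_one] at h1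
      simp [h1]
    | zero => simp
    | add a b _ _ ha hb => simp only [map_add, ha, hb]
    | smul c a _ ha => simp only [map_smul, ha]
  compat := by
    have hm : ∀ m, m ∈ Submodule.span k S := fun m => hS ▸ Submodule.mem_top
    let L : M → MonoidAlgebra k G ⊗[k] MonoidAlgebra k G →ₗ[k] M ⊗[k] MonoidAlgebra k G :=
      fun m => TensorProduct.lift
        (((TensorProduct.mapBilinear (RingHom.id k) M (MonoidAlgebra k G) M (MonoidAlgebra k G)
          ).compl₁₂ ρ.asAlgebraHom.toLinearMap (LinearMap.mul k (MonoidAlgebra k G))).compr₂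
          (LinearMap.applyₗ (δ m)))
    let R : M → MonoidAlgebra k G ⊗[k] MonoidAlgebra k G →ₗ[k] M ⊗[k] MonoidAlgebra k G :=
      fun m => TensorProduct.lift (LinearMap.mk₂ k
        (fun a b => (LinearMap.mulRight k a).lTensor M (δ (ρ.asAlgebraHom b m)))
        (by
          intro a a' b
          have : LinearMap.mulRight k (a + a') = LinearMap.mulRight k a + LinearMap.mulRight k a' := by
            ext; simp [mul_add]
          rw [this]; simp [LinearMap.lTensor_add])
        (by
          intro c a b
          have : LinearMap.mulRight k (c • a) = c • LinearMap.mulRight k a := by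
            ext; simp
          rw [this]; simp [LinearMap.lTensor_smul])
        (by intro a b b'; simp)
        (by intro c a b; simp))
    have hL : ∀ m a b, L m (a ⊗ₜ b) =
        TensorProduct.map (ρ.asAlgebraHom a) (LinearMap.mulLeft k b) (δ m) := by
      intro m a b; rfl
    have hR : ∀ m a b, R m (a ⊗ₜ b) =
        (LinearMap.mulRight k a).lTensor M (δ (ρ.asAlgebraHom b m)) := by
      intro m a b; rfl
    have key : ∀ h m, L m (Coalgebra.comul (R := k) h) = R m (Coalgebra.comul (R := k) h) := by
      intro h m
      have hadd : ∀ h₁ h₂ : MonoidAlgebra k G,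
          L m (Coalgebra.comul (R := k) h₁) = R m (Coalgebra.comul (R := k) h₁) →
          L m (Coalgebra.comul (R := k) h₂) = R m (Coalgebra.comul (R := k) h₂) →
          L m (Coalgebra.comul (R := k) (h₁ + h₂)) = R m (Coalgebra.comul (R := k) (h₁ + h₂)) := by
        intro h₁ h₂ e₁ e₂; simp only [map_add, e₁, e₂]
      induction h using MonoidAlgebra.induction_linear with
      | zero => simp
      | add a b ha hb => exact hadd a b ha hb
      | single y c =>
        have hy : L m (MonoidAlgebra.single y (1 : k) ⊗ₜ MonoidAlgebra.single y (1 : k)) =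
            R m (MonoidAlgebra.single y (1 : k) ⊗ₜ MonoidAlgebra.single y (1 : k)) := by
          rw [hL, hR]
          clear hadd
          have := hm m
          induction this using Submodule.span_induction with
          | mem m hm =>
            obtain ⟨g, hg⟩ := hδ m hm
            have h1 := hg 1
            simp only [map_one, Module.End.one_apply, one_mul, inv_one, mul_one] at h1
            simp [h1, hg, MonoidAlgebra.single_mul_single]
          | zero => simp
          | add a b _ _ ha hb => simp only [map_add, ha, hb]
          | smul c a _ ha => simp only [map_smul, ha]
        have hc : (MonoidAlgebra.single y c : MonoidAlgebra k G) =
            c • MonoidAlgebra.single y (1 : k) := by simp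
        have h1 : Coalgebra.comul (R := k) (MonoidAlgebra.single y (1 : k)) =
            (MonoidAlgebra.single y (1 : k)) ⊗ₜ[k] (MonoidAlgebra.single y (1 : k)) := by
          simp
        rw [hc, map_smul, map_smul, map_smul, h1, hy]
    intro h m S
    have := key h m
    rw [← S.eq, map_sum, map_sum] at this
    simpa only [hL, hR] using this

/-- A representation of `G` on `M` with the coaction `m ↦ m ⊗ z`, where `z` is central. -/
def central {M : Type w} [AddCommGroup M] [Module k M] (z : G) (hz : z ∈ Subgroup.center G)
    (ρ : Representation k G M) : YDModule.{u, max u v, w} k (MonoidAlgebra k G) :=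
  ofHomogeneous ρ ((TensorProduct.mk k M (MonoidAlgebra k G)).flip (MonoidAlgebra.single z 1))
    Set.univ (by simp) (by
      intro m _
      refine ⟨z, fun x => ?_⟩
      have : x * z * x⁻¹ = z := by
        rw [(Subgroup.mem_center_iff.mp hz x), mul_inv_cancel_right]
      simp [this])

/-- The coaction on the induced module `kG ⊗_{kC(g)} N`, see `YDModule.induced`. -/
def inducedCoaction (g : G) {N : Type w} [AddCommGroup N] [Module k N]
    (ρ : Representation k (Subgroup.centralizer {g}) N) :
    Representation.IndV (Subgroup.centralizer {g}).subtype ρ →ₗ[k]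
      Representation.IndV (Subgroup.centralizer {g}).subtype ρ ⊗[k] MonoidAlgebra k G :=
  Representation.Coinvariants.lift _
    (TensorProduct.lift
      ((Finsupp.lsum k fun x : G => LinearMap.toSpanSingleton k _
        ((TensorProduct.mk k _ (MonoidAlgebra k G)).flip
          (MonoidAlgebra.single (x⁻¹ * g * x) 1) ∘ₗ
            Representation.IndV.mk (Subgroup.centralizer {g}).subtype ρ x)) ∘ₗ
        (MonoidAlgebra.coeffLinearEquiv k).toLinearMap))
    (by
      intro c
      apply TensorProduct.ext
      apply MonoidAlgebra.lhom_ext'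
      intro x
      apply LinearMap.ext_ring
      ext n
      have hc : (c : G)⁻¹ * g * c = g := by
        have := Subgroup.mem_centralizer_singleton_iff.mp c.2
        rw [mul_assoc, ← this, inv_mul_cancel_left]
      have h2 : x⁻¹ * (c : G)⁻¹ * g * ((c : G) * x) = x⁻¹ * g * x := by
        rw [show x⁻¹ * (c : G)⁻¹ * g * (c * x) = x⁻¹ * ((c : G)⁻¹ * g * c) * x by
          group, hc]
      have h3 : Representation.IndV.mk (Subgroup.centralizer {g}).subtype ρ ((c : G) * x) (ρ c n) =
          Representation.IndV.mk (Subgroup.centralizer {g}).subtype ρ x n := by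
        have := Representation.Coinvariants.mk_self_apply
          (Representation.tprod ((Representation.leftRegular k G).comp
            (Subgroup.centralizer {g}).subtype) ρ) c (MonoidAlgebra.single x 1 ⊗ₜ n)
        simpa using this
      simpa [h2] using congrArg (fun y => y ⊗ₜ[k] (MonoidAlgebra.single (x⁻¹ * g * x) (1 : k))) h3)

lemma inducedCoaction_mk (g : G) {N : Type w} [AddCommGroup N] [Module k N]
    (ρ : Representation k (Subgroup.centralizer {g}) N) (x : G) (n : N) :
    inducedCoaction g ρ (Representation.IndV.mk (Subgroup.centralizer {g}).subtype ρ x n) =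
      Representation.IndV.mk (Subgroup.centralizer {g}).subtype ρ x n ⊗ₜ
        MonoidAlgebra.single (x⁻¹ * g * x) (1 : k) := by
  simp [inducedCoaction]

/-- The Yetter-Drinfeld module `D(N) = kG ⊗_{kC(g)} N` induced from a representation `N` of the
centralizer `C(g)`, with coaction `x ⊗ n ↦ (x ⊗ n) ⊗ x g x⁻¹`. In Mathlib's model of the induced
representation the vector `x ⊗ n` is `Representation.IndV.mk _ _ x⁻¹ n`. -/
def induced (g : G) {N : Type w} [AddCommGroup N] [Module k N]
    (ρ : Representation k (Subgroup.centralizer {g}) N) :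
    YDModule.{u, max u v, max u v w} k (MonoidAlgebra k G) :=
  ofHomogeneous (Representation.ind (Subgroup.centralizer {g}).subtype ρ) (inducedCoaction g ρ)
    {m | ∃ (x : G) (n : N),
      m = Representation.IndV.mk (Subgroup.centralizer {g}).subtype ρ x⁻¹ n}
    (by
      rw [eq_top_iff]
      rintro m -
      set S := {m | ∃ (x : G) (n : N),
        m = Representation.IndV.mk (Subgroup.centralizer {g}).subtype ρ x⁻¹ n} with hS
      have : (Submodule.span k S).mkQ = 0 := by
        apply Representation.IndV.hom_ext
        intro x
        ext n
        have : Representation.IndV.mk (Subgroup.centralizer {g}).subtype ρ x n ∈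
            Submodule.span k S := Submodule.subset_span ⟨x⁻¹, n, by rw [inv_inv]⟩
        simpa using this
      have h := LinearMap.congr_fun this m
      simpa using h)
    (by
      rintro _ ⟨y, n, rfl⟩
      refine ⟨y * g * y⁻¹, fun x => ?_⟩
      rw [Representation.ind_mk, inducedCoaction_mk]
      congr 2
      group)

end GroupAlgebra

end YDModule

/-! ## The quantum double of a group algebra -/

section QuantumDouble

/-- The algebra `(kG)*` of functions on `G` with values in `k`. -/
def GroupFunctions (k : Type u) (G : Type v) : Type max u v := G → k

variable (k : Type u) (G : Type v) [Field k] [Group G]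

instance : CommRing (GroupFunctions k G) := inferInstanceAs (CommRing (G → k))

instance : Algebra k (GroupFunctions k G) := inferInstanceAs (Algebra k (G → k))

/-- `G` acts on `(kG)*` by conjugation: `(h • f)(g) = f (h⁻¹ g h)`, so `h • φ_g = φ_{h g h⁻¹}`. -/
instance : MulSemiringAction G (GroupFunctions k G) where
  smul h f := fun g => f (h⁻¹ * g * h)
  one_smul f := by funext g; change f _ = f g; simp
  mul_smul x y f := by funext g; change f _ = f _; simp [mul_assoc]
  smul_zero _ := rfl
  smul_add _ _ _ := rfl
  smul_one _ := rfl
  smul_mul _ _ _ := rfl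

instance : SMulCommClass G k (GroupFunctions k G) where
  smul_comm _ _ _ := rfl

/-- The quantum double `D(kG)` as an algebra: its elements are sums of `φ ⊗ h` with `φ` a function
on `G` and `h ∈ G`, and `(φ ⊗ h)(φ' ⊗ h') = φ (h • φ') ⊗ h h'`. -/
abbrev QuantumDouble : Type max u v := SkewMonoidAlgebra (GroupFunctions k G) G

variable {k G}

open Classical in
/-- The function `φ_g`, with `φ_g(h) = δ_{g,h}`. -/
def deltaFunction (g : G) : GroupFunctions k G := fun h => if g = h then 1 else 0

open Classical in
/-- `(φ_g ⊗ h)(φ_{g'} ⊗ h') = δ_{g, h g' h⁻¹} φ_g ⊗ h h'`. -/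
lemma QuantumDouble.basis_mul_basis (g h g' h' : G) :
    (SkewMonoidAlgebra.single h (deltaFunction g) : QuantumDouble k G) *
        SkewMonoidAlgebra.single h' (deltaFunction g') =
      if g = h * g' * h⁻¹ then SkewMonoidAlgebra.single (h * h') (deltaFunction g) else 0 := by
  rw [SkewMonoidAlgebra.single_mul_single]
  have : (deltaFunction g * h • deltaFunction g' : GroupFunctions k G) =
      if g = h * g' * h⁻¹ then deltaFunction g else 0 := by
    funext x
    change (if g = x then (1 : k) else 0) * (if g' = h⁻¹ * x * h then 1 else 0) = _
    have e : g' = h⁻¹ * x * h ↔ x = h * g' * h⁻¹ := by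
      constructor
      · rintro rfl; group
      · rintro rfl; group
    by_cases h1 : g = x
    · subst h1
      by_cases h2 : g = h * g' * h⁻¹
      · rw [if_pos h2, if_pos (e.2 h2)]; simp [deltaFunction]
      · rw [if_neg h2, if_neg (fun q => h2 (e.1 q))]; simp; rfl
    · rw [if_neg h1, zero_mul]
      split_ifs
      · simp [deltaFunction, h1]
      · rfl
  rw [this]
  split_ifs <;> simp

/-- The linear form `∑ c_g g ↦ ∑ c_g f(g)` on `kG` given by a function `f` on `G`. -/
def GroupFunctions.pairing {G : Type v} (f : GroupFunctions k G) : MonoidAlgebra k G →ₗ[k] k :=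
  Finsupp.linearCombination k (f : G → k) ∘ₗ (MonoidAlgebra.coeffLinearEquiv k).toLinearMap

lemma GroupFunctions.pairing_single {G : Type v} (f : GroupFunctions k G) (g : G) (c : k) :
    f.pairing (MonoidAlgebra.single g c) = c * (f : G → k) g :=
  (Finsupp.linearCombination_single k c g).trans (smul_eq_mul c _)

namespace YDModule

variable (X : YDModule.{u, max u v, w} k (MonoidAlgebra k G))

/-- The action `f ⇀ m = ∑ f(m₁) m₀` of the algebra `(kG)*` on a right `kG`-comodule. -/
def dualActionFun (f : GroupFunctions k G) : Module.End k X.carrier :=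
  (TensorProduct.rid k X.carrier).toLinearMap ∘ₗ f.pairing.lTensor X.carrier ∘ₗ X.coaction

lemma coaction_action_single (y : G) (m : X.carrier) :
    X.coaction (X.action (MonoidAlgebra.single y 1) m) =
      TensorProduct.map (X.action (MonoidAlgebra.single y 1))
        (LinearMap.mulRight k (MonoidAlgebra.single y⁻¹ (1 : k)) ∘ₗ
          LinearMap.mulLeft k (MonoidAlgebra.single y (1 : k))) (X.coaction m) := by
  let b : MonoidAlgebra k G := MonoidAlgebra.single y 1
  let b' : MonoidAlgebra k G := MonoidAlgebra.single y⁻¹ 1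
  have hb : b * b' = 1 := by
    simp [b, b', MonoidAlgebra.single_mul_single, MonoidAlgebra.one_def]
  have h := X.compat b m ⟨{(b, b)}, Prod.fst, Prod.snd, by simp [b]⟩
  simp only [Finset.sum_singleton] at h
  have h2 := congrArg ((LinearMap.mulRight k b').lTensor X.carrier) h
  rw [← LinearMap.comp_apply, LinearMap.lTensor_comp_map, ← LinearMap.comp_apply,
    ← LinearMap.comp_apply (LinearMap.lTensor X.carrier (LinearMap.mulRight k b')),
    ← LinearMap.lTensor_comp] at h2
  have h3 : LinearMap.mulRight k b' ∘ₗ LinearMap.mulRight k b = LinearMap.id := by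
    apply LinearMap.ext
    intro z
    simp [mul_assoc, hb]
  rw [h3] at h2
  simpa using h2.symm

/-- The action `dualActionFun`, as an algebra homomorphism. -/
def dualAction : GroupFunctions k G →ₐ[k] Module.End k X.carrier :=
  AlgHom.ofLinearMap
    { toFun := X.dualActionFun
      map_add' := by
        intro f f'
        have : (f + f').pairing = f.pairing + f'.pairing := by
          apply MonoidAlgebra.lhom_ext'
          intro g
          apply LinearMap.ext_ring
          simp only [LinearMap.comp_apply, LinearMap.add_apply, MonoidAlgebra.lsingle_apply,
            GroupFunctions.pairing_single, one_mul]
          rfl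
        ext m
        simp [dualActionFun, this, LinearMap.lTensor_add]
      map_smul' := by
        intro c f
        have : (c • f).pairing = c • f.pairing := by
          apply MonoidAlgebra.lhom_ext'
          intro g
          apply LinearMap.ext_ring
          simp only [LinearMap.comp_apply, LinearMap.smul_apply, MonoidAlgebra.lsingle_apply,
            GroupFunctions.pairing_single, one_mul]
          rfl
        ext m
        simp [dualActionFun, this, LinearMap.lTensor_smul] }
    (by
      have : (1 : GroupFunctions k G).pairing = Coalgebra.counit (R := k) := by
        apply MonoidAlgebra.lhom_ext'
        intro g
        apply LinearMap.ext_ring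
        simp only [LinearMap.comp_apply, MonoidAlgebra.lsingle_apply,
          GroupFunctions.pairing_single, one_mul, MonoidAlgebra.counit_single]
        simp
        rfl
      ext m
      simpa [dualActionFun, this] using X.counit_coaction m)
    (by
      intro f f'
      apply LinearMap.ext
      intro m
      have h1 : ∀ z : X.carrier ⊗[k] MonoidAlgebra k G,
          TensorProduct.rid k X.carrier ((f * f').pairing.lTensor X.carrier z) =
          TensorProduct.rid k X.carrier ((TensorProduct.rid k k).toLinearMap.lTensor X.carrier
            ((TensorProduct.map f.pairing f'.pairing).lTensor X.carrier
              ((Coalgebra.comul (R := k)).lTensor X.carrier z))) := by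
        intro z
        have : (f * f').pairing = (TensorProduct.rid k k).toLinearMap ∘ₗ
            TensorProduct.map f.pairing f'.pairing ∘ₗ Coalgebra.comul (R := k) := by
          apply MonoidAlgebra.lhom_ext'
          intro g
          apply LinearMap.ext_ring
          simp only [LinearMap.comp_apply, MonoidAlgebra.lsingle_apply,
            GroupFunctions.pairing_single, one_mul, MonoidAlgebra.comul_single]
          simp [GroupFunctions.pairing_single]
          rw [mul_comm]; rfl
        rw [this, LinearMap.lTensor_comp, LinearMap.lTensor_comp]
        rfl
      have h2 : ∀ z : X.carrier ⊗[k] MonoidAlgebra k G,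
          TensorProduct.rid k X.carrier ((TensorProduct.rid k k).toLinearMap.lTensor X.carrier
            ((TensorProduct.map f.pairing f'.pairing).lTensor X.carrier
              (TensorProduct.assoc k _ _ _ (X.coaction.rTensor _ z)))) =
          X.dualActionFun f (TensorProduct.rid k X.carrier (f'.pairing.lTensor X.carrier z)) := by
        intro z
        induction z using TensorProduct.induction_on with
        | zero => simp
        | add a b ha hb => simp only [map_add, ha, hb]
        | tmul a c =>
          simp only [LinearMap.rTensor_tmul, LinearMap.lTensor_tmul, TensorProduct.rid_tmul,
            map_smul, dualActionFun, LinearMap.comp_apply]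
          generalize X.coaction a = q
          induction q using TensorProduct.induction_on with
          | zero => simp
          | add a b ha hb => simp only [map_add, TensorProduct.add_tmul, ha, hb, smul_add]
          | tmul a d =>
            simp [smul_smul, mul_comm]
      change TensorProduct.rid k X.carrier ((f * f').pairing.lTensor X.carrier (X.coaction m)) =
        X.dualActionFun f (TensorProduct.rid k X.carrier
          (f'.pairing.lTensor X.carrier (X.coaction m)))
      rw [h1, ← X.coassoc, h2])

/-- A Yetter-Drinfeld `kG`-module as a representation of `D(kG)`: the element `f ⊗ h` acts by
`m ↦ f ⇀ (h m)`, that is, `φ_g ⊗ h` sends `m` to the degree `g` part of `h m`. -/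
def doubleAction : QuantumDouble k G →ₐ[k] Module.End k X.carrier :=
  SkewMonoidAlgebra.liftNCAlgHom X.dualAction
    ((X.action : MonoidAlgebra k G →* Module.End k X.carrier).comp (MonoidAlgebra.of k G))
    (by
      intro f y
      apply LinearMap.ext
      intro m
      change TensorProduct.rid k X.carrier ((y • f).pairing.lTensor X.carrier
          (X.coaction (X.action (MonoidAlgebra.single y 1) m))) =
        X.action (MonoidAlgebra.single y 1) (TensorProduct.rid k X.carrier
          (f.pairing.lTensor X.carrier (X.coaction m)))
      rw [coaction_action_single]
      have : (y • f).pairing ∘ₗ (LinearMap.mulRight k (MonoidAlgebra.single y⁻¹ (1 : k)) ∘ₗ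
          LinearMap.mulLeft k (MonoidAlgebra.single y (1 : k))) = f.pairing := by
        apply MonoidAlgebra.lhom_ext'
        intro g
        apply LinearMap.ext_ring
        simp only [LinearMap.comp_apply, MonoidAlgebra.lsingle_apply,
          LinearMap.mulLeft_apply, LinearMap.mulRight_apply, MonoidAlgebra.single_mul_single,
          GroupFunctions.pairing_single, one_mul]
        change f _ = f _
        congr 1
        group
      rw [← LinearMap.comp_apply, LinearMap.lTensor_comp_map, this]
      generalize X.coaction m = z
      induction z using TensorProduct.induction_on with
      | zero => simp
      | add a b ha hb => simp only [map_add, ha, hb]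
      | tmul a c => simp)

/-- The left `D(kG)`-module corresponding to a Yetter-Drinfeld `kG`-module. -/
def Double : Type w := X.carrier

instance : AddCommGroup X.Double := inferInstanceAs (AddCommGroup X.carrier)

instance : Module (QuantumDouble k G) X.Double :=
  Module.compHom X.carrier X.doubleAction.toRingHom

end YDModule

/-- An indecomposable module over a ring: nonzero, and not the direct sum of two nonzero
submodules. -/
def IsIndecomposableModule (R : Type v) (M : Type w) [Ring R] [AddCommGroup M] [Module R M] : Prop :=
  Nontrivial M ∧ ∀ W₁ W₂ : Submodule R M, IsCompl W₁ W₂ → W₁ = ⊥ ∨ W₂ = ⊥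

end QuantumDouble

/-! ## The matrices -/

section Matrices

variable {k : Type u} [Field k]

/-- The `r × r` upper triangular Jordan block with eigenvalue `c`. -/
def jordanMatrix (r : ℕ) (c : k) : Matrix (Fin r) (Fin r) k :=
  Matrix.of fun i j => if i = j then c else if (i : ℕ) + 1 = j then 1 else 0

/-- The entries `t_{ij}` of the matrix `involutionMatrix`, with `u = r - i` and `v = r - j`. -/
def involutionEntry (c : k) : ℕ → ℕ → k
  | 0, 0 => 1
  | 0, _ + 1 => 0
  | u + 1, 0 => -c * involutionEntry c u 0
  | u + 1, v + 1 => -c * involutionEntry c u (v + 1) - involutionEntry c u v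

/-- The upper triangular `r × r` matrix `(t_{ij})` with `t_{rr} = 1` and
`t_{ij} = -c t_{i+1,j} - t_{i+1,j+1}` for `i < r`, where `t_{i+1,r+1} = 0`. -/
def involutionMatrix (r : ℕ) (c : k) : Matrix (Fin r) (Fin r) k :=
  Matrix.of fun i j => involutionEntry c (i.rev : ℕ) (j.rev : ℕ)

lemma involutionEntry_eq_zero (c : k) : ∀ u v : ℕ, u < v → involutionEntry c u v = 0
  | 0, 0, h => absurd h (lt_irrefl _)
  | 0, _ + 1, _ => rfl
  | u + 1, 0, h => absurd h (by omega)
  | u + 1, v + 1, h => by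
    rw [involutionEntry, involutionEntry_eq_zero c u (v + 1) (by omega),
      involutionEntry_eq_zero c u v (by omega)]
    ring

lemma involutionEntry_coeff (c : k) : ∀ u v : ℕ,
    involutionEntry c u v = ((-(Polynomial.C c + Polynomial.X)) ^ u : Polynomial k).coeff v
  | 0, 0 => by simp [involutionEntry]
  | 0, v + 1 => by simp [involutionEntry, Polynomial.coeff_one]
  | u + 1, 0 => by
    rw [involutionEntry, involutionEntry_coeff c u 0, pow_succ, Polynomial.mul_coeff_zero]
    simp [mul_comm]
  | u + 1, v + 1 => by
    rw [involutionEntry, involutionEntry_coeff c u (v + 1), involutionEntry_coeff c u v, pow_succ,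
      mul_neg, mul_add, Polynomial.coeff_neg, Polynomial.coeff_add, Polynomial.coeff_mul_C,
      Polynomial.coeff_mul_X]
    ring

lemma involutionMatrix_sq (r : ℕ) (c : k) :
    involutionMatrix r c * involutionMatrix r c = 1 := by
  ext i j
  rw [Matrix.mul_apply, Matrix.one_apply]
  simp only [involutionMatrix, Matrix.of_apply]
  rw [show ∑ x : Fin r, involutionEntry c (i.rev : ℕ) (x.rev : ℕ) *
      involutionEntry c (x.rev : ℕ) (j.rev : ℕ) = ∑ x : Fin r, involutionEntry c (i.rev : ℕ) (x : ℕ) *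
      involutionEntry c (x : ℕ) (j.rev : ℕ) from
    Equiv.sum_comp Fin.revPerm (fun x : Fin r => involutionEntry c (i.rev : ℕ) (x : ℕ) *
      involutionEntry c (x : ℕ) (j.rev : ℕ))]
  rw [Fin.sum_univ_eq_sum_range (fun x => involutionEntry c (i.rev : ℕ) x *
    involutionEntry c x (j.rev : ℕ)) r]
  set q : Polynomial k := -(Polynomial.C c + Polynomial.X) with hq
  set u := (i.rev : ℕ) with hu
  have hdeg : (q ^ u).natDegree < r := by
    refine lt_of_le_of_lt (Polynomial.natDegree_pow_le_of_le u (m := 1) ?_) ?_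
    · rw [hq, Polynomial.natDegree_neg, add_comm, Polynomial.natDegree_X_add_C]
    · rw [mul_one]; exact i.rev.2
  have h1 : (q ^ u).comp q = Polynomial.X ^ u := by
    rw [Polynomial.pow_comp]
    congr 1
    rw [hq]; simp
  rw [Polynomial.comp_eq_sum_left, Polynomial.sum_over_range' _ (by simp) r hdeg] at h1
  have h2 := congrArg (fun f => Polynomial.coeff f (j.rev : ℕ)) h1
  simp only [Polynomial.finsetSum_coeff, Polynomial.coeff_C_mul, ← involutionEntry_coeff, hq,
    Polynomial.coeff_X_pow] at h2
  rw [h2]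
  have : ((j.rev : ℕ) = u) ↔ i = j := by
    rw [hu, ← Fin.ext_iff, Fin.rev_inj, eq_comm]
  simp only [this]

lemma jordanMatrix_mul_involutionMatrix_mul (r : ℕ) (c : k) (hc : c ^ 2 = 1) :
    jordanMatrix r c * involutionMatrix r c * jordanMatrix r c = involutionMatrix r c := by
  have hl : ∀ (B : Matrix (Fin r) (Fin r) k) (i j : Fin r), (jordanMatrix r c * B) i j =
      c * B i j + if h : (i : ℕ) + 1 < r then B ⟨i + 1, h⟩ j else 0 := by
    intro B i j
    rw [Matrix.mul_apply]
    have : ∀ x, jordanMatrix r c i x * B x j =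
        (if i = x then c * B x j else 0) + (if (i : ℕ) + 1 = x then B x j else 0) := by
      intro x
      simp only [jordanMatrix, Matrix.of_apply]
      by_cases h : i = x
      · subst h; simp
      · simp [h]
    simp only [this, Finset.sum_add_distrib, Finset.sum_ite_eq, Finset.mem_univ, if_true]
    congr 1
    split_ifs with h
    · rw [Finset.sum_eq_single ⟨i + 1, h⟩]
      · simp
      · intro b _ hb
        rw [if_neg]
        intro e
        exact hb (Fin.ext e.symm)
      · simp
    · apply Finset.sum_eq_zero
      intro x _
      rw [if_neg]
      have := x.2
      omega
  have hr : ∀ (B : Matrix (Fin r) (Fin r) k) (i j : Fin r), (B * jordanMatrix r c) i j =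
      c * B i j + if h : 0 < (j : ℕ) then B i ⟨j - 1, by omega⟩ else 0 := by
    intro B i j
    rw [Matrix.mul_apply]
    have : ∀ x, B i x * jordanMatrix r c x j =
        (if x = j then c * B i x else 0) + (if (x : ℕ) + 1 = j then B i x else 0) := by
      intro x
      simp only [jordanMatrix, Matrix.of_apply]
      by_cases h : x = j
      · subst h; simp [mul_comm]
      · simp [h]
    simp only [this, Finset.sum_add_distrib, Finset.sum_ite_eq', Finset.mem_univ, if_true]
    congr 1
    split_ifs with h
    · rw [Finset.sum_eq_single ⟨j - 1, by omega⟩]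
      · rw [if_pos]; simp only; omega
      · intro b _ hb
        rw [if_neg]
        intro e
        exact hb (Fin.ext (by simp only; omega))
      · simp
    · apply Finset.sum_eq_zero
      intro x _
      rw [if_neg]
      omega
  -- the entries of the product of the first two factors
  have hAT : ∀ i j : Fin r, (jordanMatrix r c * involutionMatrix r c) i j =
      if h : (i : ℕ) + 1 < r then
        (if (j : ℕ) + 1 < r then
          -c * involutionEntry c (r - (i + 2)) (r - (j + 2)) else 0)
      else if (j : ℕ) + 1 < r then 0 else c := by
    intro i j
    have hi := i.2
    have hj := j.2
    rw [hl]
    simp only [involutionMatrix, Matrix.of_apply, Fin.val_rev]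
    by_cases h : (i : ℕ) + 1 < r
    · rw [dif_pos h, dif_pos h]
      have e1 : r - ((i : ℕ) + 1) = (r - (i + 2)) + 1 := by omega
      have e1' : r - ((i : ℕ) + 1 + 1) = r - (i + 2) := by omega
      rw [e1', e1]
      by_cases h' : (j : ℕ) + 1 < r
      · rw [if_pos h']
        have e2 : r - ((j : ℕ) + 1) = (r - (j + 2)) + 1 := by omega
        rw [e2, involutionEntry]
        linear_combination (-involutionEntry c (r - (i + 2)) (r - (j + 2) + 1)) * hc
      · rw [if_neg h']
        have e2 : r - ((j : ℕ) + 1) = 0 := by omega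
        rw [e2, involutionEntry]
        linear_combination (-involutionEntry c (r - (i + 2)) 0) * hc
    · rw [dif_neg h, dif_neg h]
      have e1 : r - ((i : ℕ) + 1) = 0 := by omega
      rw [e1]
      by_cases h' : (j : ℕ) + 1 < r
      · have e2 : r - ((j : ℕ) + 1) = (r - (j + 2)) + 1 := by omega
        rw [if_pos h', e2, involutionEntry]; simp
      · have e2 : r - ((j : ℕ) + 1) = 0 := by omega
        rw [if_neg h', e2, involutionEntry]; simp
  ext i j
  have hi := i.2
  have hj := j.2
  rw [hr]
  simp only [hAT]
  simp only [involutionMatrix, Matrix.of_apply, Fin.val_rev]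
  by_cases h : (i : ℕ) + 1 < r
  · have e1 : r - ((i : ℕ) + 1) = (r - (i + 2)) + 1 := by omega
    simp only [dif_pos h]
    rw [e1]
    by_cases h' : (j : ℕ) + 1 < r
    · have e2 : r - ((j : ℕ) + 1) = (r - (j + 2)) + 1 := by omega
      rw [if_pos h', e2, involutionEntry]
      by_cases h0 : 0 < (j : ℕ)
      · rw [dif_pos h0, if_pos (by omega)]
        have e3 : r - ((j : ℕ) - 1 + 2) = (r - (j + 2)) + 1 := by omega
        rw [e3]
        linear_combination (-involutionEntry c (r - (i + 2)) (r - (j + 2))) * hc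
      · rw [dif_neg h0, involutionEntry_eq_zero c (r - (i + 2)) (r - (j + 2) + 1) (by omega)]
        linear_combination (-involutionEntry c (r - (i + 2)) (r - (j + 2))) * hc
    · have e2 : r - ((j : ℕ) + 1) = 0 := by omega
      have h0 : 0 < (j : ℕ) := by omega
      rw [if_neg h', e2, involutionEntry, dif_pos h0, if_pos (by omega)]
      have e3 : r - ((j : ℕ) - 1 + 2) = 0 := by omega
      rw [e3]; ring
  · have e1 : r - ((i : ℕ) + 1) = 0 := by omega
    simp only [dif_neg h]
    rw [e1]
    by_cases h' : (j : ℕ) + 1 < r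
    · have e2 : r - ((j : ℕ) + 1) = (r - (j + 2)) + 1 := by omega
      rw [if_pos h', e2, involutionEntry]
      by_cases h0 : 0 < (j : ℕ)
      · rw [dif_pos h0, if_pos (by omega)]; ring
      · rw [dif_neg h0]; ring
    · have e2 : r - ((j : ℕ) + 1) = 0 := by omega
      rw [if_neg h', e2, involutionEntry]
      by_cases h0 : 0 < (j : ℕ)
      · rw [dif_pos h0, if_pos (by omega)]; linear_combination hc
      · rw [dif_neg h0]; linear_combination hc

lemma jordanMatrix_pow_eq_one {p s t r : ℕ} [Fact p.Prime] [CharP k p] (hr : r ≤ p ^ s) (c : k)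
    (hc : c ^ t = 1) : jordanMatrix r c ^ (p ^ s * t) = 1 := by
  have hsplit : jordanMatrix r c = Matrix.scalar (Fin r) c + jordanMatrix r 0 := by
    ext i j
    by_cases h : i = j
    · subst h; simp [jordanMatrix]
    · simp [jordanMatrix, h]
  have hN : ∀ m : ℕ, ∀ i j : Fin r, (j : ℕ) < i + m → (jordanMatrix r (0 : k) ^ m) i j = 0 := by
    intro m
    induction m with
    | zero =>
      intro i j h
      rw [pow_zero, Matrix.one_apply_ne]
      rintro rfl; omega
    | succ m ih =>
      intro i j h
      rw [pow_succ, Matrix.mul_apply]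
      apply Finset.sum_eq_zero
      intro x _
      by_cases hx : (x : ℕ) < i + m
      · rw [ih i x hx, zero_mul]
      · have : jordanMatrix r (0 : k) x j = 0 := by
          simp only [jordanMatrix, Matrix.of_apply]
          split_ifs with h1 h2
          · rfl
          · omega
          · rfl
        rw [this, mul_zero]
  have hN0 : jordanMatrix r (0 : k) ^ (p ^ s) = 0 := by
    ext i j
    exact hN _ i j (by have := j.2; omega)
  rcases Nat.eq_zero_or_pos r with rfl | hr0
  · exact Subsingleton.elim _ _
  have : Nonempty (Fin r) := ⟨⟨0, hr0⟩⟩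
  have : CharP (Matrix (Fin r) (Fin r) k) p := Matrix.charP p
  have hcomm : Commute (Matrix.scalar (Fin r) c) (jordanMatrix r (0 : k)) :=
    Matrix.scalar_commute _ (fun _ => Commute.all _ _) _
  rw [pow_mul, hsplit, add_pow_char_pow_of_commute p s hcomm, hN0, add_zero, ← map_pow, ← map_pow,
    ← pow_mul, mul_comm, pow_mul, hc, one_pow, map_one]

end Matrices

/-! ## Representations of the dihedral group `D_n` and of its subgroups

In `DihedralGroup n` the generators are `a = r 1` and `b = sr 0`, so `r i = a ^ i` and
`sr i = b a ^ i`. -/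

section DihedralRepresentations

open DihedralGroup

variable {k : Type u} [Field k] {n : ℕ}

lemma pow_val_add [NeZero n] {M : Type*} [Monoid M] {A : M} (hA : A ^ n = 1) (i j : ZMod n) :
    A ^ (i + j).val = A ^ i.val * A ^ j.val := by
  rw [ZMod.val_add, ← pow_add, ← pow_eq_pow_mod _ hA]

/-- The representation of `D_n` given by matrices `a ↦ A`, `b ↦ B`. -/
def dihedralRep [NeZero n] {m : ℕ} (A B : Matrix (Fin m) (Fin m) k) (hA : A ^ n = 1) (hB : B * B = 1)
    (hAB : A * B * A = B) : Representation k (DihedralGroup n) (Fin m → k) :=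
  ((Matrix.toLinAlgEquiv' : Matrix (Fin m) (Fin m) k ≃ₐ[k] _) :
      Matrix (Fin m) (Fin m) k →* Module.End k (Fin m → k)).comp
    { toFun := fun
        | r i => A ^ i.val
        | sr i => B * A ^ i.val
      map_one' := by
        change A ^ (0 : ZMod n).val = 1
        simp
      map_mul' := by
        have hpow : ∀ m : ℕ, A ^ m * B * A ^ m = B := by
          intro m
          induction m with
          | zero => simp
          | succ m ih =>
            calc A ^ (m + 1) * B * A ^ (m + 1) = A ^ m * (A * B * A) * A ^ m := by
                  rw [pow_succ]; nth_rewrite 2 [← pow_succ]; rw [pow_succ']; simp only [mul_assoc]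
              _ = B := by rw [hAB, ih]
        have hsub : ∀ i j : ZMod n, A ^ i.val * B * A ^ j.val = B * A ^ (j - i).val := by
          intro i j
          have : A ^ j.val = A ^ i.val * A ^ (j - i).val := by
            rw [← pow_val_add hA]; simp
          rw [this, ← mul_assoc, hpow]
        rintro (i | i) (j | j)
        · exact pow_val_add hA i j
        · change B * A ^ (j - i).val = A ^ i.val * (B * A ^ j.val)
          rw [← mul_assoc, hsub]
        · change B * A ^ (i + j).val = B * A ^ i.val * A ^ j.val
          rw [pow_val_add hA, mul_assoc]
        · change A ^ (j - i).val = B * A ^ i.val * (B * A ^ j.val)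
          rw [mul_assoc, ← mul_assoc (A ^ i.val), hsub, ← mul_assoc, hB, one_mul] }

/-- The representation `a ^ i ↦ A ^ i` of a subgroup of `C_n = ⟨a⟩ ≤ D_n`. -/
def rotationRep [NeZero n] {m : ℕ} (H : Subgroup (DihedralGroup n)) (hH : ∀ i, sr i ∉ H)
    (A : Matrix (Fin m) (Fin m) k) (hA : A ^ n = 1) : Representation k H (Fin m → k) :=
  ((Matrix.toLinAlgEquiv' : Matrix (Fin m) (Fin m) k ≃ₐ[k] _) :
      Matrix (Fin m) (Fin m) k →* Module.End k (Fin m → k)).comp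
    { toFun := fun x => match x.1 with
        | r i => A ^ i.val
        | sr _ => 1
      map_one' := by
        change A ^ (0 : ZMod n).val = 1
        simp
      map_mul' := by
        rintro ⟨(i | i), hi⟩ ⟨(j | j), hj⟩
        · exact pow_val_add hA i j
        · exact absurd hj (hH j)
        · exact absurd hi (hH i)
        · exact absurd hi (hH i) }

lemma sr_notMem_zpowers (i : ZMod n) :
    sr i ∉ Subgroup.zpowers (r 1 : DihedralGroup n) := by
  rintro ⟨z, hz⟩
  simp at hz

lemma sr_notMem_centralizer {l : ℕ} (hl : 1 ≤ l) (hl' : l ≤ n / 2 - 1) (i : ZMod n) :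
    sr i ∉ Subgroup.centralizer {(r (l : ZMod n) : DihedralGroup n)} := by
  intro h
  have h1 := Subgroup.mem_centralizer_singleton_iff.mp h
  rw [sr_mul_r, r_mul_sr] at h1
  have h2 : i + (l : ZMod n) = i - l := by injection h1
  have h3 : ((2 * l : ℕ) : ZMod n) = 0 := by
    push_cast
    linear_combination h2
  rw [ZMod.natCast_eq_zero_iff] at h3
  have := Nat.le_of_dvd (by omega) h3
  omega

lemma eq_zero_or_eq_half [NeZero n] (hn : Even n) {i : ZMod n} (h : i + i = 0) :
    i = 0 ∨ i = ((n / 2 : ℕ) : ZMod n) := by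
  obtain ⟨m, hm⟩ := hn
  have h1 : ((i.val + i.val : ℕ) : ZMod n) = 0 := by
    push_cast
    simpa using h
  rw [ZMod.natCast_eq_zero_iff] at h1
  have h2 := ZMod.val_lt i
  obtain ⟨q, hq⟩ := h1
  have : q = 0 ∨ q = 1 := by
    by_contra hcon
    have : 2 ≤ q := by omega
    have : n * 2 ≤ n * q := Nat.mul_le_mul_left n this
    omega
  rcases this with rfl | rfl
  · left
    rw [← ZMod.val_eq_zero]; omega
  · right
    rw [← ZMod.natCast_zmod_val i]
    congr 1; omega

lemma half_add_half (hn : Even n) : ((n / 2 : ℕ) : ZMod n) + ((n / 2 : ℕ) : ZMod n) = 0 := by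
  rw [← Nat.cast_add, ← two_mul, Nat.two_mul_div_two_of_even hn, ZMod.natCast_self]

lemma half_ne_zero [NeZero n] (hn : Even n) : ((n / 2 : ℕ) : ZMod n) ≠ 0 := by
  intro h
  rw [ZMod.natCast_eq_zero_iff] at h
  have h0 := NeZero.ne n
  obtain ⟨m, hm⟩ := hn
  have := Nat.le_of_dvd (by omega) h
  omega

lemma rotation_half_mem_center (hn : Even n) :
    (r ((n / 2 : ℕ) : ZMod n) : DihedralGroup n) ∈ Subgroup.center (DihedralGroup n) := by
  rw [Subgroup.mem_center_iff]
  have h := half_add_half hn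
  rintro (i | i)
  · rw [r_mul_r, r_mul_r, add_comm]
  · rw [sr_mul_r, r_mul_sr]
    congr 1
    linear_combination h

/-- The sign character of the Klein four group `C(sr c) = {1, a^{n/2}, sr c, a^{n/2} sr c}`
with `a^{n/2} ↦ e₁` and `sr c ↦ e₂`. -/
def kleinCharacter [NeZero n] (hn : Even n) (c : ZMod n) (e₁ e₂ : ℤˣ) :
    Subgroup.centralizer {(sr c : DihedralGroup n)} →* ℤˣ where
  toFun x := match x.1 with
    | r i => if i = 0 then 1 else e₁
    | sr i => (if i = c then 1 else e₁) * e₂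
  map_one' := by
    change (if (0 : ZMod n) = 0 then (1 : ℤˣ) else e₁) = 1
    simp
  map_mul' := by
    have h0 := half_ne_zero hn
    have hh := half_add_half hn
    have hR : ∀ i, r i ∈ Subgroup.centralizer {(sr c : DihedralGroup n)} →
        i = 0 ∨ i = ((n / 2 : ℕ) : ZMod n) := by
      intro i hi
      have h1 := Subgroup.mem_centralizer_singleton_iff.mp hi
      rw [sr_mul_r, r_mul_sr] at h1
      have h2 : c - i = c + i := by injection h1
      exact eq_zero_or_eq_half hn (by linear_combination -h2)
    have hS : ∀ i, sr i ∈ Subgroup.centralizer {(sr c : DihedralGroup n)} →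
        i = c ∨ i = c + ((n / 2 : ℕ) : ZMod n) := by
      intro i hi
      have h1 := Subgroup.mem_centralizer_singleton_iff.mp hi
      rw [sr_mul_sr, sr_mul_sr] at h1
      have h2 : c - i = i - c := by injection h1
      rcases eq_zero_or_eq_half hn (i := i - c) (by linear_combination -h2) with h | h
      · left; linear_combination h
      · right; linear_combination h
    generalize ((n / 2 : ℕ) : ZMod n) = z at h0 hh hR hS
    have hz : -z = z := by linear_combination -hh
    have hcz : c + z ≠ c := by simpa using h0
    have he : e₁ * e₁ = 1 := Int.units_mul_self e₁
    have he₂ : e₂ * e₂ = 1 := Int.units_mul_self e₂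
    rintro ⟨(i | i), hi⟩ ⟨(j | j), hj⟩
    · change (if i + j = 0 then (1 : ℤˣ) else e₁) =
        (if i = 0 then 1 else e₁) * (if j = 0 then 1 else e₁)
      rcases hR i hi with rfl | rfl <;> rcases hR j hj with rfl | rfl <;> simp [h0, hh, he]
    · change (if j - i = c then (1 : ℤˣ) else e₁) * e₂ =
        (if i = 0 then 1 else e₁) * ((if j = c then 1 else e₁) * e₂)
      rcases hR i hi with rfl | rfl <;> rcases hS j hj with rfl | rfl <;>
        simp [h0, sub_eq_add_neg, hz, add_assoc, hh, ← mul_assoc, he]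
    · change (if i + j = c then (1 : ℤˣ) else e₁) * e₂ =
        ((if i = c then 1 else e₁) * e₂) * (if j = 0 then 1 else e₁)
      rcases hS i hi with rfl | rfl <;> rcases hR j hj with rfl | rfl <;>
        simp [h0, add_assoc, hh, mul_right_comm, he, mul_comm e₂]
    · change (if j - i = 0 then (1 : ℤˣ) else e₁) =
        ((if i = c then 1 else e₁) * e₂) * ((if j = c then 1 else e₁) * e₂)
      rw [mul_mul_mul_comm, he₂, mul_one]
      rcases hS i hi with rfl | rfl <;> rcases hS j hj with rfl | rfl <;> simp [h0, hz, he]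

/-- The one-dimensional representation of `C(sr c)` given by `kleinCharacter`. -/
def kleinRep (k : Type u) [Field k] [NeZero n] (hn : Even n) (c : ZMod n) (e₁ e₂ : ℤˣ) :
    Representation k (Subgroup.centralizer {(sr c : DihedralGroup n)}) k :=
  (algebraMap k (Module.End k k) : k →* Module.End k k).comp
    (((Int.castRingHom k : ℤ →* k).comp (Units.coeHom ℤ)).comp (kleinCharacter hn c e₁ e₂))

end DihedralRepresentations

/-! ## The list of Yetter-Drinfeld modules -/

/-- The standing assumptions: `k` is a field of odd prime characteristic `p`, `n = p ^ s * t` is even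
with `p ∤ t`, and `ξ ∈ k` is a primitive `t`-th root of unity. -/
structure EvenDihedralSetting (k : Type u) [Field k] (p s t n : ℕ) (ξ : k) : Prop where
  prime : p.Prime
  ne_two : p ≠ 2
  charP : CharP k p
  n_eq : n = p ^ s * t
  not_dvd : ¬ p ∣ t
  even : Even n
  primitive : IsPrimitiveRoot ξ t

namespace EvenDihedralSetting

variable {k : Type u} [Field k] {p s t n : ℕ} {ξ : k} 

lemma neZero (h : EvenDihedralSetting k p s t n ξ) : NeZero n := by
  refine ⟨?_⟩
  rw [h.n_eq]
  have : t ≠ 0 := by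
    rintro rfl
    exact h.not_dvd (dvd_zero _)
  exact mul_ne_zero (pow_ne_zero _ h.prime.ne_zero) this

lemma even_t (h : EvenDihedralSetting k p s t n ξ) : Even t := by
  have h1 := h.even
  rw [h.n_eq, Nat.even_mul] at h1
  rcases h1 with h1 | h1
  · exact absurd ((Nat.Prime.even_iff h.prime).1 (Nat.even_pow.1 h1).1) h.ne_two
  · exact h1

lemma half_pow_sq (h : EvenDihedralSetting k p s t n ξ) : (ξ ^ (t / 2)) ^ 2 = 1 := by
  rw [← pow_mul, Nat.div_two_mul_two_of_even h.even_t, h.primitive.pow_eq_one]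

lemma jordanMatrix_pow (h : EvenDihedralSetting k p s t n ξ) {m : ℕ} (hm : m ≤ p ^ s) {c : k}
    (hc : c ^ t = 1) : jordanMatrix m c ^ n = 1 := by
  have := Fact.mk h.prime
  have := h.charP
  rw [h.n_eq]
  exact jordanMatrix_pow_eq_one hm c hc

/-- The representation `a ↦ A`, `b ↦ e T` of `D_n`, where `A` is the `m × m` Jordan block with
eigenvalue `c = ± 1`, `T` is the matrix `involutionMatrix m c`, and `e = ± 1`. -/
def phiRep (h : EvenDihedralSetting k p s t n ξ) (m : ℕ) (hm : m ≤ p ^ s) (c : k) (hc : c ^ 2 = 1)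
    (e : ℤˣ) : Representation k (DihedralGroup n) (Fin m → k) :=
  have := h.neZero
  have he : ((e : ℤ) : k) * ((e : ℤ) : k) = 1 := by
    rw [← Int.cast_mul, ← Units.val_mul, Int.units_mul_self]; simp
  dihedralRep (jordanMatrix m c) (((e : ℤ) : k) • involutionMatrix m c)
    (h.jordanMatrix_pow hm (by
      obtain ⟨q, hq⟩ := h.even_t
      rw [hq, ← two_mul, pow_mul, hc, one_pow]))
    (by rw [Matrix.smul_mul, Matrix.mul_smul, involutionMatrix_sq, smul_smul, he, one_smul])
    (by rw [Matrix.mul_smul, Matrix.smul_mul, jordanMatrix_mul_involutionMatrix_mul m c hc])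

/-- The representation `ρ_{m,j}` of a subgroup `H` of `C_n = ⟨a⟩`: it sends `a` to the `m × m`
Jordan block with eigenvalue `ξ ^ j`. -/
def rhoRep (h : EvenDihedralSetting k p s t n ξ) (H : Subgroup (DihedralGroup n))
    (hH : ∀ i, DihedralGroup.sr i ∉ H) (m : ℕ) (hm : m ≤ p ^ s) (j : ℕ) :
    Representation k H (Fin m → k) :=
  have := h.neZero
  rotationRep H hH (jordanMatrix m (ξ ^ j))
    (h.jordanMatrix_pow hm (by
      rw [← pow_mul, mul_comm, pow_mul, h.primitive.pow_eq_one, one_pow]))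

end EvenDihedralSetting

/-- The index set of the modules `V_{r,0}`, `V'_{r,0}`, `V_{r,t/2}`, `V'_{r,t/2}` and `W_{2r,i}`, where
`1 ≤ r ≤ q` and `1 ≤ i ≤ t/2 - 1`. -/
inductive DihedralIndex (q t : ℕ) : Type
  | V0 (r : Set.Icc 1 q)
  | V0' (r : Set.Icc 1 q)
  | VHalf (r : Set.Icc 1 q)
  | VHalf' (r : Set.Icc 1 q)
  | W (r : Set.Icc 1 q) (i : Set.Icc 1 (t / 2 - 1))

/-- The index set of the list of Yetter-Drinfeld modules: the representations `x` of `D_n` in degree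
`1` and in degree `a^{n/2}`, the modules `D(V_m)` and `D(U_m)` (the index `m` is replaced by the pair
of signs that defines the character), and `D(Q_{r,j}^l)`. -/
inductive YDIndex (q t n : ℕ) : Type
  | degreeOne (x : DihedralIndex q t)
  | degreeHalf (x : DihedralIndex q t)
  | V (e₁ e₂ : ℤˣ)
  | U (e₁ e₂ : ℤˣ)
  | Q (r : Set.Icc 1 q) (j : Fin t) (l : Set.Icc 1 (n / 2 - 1))

namespace EvenDihedralSetting

variable {k : Type u} [Field k] {p s t n : ℕ} {ξ : k}

/-- The listed representations of `D_n`, with all vectors in degree `z` for a central `z`. The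
module `W_{2r,i}` is induced from the representation `ρ_{r,i}` of `C_n = ⟨a⟩`. -/
def centralModule (h : EvenDihedralSetting k p s t n ξ) (z : DihedralGroup n)
    (hz : z ∈ Subgroup.center (DihedralGroup n)) :
    DihedralIndex (p ^ s) t → YDModule.{u, u, u} k (MonoidAlgebra k (DihedralGroup n))
  | .V0 r => YDModule.central z hz (h.phiRep r r.2.2 1 (one_pow 2) 1)
  | .V0' r => YDModule.central z hz (h.phiRep r r.2.2 1 (one_pow 2) (-1))
  | .VHalf r => YDModule.central z hz (h.phiRep r r.2.2 (ξ ^ (t / 2)) h.half_pow_sq 1)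
  | .VHalf' r => YDModule.central z hz (h.phiRep r r.2.2 (ξ ^ (t / 2)) h.half_pow_sq (-1))
  | .W r i => YDModule.central z hz
      (Representation.ind (Subgroup.zpowers (DihedralGroup.r 1 : DihedralGroup n)).subtype
        (h.rhoRep _ sr_notMem_zpowers r r.2.2 i))

/-- The list of Yetter-Drinfeld modules. Here `b = sr 0` and `a b = sr (-1)`. -/
def ydModule (h : EvenDihedralSetting k p s t n ξ) :
    YDIndex (p ^ s) t n → YDModule.{u, u, u} k (MonoidAlgebra k (DihedralGroup n))
  | .degreeOne x => h.centralModule 1 (one_mem _) x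
  | .degreeHalf x => h.centralModule (DihedralGroup.r ((n / 2 : ℕ) : ZMod n))
      (rotation_half_mem_center h.even) x
  | .V e₁ e₂ =>
      have := h.neZero
      YDModule.induced (DihedralGroup.sr 0 : DihedralGroup n) (kleinRep k h.even 0 e₁ e₂)
  | .U e₁ e₂ =>
      have := h.neZero
      YDModule.induced (DihedralGroup.sr (-1) : DihedralGroup n) (kleinRep k h.even (-1) e₁ e₂)
  | .Q r j l => YDModule.induced (DihedralGroup.r ((l : ℕ) : ZMod n) : DihedralGroup n)
      (h.rhoRep _ (sr_notMem_centralizer l.2.1 l.2.2) r r.2.2 j)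

end EvenDihedralSetting

end

/-! For a finite group `G`, a Yetter-Drinfeld `kG`-module is a representation `M` of `G` with a
decomposition `M = ⨁ M_g` such that `x` carries `M_g` to `M_{x g x⁻¹}`. The same data form a
`D(kG)`-module, since the functions `φ_g` act as the projections to the degrees.

For `D_n` the degree decomposition is refined by weights, on which `D_n` still acts. In a rotation
degree `a ^ l` one splits by the eigenvalues of `a ^ (p ^ s)`. This operator has order dividing `t`,
so it is diagonalizable, and because `(a - ξ ^ j) ^ (p ^ s) = a ^ (p ^ s) - ξ ^ (j p ^ s)` its
eigenspaces are the generalized eigenspaces of `a`. In the degree of a reflection one splits by the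
signs by which `a ^ (n / 2)` and the reflection act. The refinement changes neither the submodules
nor the isomorphisms (`isGradedSub_weightProj_iff`, `isIso_iff_weightProj`).

For a representation graded by a finite `G`-set there is a reduction of Clifford type. An
indecomposable module is supported on one orbit and is generated by any nonzero component `M_i`. A
module generated by `M_i` is determined by `M_i` as a representation of the stabilizer of `i`
(`IsGenerated.exists_linearEquiv`), and indecomposability passes between the two
(`IsGenerated.isGradedIndecomposable`, `IsGenerated.eq_bot_or_eq_bot_of_indecomposable`).

It remains to find the indecomposable representations of the stabilizers with the prescribed weight.
The weight `(l, j)` has stabilizer `C_n`, or all of `D_n` when `-l = l` and `-j = j`. A reflection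
weight has a Klein four group as stabilizer, which acts by scalars, so its component is a line. For
`C_n` the answer is a Jordan block. For `D_n` it is a Jordan block for `a` together with `b ↦ ± T`.
Both come from `exists_jordanMatrix_equiv`: a block of maximal size splits off compatibly with an
involution `S`, because its generator and a linear form that is nonzero on its socle can both be
chosen to be eigenvectors of `S` when `2` is invertible.

A module is thus described by a label: a weight up to the action of `D_n`, a block size `m ≤ p ^ s`
and a sign, which matters only at weights fixed by `b`. Every indecomposable module has a label
(`exists_hasLabel`), equal labels give isomorphic modules (`isIso_of_hasLabel`), and labels are
unique up to the choice of weight in its orbit (`HasLabel.mem_orbit`, `HasLabel.unique`). The listed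
modules realize each label with a canonical weight exactly once. -/

/-! ## Representations graded by a `G`-set -/

section Grading

variable {k G Ω M M' N : Type*} [Field k] [Group G] [MulAction G Ω] [Fintype Ω]
  [AddCommGroup M] [Module k M] [AddCommGroup M'] [Module k M'] [AddCommGroup N] [Module k N]

/-- A grading of a representation of `G` by a finite `G`-set `Ω`, given by its projections: the
element `x` maps the component of `i` to the component of `x • i`. -/
structure IsGrading (ρ : Representation k G M) (P : Ω → Module.End k M) : Prop where
  apply_of_ne : ∀ {i j}, i ≠ j → ∀ m, P i (P j m) = 0
  sum_apply : ∀ m, ∑ i, P i m = m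
  map_apply : ∀ x i m, ρ x (P i m) = P (x • i) (ρ x m)

/-- A graded subrepresentation. -/
def IsGradedSub {G Ω : Type*} [Group G] (ρ : Representation k G M) (P : Ω → Module.End k M)
    (W : Submodule k M) : Prop :=
  (∀ x, ∀ m ∈ W, ρ x m ∈ W) ∧ ∀ i, ∀ m ∈ W, P i m ∈ W

/-- A graded representation that is nonzero and not a direct sum of two nonzero graded
subrepresentations. -/
def IsGradedIndecomposable {G Ω : Type*} [Group G] (ρ : Representation k G M)
    (P : Ω → Module.End k M) : Prop :=
  Nontrivial M ∧ ∀ W₁ W₂ : Submodule k M, IsGradedSub ρ P W₁ → IsGradedSub ρ P W₂ →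
    IsCompl W₁ W₂ → W₁ = ⊥ ∨ W₂ = ⊥

/-- The component of degree `i` is the image of the injective map `f`, and it generates `M`. -/
structure IsGenerated (ρ : Representation k G M) (P : Ω → Module.End k M) (i : Ω)
    (f : N →ₗ[k] M) : Prop where
  injective : Function.Injective f
  apply_self : ∀ n, P i (f n) = f n
  stable : ∀ x : G, x • i = i → ∀ n, ∃ n', ρ x (f n) = f n'
  eq_top : ∀ W : Submodule k M, (∀ x n, ρ x (f n) ∈ W) → W = ⊤

/-! ### Orbit summands and coinduced subrepresentations -/

namespace IsGrading

variable {ρ : Representation k G M} {P : Ω → Module.End k M}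

lemma apply_apply_self (h : IsGrading ρ P) (i : Ω) (m : M) : P i (P i m) = P i m := by
  have h1 := h.sum_apply (P i m)
  rwa [Finset.sum_eq_single i (fun j _ hj => h.apply_of_ne hj m) (by simp)] at h1

lemma map_inv_apply (h : IsGrading ρ P) (x : G) (i : Ω) (m : M) :
    P i (ρ x m) = ρ x (P (x⁻¹ • i) m) := by
  rw [h.map_apply, smul_inv_smul]

/-- The largest graded subrepresentation whose component of degree `i` is contained in `D`. -/
def coinduce {G Ω : Type*} [Group G] (ρ : Representation k G M) (P : Ω → Module.End k M) (i : Ω) (D : Submodule k M) :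
    Submodule k M :=
  ⨅ x : G, D.comap (P i ∘ₗ ρ x)

lemma mem_coinduce {G Ω : Type*} [Group G] {ρ : Representation k G M} {P : Ω → Module.End k M}
    {i : Ω} {D : Submodule k M} {m : M} :
    m ∈ coinduce ρ P i D ↔ ∀ x, P i (ρ x m) ∈ D := by
  simp [coinduce]

lemma coinduce_isGradedSub (h : IsGrading ρ P) (i : Ω) (D : Submodule k M) :
    IsGradedSub ρ P (coinduce ρ P i D) := by
  constructor
  · intro y m hm
    rw [mem_coinduce] at hm ⊢
    intro x
    have := hm (x * y)
    rwa [map_mul] at this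
  · intro j m hm
    rw [mem_coinduce] at hm ⊢
    intro x
    rw [h.map_apply]
    by_cases hx : x • j = i
    · rw [hx, h.apply_apply_self]; exact hm x
    · rw [h.apply_of_ne (Ne.symm hx)]; exact zero_mem _

/-- An element outside the stabilizer moves a vector of degree `i` to another degree, where `P i`
kills it. Hence only the stabilizer imposes a condition on `D`. -/
lemma le_coinduce (h : IsGrading ρ P) {i : Ω} {D : Submodule k M} (hD : ∀ m ∈ D, P i m = m)
    (hs : ∀ x : G, x • i = i → ∀ m ∈ D, ρ x m ∈ D) : D ≤ coinduce ρ P i D := by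
  intro m hm
  rw [mem_coinduce]
  intro x
  have e : ρ x m = P (x • i) (ρ x m) := by rw [← h.map_apply, hD m hm]
  by_cases hx : x • i = i
  · rw [hx] at e
    rw [← e]; exact hs x hx m hm
  · rw [e, h.apply_of_ne (Ne.symm hx)]; exact zero_mem _

/-- The sum of the components in the orbit of `i` is a graded direct summand. -/
lemma exists_isCompl_of_orbit (h : IsGrading ρ P) (i : Ω) :
    ∃ W₁ W₂ : Submodule k M, IsGradedSub ρ P W₁ ∧ IsGradedSub ρ P W₂ ∧ IsCompl W₁ W₂ ∧
      LinearMap.range (P i) ≤ W₁ ∧ ∀ W : Submodule k M,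
        (∀ x m, ρ x (P i m) ∈ W) → W₁ ≤ W := by
  classical
  -- The projection to the components in the orbit. It commutes with `G` because orbits are stable,
  -- and with every `P j`, so its range and kernel are complementary graded subrepresentations.
  let π : Module.End k M := ∑ j ∈ Finset.univ.filter (fun j => j ∈ MulAction.orbit G i), P j
  have hπ : ∀ m, π m = ∑ j ∈ Finset.univ.filter (fun j => j ∈ MulAction.orbit G i), P j m := by
    intro m; simp [π]
  have hP : ∀ j m, P j (π m) = if j ∈ MulAction.orbit G i then P j m else 0 := by
    intro j m
    rw [hπ, map_sum]
    split_ifs with hj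
    · rw [Finset.sum_eq_single j (fun l _ hl => h.apply_of_ne (Ne.symm hl) m) (by simp [hj]),
        h.apply_apply_self]
    · apply Finset.sum_eq_zero
      intro l hl
      apply h.apply_of_ne
      rintro rfl
      exact hj (Finset.mem_filter.mp hl).2
  have hρ : ∀ x m, ρ x (π m) = π (ρ x m) := by
    intro x m
    -- The two sides are compared in each degree `j`; there `x⁻¹ • j` and `j` lie in the orbit of
    -- `i` or outside it together.
    rw [← h.sum_apply (ρ x (π m)), ← h.sum_apply (π (ρ x m))]
    refine Finset.sum_congr rfl fun j _ => ?_
    rw [h.map_inv_apply, hP, hP, h.map_inv_apply]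
    have : x⁻¹ • j ∈ MulAction.orbit G i ↔ j ∈ MulAction.orbit G i := by
      rw [← MulAction.orbit_eq_iff, MulAction.orbit_smul, MulAction.orbit_eq_iff]
    by_cases hj : j ∈ MulAction.orbit G i
    · rw [if_pos hj, if_pos (this.2 hj)]
    · rw [if_neg hj, if_neg (fun hh => hj (this.1 hh)), map_zero]
  have hPπ : ∀ j m, P j (π m) = π (P j m) := by
    intro j m
    rw [hP, ← h.sum_apply (π (P j m)), Finset.sum_eq_single j]
    · rw [hP, h.apply_apply_self]
    · intro l _ hl
      rw [hP, h.apply_of_ne hl, ite_self]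
    · simp
  have hππ : ∀ m, π (π m) = π m := by
    intro m
    refine (hπ (π m)).trans ((Finset.sum_congr rfl fun j hj => ?_).trans (hπ m).symm)
    rw [hP, if_pos (Finset.mem_filter.mp hj).2]
  refine ⟨LinearMap.range π, LinearMap.ker π, ⟨?_, ?_⟩, ⟨?_, ?_⟩, ?_, ?_, ?_⟩
  · rintro x _ ⟨m, rfl⟩; exact ⟨ρ x m, (hρ x m).symm⟩
  · rintro j _ ⟨m, rfl⟩; exact ⟨P j m, (hPπ j m).symm⟩
  · intro x m hm
    rw [LinearMap.mem_ker] at hm ⊢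
    rw [← hρ, hm, map_zero]
  · intro j m hm
    rw [LinearMap.mem_ker] at hm ⊢
    rw [← hPπ, hm, map_zero]
  · constructor
    · rw [Submodule.disjoint_def]
      rintro _ ⟨m, rfl⟩ hm
      rw [LinearMap.mem_ker, hππ] at hm
      exact hm
    · rw [codisjoint_iff, eq_top_iff]
      intro m _
      rw [show m = π m + (m - π m) by abel]
      refine Submodule.add_mem_sup ⟨m, rfl⟩ ?_
      rw [LinearMap.mem_ker, map_sub, hππ, sub_self]
  · rintro _ ⟨m, rfl⟩
    refine ⟨P i m, ?_⟩
    rw [← hPπ, hP, if_pos (MulAction.mem_orbit_self i)]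
  · rintro W hW _ ⟨m, rfl⟩
    rw [hπ]
    refine Submodule.sum_mem _ fun j hj => ?_
    obtain ⟨x, rfl⟩ := (Finset.mem_filter.mp hj).2
    have := hW x (ρ x⁻¹ m)
    rwa [h.map_apply, ← Module.End.mul_apply (ρ x), ← map_mul, mul_inv_cancel, map_one] at this

lemma exists_apply_ne_zero (h : IsGrading ρ P) [Nontrivial M] : ∃ i m, P i m ≠ 0 := by
  by_contra! hc
  obtain ⟨m, hm⟩ := exists_ne (0 : M)
  exact hm (by rw [← h.sum_apply m]; exact Finset.sum_eq_zero fun i _ => hc i m)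

/-- A nonzero component of an indecomposable graded representation generates it. -/
lemma isGenerated_of_indecomposable (h : IsGrading ρ P) (hM : IsGradedIndecomposable ρ P) {i : Ω}
    (hi : ∃ m, P i m ≠ 0) : IsGenerated ρ P i (LinearMap.range (P i)).subtype := by
  refine ⟨Subtype.val_injective, ?_, ?_, ?_⟩
  · rintro ⟨_, m, rfl⟩; exact h.apply_apply_self i m
  · rintro x hx ⟨_, m, rfl⟩
    exact ⟨⟨P i (ρ x m), ρ x m, rfl⟩, by simp [h.map_apply, hx]⟩
  · intro W hW
    obtain ⟨W₁, W₂, h1, h2, h3, h4, h5⟩ := h.exists_isCompl_of_orbit i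
    have hle := h5 W fun x m => hW x ⟨P i m, m, rfl⟩
    -- The orbit summand `W₁` contains the nonzero component of degree `i`, so its complement must
    -- vanish.
    rcases hM.2 W₁ W₂ h1 h2 h3 with rfl | rfl
    · obtain ⟨m, hm⟩ := hi
      exact absurd (by simpa using h4 ⟨m, rfl⟩) hm
    · rw [← top_le_iff, ← codisjoint_iff.1 h3.codisjoint, sup_bot_eq]
      exact hle

end IsGrading

/-! ### Reduction of a graded representation to one component -/

namespace IsGenerated

variable {ρ : Representation k G M} {P : Ω → Module.End k M} {i : Ω} {f : N →ₗ[k] M}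

/-- On a generator `ρ x (f n)` there are two cases: `x` fixes `i` and the vector stays in the image
of `f`, or `x` moves `i` and the projection kills it. The generators span. -/
lemma apply_mem_range (h : IsGrading ρ P) (hf : IsGenerated ρ P i f) (m : M) :
    ∃ n, P i m = f n := by
  have key : (LinearMap.range f).comap (P i) = ⊤ := by
    apply hf.eq_top
    intro x n
    rw [Submodule.mem_comap, ← hf.apply_self n, h.map_apply]
    by_cases hx : x • i = i
    · obtain ⟨n', hn'⟩ := hf.stable x hx n
      rw [hx, h.apply_apply_self, hn', hf.apply_self]
      exact ⟨n', rfl⟩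
    · rw [h.apply_of_ne (Ne.symm hx)]; exact zero_mem _
  obtain ⟨n, hn⟩ : m ∈ (LinearMap.range f).comap (P i) := key ▸ Submodule.mem_top
  exact ⟨n, hn.symm⟩

lemma apply_eq_zero (h : IsGrading ρ P) (hf : IsGenerated ρ P i f) {j : Ω}
    (hj : j ∉ MulAction.orbit G i) (m : M) : P j m = 0 := by
  have key : LinearMap.ker (P j) = ⊤ := by
    apply hf.eq_top
    intro x n
    rw [LinearMap.mem_ker, ← hf.apply_self n, h.map_apply]
    apply h.apply_of_ne
    rintro rfl
    exact hj ⟨x, rfl⟩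
  exact LinearMap.mem_ker.1 (key ▸ Submodule.mem_top : m ∈ LinearMap.ker (P j))

/-- Only degrees in the orbit of `i` occur, and the group carries each of them back to degree `i`.
So a vector is detected by the degree `i` parts of its translates; this makes the component of
degree `i` control the whole module. -/
lemma eq_zero (h : IsGrading ρ P) (hf : IsGenerated ρ P i f) {m : M}
    (hm : ∀ x, P i (ρ x m) = 0) : m = 0 := by
  rw [← h.sum_apply m]
  refine Finset.sum_eq_zero fun j _ => ?_
  by_cases hj : j ∈ MulAction.orbit G i
  · obtain ⟨x, rfl⟩ := hj
    have := congrArg (ρ x) (hm x⁻¹)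
    rwa [h.map_apply, ← Module.End.mul_apply (ρ x), ← map_mul, mul_inv_cancel, map_one,
      map_zero] at this
  · exact apply_eq_zero h hf hj m

/-- If `j` were outside the orbit of `i`, generation from `i` would make all degree `j` parts
vanish, while generation from `j` says that these parts detect every vector. -/
lemma mem_orbit (h : IsGrading ρ P) (hf : IsGenerated ρ P i f) [Nontrivial M] {N' : Type*}
    [AddCommGroup N'] [Module k N'] {j : Ω} {f' : N' →ₗ[k] M} (hf' : IsGenerated ρ P j f') :
    j ∈ MulAction.orbit G i := by
  by_contra hj
  obtain ⟨m, hm⟩ := exists_ne (0 : M)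
  exact hm (eq_zero h hf' fun x => apply_eq_zero h hf hj _)

/-- Pulling back along `f` turns complementary graded subrepresentations into disjoint subspaces
stable under the stabilizer, and a graded subrepresentation with zero pullback is zero.
Complementarity of the pullbacks is not needed, which suits components in which any two nonzero
stable subspaces meet. -/
lemma isGradedIndecomposable (h : IsGrading ρ P) (hf : IsGenerated ρ P i f) [Nontrivial N]
    (hN : ∀ D₁ D₂ : Submodule k N,
      (∀ x : G, x • i = i → ∀ n ∈ D₁, ∀ n', ρ x (f n) = f n' → n' ∈ D₁) →
      (∀ x : G, x • i = i → ∀ n ∈ D₂, ∀ n', ρ x (f n) = f n' → n' ∈ D₂) →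
      Disjoint D₁ D₂ → D₁ = ⊥ ∨ D₂ = ⊥) : IsGradedIndecomposable ρ P := by
  refine ⟨hf.injective.nontrivial, fun W₁ W₂ h1 h2 h3 => ?_⟩
  have hs : ∀ W : Submodule k M, IsGradedSub ρ P W → ∀ x : G, x • i = i →
      ∀ n ∈ W.comap f, ∀ n', ρ x (f n) = f n' → n' ∈ W.comap f := by
    intro W hW x _ n hn n' e
    rw [Submodule.mem_comap, ← e]
    exact hW.1 x _ hn
  have hb : ∀ W : Submodule k M, IsGradedSub ρ P W → W.comap f = ⊥ → W = ⊥ := by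
    intro W hW hbot
    rw [eq_bot_iff]
    intro m hm
    refine eq_zero h hf fun x => ?_
    obtain ⟨n, hn⟩ := apply_mem_range h hf (ρ x m)
    have : n ∈ W.comap f := by
      rw [Submodule.mem_comap, ← hn]
      exact hW.2 _ _ (hW.1 _ _ hm)
    rw [hbot, Submodule.mem_bot] at this
    rw [hn, this, map_zero]
  refine (hN _ _ (hs W₁ h1) (hs W₂ h2) ?_).imp (hb W₁ h1) (hb W₂ h2)
  rw [Submodule.disjoint_def]
  intro n hn1 hn2
  exact hf.injective (by rw [map_zero]; exact (Submodule.disjoint_def.1 h3.disjoint) _ hn1 hn2)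

/-- A graded subrepresentation that misses the component is zero by detection, and one that contains
the component is everything by generation. -/
lemma eq_bot_or_eq_top (h : IsGrading ρ P) (hf : IsGenerated ρ P i f)
    (hN : ∀ D : Submodule k N, D = ⊥ ∨ D = ⊤) {W : Submodule k M} (hW : IsGradedSub ρ P W) :
    W = ⊥ ∨ W = ⊤ := by
  refine (hN (W.comap f)).imp (fun hbot => ?_) fun htop => hf.eq_top W fun x n => hW.1 x _ ?_
  · rw [eq_bot_iff]
    intro m hm
    refine eq_zero h hf fun x => ?_
    obtain ⟨n, hn⟩ := apply_mem_range h hf (ρ x m)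
    have : n ∈ W.comap f := by
      rw [Submodule.mem_comap, ← hn]
      exact hW.2 _ _ (hW.1 _ _ hm)
    rw [hbot, Submodule.mem_bot] at this
    rw [hn, this, map_zero]
  · have : n ∈ W.comap f := htop ▸ Submodule.mem_top
    exact this

/-- Converse direction: a splitting of the component extends to a splitting of `M` by coinduction.
The coinduced subrepresentations meet in zero because the degree `i` parts detect vectors, and they
span because together they contain the generators. -/
lemma eq_bot_or_eq_bot_of_indecomposable (h : IsGrading ρ P) (hf : IsGenerated ρ P i f)
    (hM : IsGradedIndecomposable ρ P) {D₁ D₂ : Submodule k N}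
    (h1 : ∀ x : G, x • i = i → ∀ n ∈ D₁, ∃ n' ∈ D₁, ρ x (f n) = f n')
    (h2 : ∀ x : G, x • i = i → ∀ n ∈ D₂, ∃ n' ∈ D₂, ρ x (f n) = f n')
    (hD : IsCompl D₁ D₂) : D₁ = ⊥ ∨ D₂ = ⊥ := by
  have hle : ∀ D : Submodule k N, (∀ x : G, x • i = i → ∀ n ∈ D, ∃ n' ∈ D, ρ x (f n) = f n') →
      D.map f ≤ IsGrading.coinduce ρ P i (D.map f) := by
    intro D hs
    apply h.le_coinduce
    · rintro _ ⟨n, _, rfl⟩; exact hf.apply_self n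
    · rintro x hx _ ⟨n, hn, rfl⟩
      obtain ⟨n', hn', e⟩ := hs x hx n hn
      exact ⟨n', hn', e.symm⟩
  have hb : ∀ D : Submodule k N, (∀ x : G, x • i = i → ∀ n ∈ D, ∃ n' ∈ D, ρ x (f n) = f n') →
      IsGrading.coinduce ρ P i (D.map f) = ⊥ → D = ⊥ := by
    intro D hs hbot
    have := hle D hs
    rw [hbot, le_bot_iff] at this
    rw [eq_bot_iff]
    intro n hn
    have hn' : f n ∈ D.map f := ⟨n, hn, rfl⟩
    rw [this, Submodule.mem_bot] at hn'
    exact hf.injective (hn'.trans (map_zero f).symm)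
  refine (hM.2 _ _ (h.coinduce_isGradedSub i (D₁.map f)) (h.coinduce_isGradedSub i (D₂.map f))
    ⟨?_, ?_⟩).imp (hb D₁ h1) (hb D₂ h2)
  · rw [Submodule.disjoint_def]
    intro m hm1 hm2
    rw [IsGrading.mem_coinduce] at hm1 hm2
    refine eq_zero h hf fun x => ?_
    obtain ⟨n1, hn1, e1⟩ := hm1 x
    obtain ⟨n2, hn2, e2⟩ := hm2 x
    have : n1 = n2 := hf.injective (e1.trans e2.symm)
    subst this
    rw [← e1, Submodule.disjoint_def.1 hD.disjoint _ hn1 hn2, map_zero]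
  · rw [codisjoint_iff]
    apply hf.eq_top
    intro x n
    obtain ⟨a, ha, b, hb, rfl⟩ : ∃ a ∈ D₁, ∃ b ∈ D₂, a + b = n := by
      rw [← Submodule.mem_sup, codisjoint_iff.1 hD.codisjoint]; trivial
    rw [map_add, map_add]
    exact Submodule.add_mem_sup
      ((h.coinduce_isGradedSub i _).1 x _ (hle D₁ h1 ⟨a, ha, rfl⟩))
      ((h.coinduce_isGradedSub i _).1 x _ (hle D₂ h2 ⟨b, hb, rfl⟩))

/-- Graded representations that are generated by isomorphic components are isomorphic. -/
lemma exists_linearEquiv (h : IsGrading ρ P) (hf : IsGenerated ρ P i f)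
    {ρ' : Representation k G M'} {P' : Ω → Module.End k M'} (h' : IsGrading ρ' P')
    {f' : N →ₗ[k] M'} (hf' : IsGenerated ρ' P' i f')
    (hff' : ∀ x : G, x • i = i → ∀ n, ∃ n', ρ x (f n) = f n' ∧ ρ' x (f' n) = f' n') :
    ∃ e : M ≃ₗ[k] M', (∀ x m, e (ρ x m) = ρ' x (e m)) ∧ ∀ j m, e (P j m) = P' j (e m) := by
  -- The graph of the isomorphism: pairs whose translates under every `x` have degree `i` parts
  -- parametrized by the same element of `N`. It is stable under the group and the projections and
  -- contains all pairs `(f n, f' n)`.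
  let Γ : Submodule k (M × M') :=
    ⨅ x : G, (LinearMap.range (f.prod f')).comap ((P i ∘ₗ ρ x).prodMap (P' i ∘ₗ ρ' x))
  have hΓ : ∀ z, z ∈ Γ ↔ ∀ x, ∃ n, f n = P i (ρ x z.1) ∧ f' n = P' i (ρ' x z.2) := by
    intro z
    simp [Γ, Prod.ext_iff]
  have hρ : ∀ z ∈ Γ, ∀ y, (ρ y z.1, ρ' y z.2) ∈ Γ := by
    intro z hz y
    rw [hΓ] at hz ⊢
    intro x
    have := hz (x * y)
    rwa [map_mul, map_mul] at this
  have hP : ∀ z ∈ Γ, ∀ j, (P j z.1, P' j z.2) ∈ Γ := by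
    intro z hz j
    rw [hΓ] at hz ⊢
    intro x
    simp only [h.map_apply, h'.map_apply]
    by_cases hx : x • j = i
    · rw [hx, h.apply_apply_self, h'.apply_apply_self]; exact hz x
    · rw [h.apply_of_ne (Ne.symm hx), h'.apply_of_ne (Ne.symm hx)]
      exact ⟨0, map_zero _, map_zero _⟩
  have hmem : ∀ n, (f n, f' n) ∈ Γ := by
    intro n
    rw [hΓ]
    intro x
    by_cases hx : x • i = i
    · obtain ⟨n', e1, e2⟩ := hff' x hx n
      exact ⟨n', by simp only [e1, hf.apply_self], by simp only [e2, hf'.apply_self]⟩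
    · refine ⟨0, ?_, ?_⟩
      · simp only
        rw [map_zero, ← hf.apply_self n, h.map_apply, h.apply_of_ne (Ne.symm hx)]
      · simp only
        rw [map_zero, ← hf'.apply_self n, h'.map_apply, h'.apply_of_ne (Ne.symm hx)]
  let p₁ : Γ →ₗ[k] M := LinearMap.fst k M M' ∘ₗ Γ.subtype
  let p₂ : Γ →ₗ[k] M' := LinearMap.snd k M M' ∘ₗ Γ.subtype
  -- Injectivity holds because a pair with first entry zero has a second entry with no degree `i`
  -- parts; surjectivity holds because the image contains the generators.
  have b₁ : Function.Bijective p₁ := by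
    constructor
    · rw [← LinearMap.ker_eq_bot, LinearMap.ker_eq_bot']
      rintro ⟨⟨m, m'⟩, hz⟩ (rfl : m = 0)
      have : m' = 0 := eq_zero h' hf' fun x => by
        obtain ⟨n, e1, e2⟩ := (hΓ _).1 hz x
        simp only at e1 e2
        rw [map_zero, map_zero, ← map_zero f] at e1
        rw [← e2, hf.injective e1, map_zero]
      subst this; rfl
    · rw [← LinearMap.range_eq_top]
      exact hf.eq_top _ fun x n => ⟨⟨_, hρ _ (hmem n) x⟩, rfl⟩
  have b₂ : Function.Bijective p₂ := by
    constructor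
    · rw [← LinearMap.ker_eq_bot, LinearMap.ker_eq_bot']
      rintro ⟨⟨m, m'⟩, hz⟩ (rfl : m' = 0)
      have : m = 0 := eq_zero h hf fun x => by
        obtain ⟨n, e1, e2⟩ := (hΓ _).1 hz x
        simp only at e1 e2
        rw [map_zero, map_zero, ← map_zero f'] at e2
        rw [← e1, hf'.injective e2, map_zero]
      subst this; rfl
    · rw [← LinearMap.range_eq_top]
      exact hf'.eq_top _ fun x n => ⟨⟨_, hρ _ (hmem n) x⟩, rfl⟩
  let e := (LinearEquiv.ofBijective p₁ b₁).symm.trans (LinearEquiv.ofBijective p₂ b₂)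
  have he : ∀ z ∈ Γ, e z.1 = z.2 := by
    intro z hz
    have : (LinearEquiv.ofBijective p₁ b₁).symm z.1 = ⟨z, hz⟩ := by
      rw [LinearEquiv.symm_apply_eq]; rfl
    simp only [e, LinearEquiv.trans_apply, this]
    rfl
  have hG : ∀ m, (m, e m) ∈ Γ := by
    intro m
    obtain ⟨⟨z, hz⟩, rfl⟩ := b₁.2 m
    have := he z hz
    change (z.1, e z.1) ∈ Γ
    rwa [this]
  exact ⟨e, fun x m => he _ (hρ _ (hG m) x), fun j m => he _ (hP _ (hG m) j)⟩

end IsGenerated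

end Grading

/-! ## Jordan blocks -/

section JordanBlocks

open Matrix

variable {k : Type*} [Field k] {r : ℕ}

lemma jordanMatrix_mulVec_castSucc (c : k) (x : Fin (r + 1) → k) (i : Fin r) :
    (jordanMatrix (r + 1) c *ᵥ x) i.castSucc = c * x i.castSucc + x i.succ := by
  have : ∀ j, jordanMatrix (r + 1) c i.castSucc j * x j =
      (if i.castSucc = j then c * x j else 0) + (if i.succ = j then x j else 0) := by
    intro j
    have e : ((i.castSucc : Fin (r + 1)) : ℕ) + 1 = j ↔ i.succ = j := by
      simp [Fin.ext_iff]
    simp only [jordanMatrix, Matrix.of_apply, e]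
    by_cases h : i.castSucc = j
    · subst h
      simp [Fin.ext_iff]
    · simp [h]
  simp [Matrix.mulVec, dotProduct, this, Finset.sum_add_distrib]

lemma jordanMatrix_mulVec_last (c : k) (x : Fin (r + 1) → k) :
    (jordanMatrix (r + 1) c *ᵥ x) (Fin.last r) = c * x (Fin.last r) := by
  have : ∀ j, jordanMatrix (r + 1) c (Fin.last r) j * x j =
      if Fin.last r = j then c * x j else 0 := by
    intro j
    have e : ¬ ((Fin.last r : Fin (r + 1)) : ℕ) + 1 = j := by
      have := j.2
      simp only [Fin.val_last]; omega
    simp only [jordanMatrix, Matrix.of_apply, e, if_false]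
    split_ifs <;> simp
  simp [Matrix.mulVec, dotProduct, this]

lemma jordanMatrix_mulVec (c : k) (x : Fin (r + 1) → k) :
    jordanMatrix (r + 1) c *ᵥ x = c • x + jordanMatrix (r + 1) 0 *ᵥ x := by
  ext i
  induction i using Fin.lastCases with
  | last => simp [jordanMatrix_mulVec_last]
  | cast i => simp [jordanMatrix_mulVec_castSucc]

lemma sub_smul_mem_of_jordanMatrix {c : k} {D : Submodule k (Fin (r + 1) → k)}
    (hD : ∀ x ∈ D, jordanMatrix (r + 1) c *ᵥ x ∈ D) {x : Fin (r + 1) → k} (hx : x ∈ D) :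
    jordanMatrix (r + 1) 0 *ᵥ x ∈ D := by
  have := D.sub_mem (hD x hx) (D.smul_mem c hx)
  rwa [jordanMatrix_mulVec, add_sub_cancel_left] at this

/-- A nonzero subspace that is stable under a Jordan block contains the first basis vector. -/
lemma single_zero_mem_of_jordanMatrix {c : k} {D : Submodule k (Fin (r + 1) → k)}
    (hD : ∀ x ∈ D, jordanMatrix (r + 1) c *ᵥ x ∈ D) (hne : D ≠ ⊥) :
    Pi.single 0 1 ∈ D := by
  -- Here `m` bounds the support of `x`. The nilpotent part shifts coordinates down, so it lowers
  -- `m`; when it kills `x`, only the coordinate `0` is left.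
  have key : ∀ m : ℕ, ∀ x ∈ D, x ≠ 0 → (∀ j : Fin (r + 1), m ≤ j → x j = 0) →
      Pi.single 0 1 ∈ D := by
    intro m
    induction m with
    | zero => exact fun x _ h0 hx => absurd (funext fun j => hx j (Nat.zero_le _)) h0
    | succ m ih =>
      intro x hxD h0 hx
      by_cases hN : jordanMatrix (r + 1) 0 *ᵥ x = 0
      · have hs : ∀ j : Fin r, x j.succ = 0 := by
          intro j
          have := congrFun hN j.castSucc
          rwa [jordanMatrix_mulVec_castSucc, zero_mul, zero_add] at this
        have hx0 : x = x 0 • Pi.single 0 1 := by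
          ext j
          induction j using Fin.cases with
          | zero => simp
          | succ j => simp [hs j]
        have h00 : x 0 ≠ 0 := by
          intro h
          rw [h, zero_smul] at hx0
          exact h0 hx0
        rw [hx0] at hxD
        exact (D.smul_mem_iff h00).1 hxD
      · refine ih _ (sub_smul_mem_of_jordanMatrix hD hxD) hN fun j hj => ?_
        induction j using Fin.lastCases with
        | last => rw [jordanMatrix_mulVec_last, zero_mul]
        | cast j =>
          rw [jordanMatrix_mulVec_castSucc, zero_mul, zero_add]
          apply hx
          simpa using hj
  obtain ⟨x, hx, h0⟩ := D.ne_bot_iff.1 hne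
  exact key (r + 1) x hx h0 fun j hj => absurd j.2 (by omega)

/-- Two nonzero stable subspaces share the eigenline of the block, so they cannot be disjoint. -/
lemma eq_bot_or_eq_bot_of_jordanMatrix {c : k} {D₁ D₂ : Submodule k (Fin (r + 1) → k)}
    (h1 : ∀ x ∈ D₁, jordanMatrix (r + 1) c *ᵥ x ∈ D₁)
    (h2 : ∀ x ∈ D₂, jordanMatrix (r + 1) c *ᵥ x ∈ D₂) (hD : Disjoint D₁ D₂) :
    D₁ = ⊥ ∨ D₂ = ⊥ := by
  by_contra! hc
  have := Submodule.disjoint_def.1 hD _ (single_zero_mem_of_jordanMatrix h1 hc.1)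
    (single_zero_mem_of_jordanMatrix h2 hc.2)
  simpa using congrFun this 0

/-- The last basis vector generates the space as a module over a Jordan block. -/
lemma eq_top_of_single_last_mem {c : k} {D : Submodule k (Fin (r + 1) → k)}
    (hD : ∀ x ∈ D, jordanMatrix (r + 1) c *ᵥ x ∈ D) (hl : Pi.single (Fin.last r) 1 ∈ D) :
    D = ⊤ := by
  -- The nilpotent part sends each basis vector to the previous one, hence the downward induction.
  have key : ∀ i : Fin (r + 1), Pi.single i (1 : k) ∈ D := by
    intro i
    induction i using Fin.reverseInduction with
    | last => exact hl
    | cast i ih =>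
      have : jordanMatrix (r + 1) 0 *ᵥ Pi.single i.succ (1 : k) = Pi.single i.castSucc 1 := by
        ext j
        induction j using Fin.lastCases with
        | last =>
          rw [jordanMatrix_mulVec_last, zero_mul, Pi.single_eq_of_ne]
          exact (Fin.castSucc_lt_last i).ne'
        | cast j =>
          rw [jordanMatrix_mulVec_castSucc, zero_mul, zero_add]
          by_cases h : j = i
          · subst h; simp
          · rw [Pi.single_eq_of_ne (by simpa using h), Pi.single_eq_of_ne (by simpa using h)]
      rw [← this]
      exact sub_smul_mem_of_jordanMatrix hD ih
  rw [eq_top_iff]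
  intro x _
  rw [pi_eq_sum_univ' x]
  refine D.sum_mem fun i _ => ?_
  have := D.smul_mem (x i) (key i)
  convert this using 2

/-- The last coordinate of `T x` is the last coordinate of `x`. -/
lemma involutionMatrix_mulVec_last (c : k) (x : Fin (r + 1) → k) :
    (involutionMatrix (r + 1) c *ᵥ x) (Fin.last r) = x (Fin.last r) := by
  rw [Matrix.mulVec, dotProduct, Finset.sum_eq_single (Fin.last r)]
  · simp [involutionMatrix, involutionEntry]
  · intro j _ hj
    have : ∃ v, ((j.rev : Fin (r + 1)) : ℕ) = v + 1 := by
      refine ⟨r - j - 1, ?_⟩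
      have := Fin.val_lt_last hj
      rw [Fin.val_rev]; omega
    obtain ⟨v, hv⟩ := this
    simp only [involutionMatrix, Matrix.of_apply, hv, Fin.rev_last, Fin.val_zero, involutionEntry,
      zero_mul]
  · simp

/-- The last column of `T` consists of the powers of `-c`, and multiplying it by the block
telescopes because `c ^ 2 = 1`. So the generator of the block is an eigenvector of `a b`; for blocks
of size at least two it is not one of `b`. -/
lemma jordanMatrix_mulVec_involutionMatrix_mulVec_single_last {c : k} (hc : c ^ 2 = 1) :
    jordanMatrix (r + 1) c *ᵥ (involutionMatrix (r + 1) c *ᵥ Pi.single (Fin.last r) 1) =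
      c • Pi.single (Fin.last r) 1 := by
  ext i
  induction i using Fin.lastCases with
  | last => rw [jordanMatrix_mulVec_last, involutionMatrix_mulVec_last]; simp
  | cast i =>
    rw [jordanMatrix_mulVec_castSucc, Matrix.mulVec_single_one]
    have h1 : ((i.castSucc.rev : Fin (r + 1)) : ℕ) = ((i.succ.rev : Fin (r + 1)) : ℕ) + 1 := by
      have := i.2
      simp only [Fin.val_rev, Fin.val_castSucc, Fin.val_succ]; omega
    simp only [Matrix.col_apply, involutionMatrix, Matrix.of_apply, h1, Fin.rev_last,
      Fin.val_zero, involutionEntry]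
    rw [Pi.smul_apply, Pi.single_eq_of_ne (Fin.castSucc_lt_last i).ne]
    linear_combination (-involutionEntry c (i.succ.rev : ℕ) 0) * hc

/-- The sign is determined by the representation `a ↦ A`, `b ↦ e T`. -/
lemma sign_eq_of_linearEquiv {c : k} {η η' : k}
    (e : (Fin (r + 1) → k) ≃ₗ[k] (Fin (r + 1) → k))
    (hJ : ∀ x, e (jordanMatrix (r + 1) c *ᵥ x) = jordanMatrix (r + 1) c *ᵥ e x)
    (hT : ∀ x, e (η • involutionMatrix (r + 1) c *ᵥ x) =
      η' • involutionMatrix (r + 1) c *ᵥ e x) : η = η' := by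
  set y := e (Pi.single (Fin.last r) 1) with hy
  -- A map commuting with the block acts on the last coordinate, the top of the module, by a scalar.
  -- The matrix `T` acts there by `1`, so comparing the two signs on this coordinate decides the
  -- claim.
  have key : ∀ x, e x (Fin.last r) = x (Fin.last r) * y (Fin.last r) := by
    let D : Submodule k (Fin (r + 1) → k) :=
      LinearMap.ker (LinearMap.proj (Fin.last r) ∘ₗ e.toLinearMap -
        y (Fin.last r) • LinearMap.proj (Fin.last r))
    have hD : ∀ x, x ∈ D ↔ e x (Fin.last r) = x (Fin.last r) * y (Fin.last r) := by
      intro x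
      simp [D, sub_eq_zero, mul_comm]
    have : D = ⊤ := by
      apply eq_top_of_single_last_mem (c := c)
      · intro x hx
        rw [hD] at hx ⊢
        rw [hJ, jordanMatrix_mulVec_last, jordanMatrix_mulVec_last, hx, mul_assoc]
      · rw [hD]; simp [hy]
    intro x
    rw [← hD, this]; trivial
  -- If the scalar were zero, the last coordinate would vanish on the image of `e`, contradicting
  -- surjectivity.
  have hne : y (Fin.last r) ≠ 0 := by
    intro h0
    have := key (e.symm (Pi.single (Fin.last r) 1))
    rw [h0, mul_zero, e.apply_symm_apply] at this
    simp at this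
  have h1 := congrFun (hT (Pi.single (Fin.last r) 1)) (Fin.last r)
  rw [map_smul, Pi.smul_apply, Pi.smul_apply, key, involutionMatrix_mulVec_last,
    involutionMatrix_mulVec_last, ← hy, Pi.single_eq_same, one_mul, smul_eq_mul, smul_eq_mul] at h1
  exact mul_right_cancel₀ hne h1

/-! ### Splitting off a Jordan block compatibly with an involution -/

variable {V : Type*} [AddCommGroup V] [Module k V]

/-- The two candidates add up to `2 x`. This is used to project a vector or a linear form to an
eigenspace of an involution without losing a prescribed nonvanishing. -/
lemma exists_sign_add_ne_zero (h2 : (2 : k) ≠ 0) {x y : V} (hx : x ≠ 0) :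
    ∃ η : ℤˣ, x + ((η : ℤ) : k) • y ≠ 0 := by
  by_contra! hc
  have h1 := hc 1
  have h3 := hc (-1)
  simp only [Units.val_one, Int.cast_one, one_smul, Units.val_neg, Int.cast_neg, neg_smul] at h1 h3
  have : (2 : k) • x = 0 := by
    rw [two_smul]
    calc x + x = (x + y) + (x + -y) := by abel
      _ = 0 := by rw [h1, h3, add_zero]
  exact hx ((smul_eq_zero.1 this).resolve_left h2)

lemma units_intCast_mul_self (η : ℤˣ) : ((η : ℤ) : k) * ((η : ℤ) : k) = 1 := by
  rw [← Int.cast_mul, ← Units.val_mul, Int.units_mul_self]; simp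

/-- Let `A` be an endomorphism with the single eigenvalue `c` and let `S` be an involution that
normalizes the powers of `A`. If the space is indecomposable under `A` and `S`, then `A` is a
Jordan block with respect to some basis, whose last vector is an eigenvector of `S`. -/
lemma exists_jordanMatrix_equiv [FiniteDimensional k V] [Nontrivial V] (h2 : (2 : k) ≠ 0)
    {A S : Module.End k V} {c : k} (hA : IsNilpotent (A - c • 1)) (hS : S * S = 1)
    (hAS : ∀ i : ℕ, ∃ j : ℕ, A ^ i * S = S * A ^ j)
    (hind : ∀ D₁ D₂ : Submodule k V, (∀ m ∈ D₁, A m ∈ D₁) → (∀ m ∈ D₁, S m ∈ D₁) →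
      (∀ m ∈ D₂, A m ∈ D₂) → (∀ m ∈ D₂, S m ∈ D₂) → IsCompl D₁ D₂ → D₁ = ⊥ ∨ D₂ = ⊥) :
    ∃ (r : ℕ) (f : (Fin (r + 1) → k) ≃ₗ[k] V) (η : ℤˣ),
      (∀ x, f (jordanMatrix (r + 1) c *ᵥ x) = A (f x)) ∧
      S (f (Pi.single (Fin.last r) 1)) = ((η : ℤ) : k) • f (Pi.single (Fin.last r) 1) ∧
      ∀ m : ℕ, (A - c • 1) ^ m = 0 → r + 1 ≤ m := by
  classical
  set N : Module.End k V := A - c • 1 with hN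
  have hAN : ∀ v, A v = N v + c • v := by intro v; simp [hN]
  have hSS : ∀ v, S (S v) = v := fun v => LinearMap.congr_fun hS v
  -- The size `r + 1` of the block is the nilpotency index of `N`.
  obtain ⟨r, hr, hr'⟩ : ∃ r, N ^ (r + 1) = 0 ∧ N ^ r ≠ 0 := by
    have h0 : Nat.find hA ≠ 0 := by
      intro h0
      have := Nat.find_spec hA
      rw [h0, pow_zero] at this
      exact one_ne_zero this
    obtain ⟨r, hr⟩ := Nat.exists_eq_succ_of_ne_zero h0
    refine ⟨r, ?_, ?_⟩
    · have := Nat.find_spec hA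
      rwa [hr] at this
    · exact Nat.find_min hA (by omega)
  have hstab : ∀ D : Submodule k V, (∀ m ∈ D, A m ∈ D) → ∀ i : ℕ, ∀ m ∈ D, (N ^ i) m ∈ D := by
    intro D hD i
    induction i with
    | zero => intro m hm; simpa using hm
    | succ i ih =>
      intro m hm
      rw [pow_succ, Module.End.mul_apply]
      apply ih
      have := D.sub_mem (hD m hm) (D.smul_mem c hm)
      rwa [hAN, add_sub_cancel_right] at this
  have hstabA : ∀ D : Submodule k V, (∀ m ∈ D, A m ∈ D) → ∀ i : ℕ, ∀ m ∈ D, (A ^ i) m ∈ D := by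
    intro D hD i
    induction i with
    | zero => intro m hm; simpa using hm
    | succ i ih =>
      intro m hm
      rw [pow_succ, Module.End.mul_apply]
      exact ih _ (hD m hm)
  -- a homogeneous generator of maximal order
  obtain ⟨v, η, hv, hSv⟩ : ∃ (v : V) (η : ℤˣ), (N ^ r) v ≠ 0 ∧ S v = ((η : ℤ) : k) • v := by
    obtain ⟨v₀, hv₀⟩ : ∃ v₀, (N ^ r) v₀ ≠ 0 := by
      by_contra! hc
      exact hr' (LinearMap.ext hc)
    -- The average `v₀ + η S v₀` is an eigenvector of `S` for either sign; the sign is chosen so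
    -- that `N ^ r` does not kill it.
    obtain ⟨η, hη⟩ := exists_sign_add_ne_zero h2 (y := (N ^ r) (S v₀)) hv₀
    refine ⟨v₀ + ((η : ℤ) : k) • S v₀, η, by rwa [map_add, map_smul], ?_⟩
    rw [map_add, map_smul, hSS, smul_add, smul_smul, units_intCast_mul_self, one_smul, add_comm]
  -- a homogeneous linear form which does not vanish on the socle of the module generated by `v`
  obtain ⟨φ, σ, hφ, hφS⟩ : ∃ (φ : V →ₗ[k] k) (σ : ℤˣ), φ ((N ^ r) v) ≠ 0 ∧
      ∀ w, φ (S w) = ((σ : ℤ) : k) * φ w := by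
    obtain ⟨φ₀, hφ₀⟩ : ∃ φ₀ : V →ₗ[k] k, φ₀ ((N ^ r) v) ≠ 0 := by
      by_contra! hc
      exact hv ((Module.forall_dual_apply_eq_zero_iff k _).1 hc)
    obtain ⟨σ, hσ⟩ := exists_sign_add_ne_zero h2 (y := φ₀ (S ((N ^ r) v))) hφ₀
    refine ⟨φ₀ + ((σ : ℤ) : k) • (φ₀ ∘ₗ S), σ, by simpa using hσ, fun w => ?_⟩
    simp only [LinearMap.add_apply, LinearMap.smul_apply, LinearMap.comp_apply, hSS, smul_eq_mul]
    linear_combination (-φ₀ (S w)) * units_intCast_mul_self (k := k) σ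
  -- The Jordan basis generated by `v`: the vector with index `j` goes to `N ^ (r - j) v`, so that
  -- `N` lowers the index by one and the last vector is `v`.
  let g : (Fin (r + 1) → k) →ₗ[k] V :=
    Fintype.linearCombination k (fun j : Fin (r + 1) => (N ^ (r - (j : ℕ))) v)
  have hgs : ∀ x, g x = ∑ j, x j • (N ^ (r - (j : ℕ))) v := by
    intro x; simp [g, Fintype.linearCombination_apply]
  have hgl : g (Pi.single (Fin.last r) 1) = v := by
    simp [g, Fintype.linearCombination_apply_single]
  have hg0 : g (Pi.single 0 1) = (N ^ r) v := by
    simp [g, Fintype.linearCombination_apply_single]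
  have hgN : ∀ x, g (jordanMatrix (r + 1) 0 *ᵥ x) = N (g x) := by
    intro x
    rw [hgs, hgs, map_sum, Fin.sum_univ_castSucc, Fin.sum_univ_succ, jordanMatrix_mulVec_last,
      zero_mul, zero_smul, add_zero, map_smul, ← Module.End.mul_apply, ← pow_succ']
    have : (N ^ (r - ((0 : Fin (r + 1)) : ℕ) + 1)) v = 0 := by
      rw [Fin.val_zero, Nat.sub_zero, hr]; rfl
    rw [this, smul_zero, zero_add]
    refine Finset.sum_congr rfl fun i _ => ?_
    rw [jordanMatrix_mulVec_castSucc, zero_mul, zero_add, map_smul, ← Module.End.mul_apply,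
      ← pow_succ', Fin.val_succ, Fin.val_castSucc]
    congr 3
    have := i.2
    omega
  have hgA : ∀ x, g (jordanMatrix (r + 1) c *ᵥ x) = A (g x) := by
    intro x
    rw [jordanMatrix_mulVec, map_add, map_smul, hgN, hAN, add_comm]
  -- Reading off `φ (N ^ i w)` also intertwines `N` with the nilpotent block, so the kernel of `h`
  -- is a candidate for a stable complement to the image of `g`.
  let h : V →ₗ[k] (Fin (r + 1) → k) := LinearMap.pi fun i => φ ∘ₗ (N ^ (i : ℕ))
  have hh : ∀ w i, h w i = φ ((N ^ (i : ℕ)) w) := fun w i => rfl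
  have hhN : ∀ w, h (N w) = jordanMatrix (r + 1) 0 *ᵥ h w := by
    intro w
    ext i
    rw [hh, ← Module.End.mul_apply, ← pow_succ]
    induction i using Fin.lastCases with
    | last => rw [jordanMatrix_mulVec_last, Fin.val_last, hr]; simp
    | cast i => rw [jordanMatrix_mulVec_castSucc, hh, hh]; simp
  -- A nonzero kernel would be stable and so contain the first basis vector, whose image under `g`
  -- is `N ^ r v`; but `φ (N ^ r v) ≠ 0`.
  have hinj : Function.Injective (h ∘ₗ g) := by
    rw [← LinearMap.ker_eq_bot]
    by_contra hne
    have := single_zero_mem_of_jordanMatrix (c := 0) (D := LinearMap.ker (h ∘ₗ g)) (by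
      intro x hx
      rw [LinearMap.mem_ker, LinearMap.comp_apply] at hx ⊢
      rw [hgN, hhN, hx, mulVec_zero]) hne
    rw [LinearMap.mem_ker, LinearMap.comp_apply, hg0] at this
    exact hφ (by simpa [hh] using congrFun this 0)
  have hsurj : Function.Surjective (h ∘ₗ g) := LinearMap.injective_iff_surjective.1 hinj
  have hginj : Function.Injective g := fun x y e => hinj (congrArg h e)
  have hcompl : IsCompl (LinearMap.range g) (LinearMap.ker h) := by
    constructor
    · rw [Submodule.disjoint_def]
      rintro _ ⟨x, rfl⟩ hx
      rw [hinj (a₁ := x) (a₂ := 0) (by rw [map_zero]; exact hx), map_zero]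
    · rw [codisjoint_iff, eq_top_iff]
      intro m _
      obtain ⟨x, hx⟩ := hsurj (h m)
      rw [show m = g x + (m - g x) by abel]
      refine Submodule.add_mem_sup ⟨x, rfl⟩ ?_
      rw [LinearMap.mem_ker, map_sub, sub_eq_zero]
      exact hx.symm
  have hrA : ∀ m ∈ LinearMap.range g, A m ∈ LinearMap.range g := by
    rintro _ ⟨x, rfl⟩; exact ⟨_, hgA x⟩
  have hkA : ∀ m ∈ LinearMap.ker h, A m ∈ LinearMap.ker h := by
    intro m hm
    rw [LinearMap.mem_ker] at hm ⊢
    rw [hAN, map_add, map_smul, hhN, hm, mulVec_zero, smul_zero, add_zero]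
  have hvr : v ∈ LinearMap.range g := ⟨_, hgl⟩
  -- Since `S A = A ^ j S` for some `j`, the preimage of the image of `g` under `S` is stable under
  -- `A`. It contains the generator `v`, which is an eigenvector of `S`.
  have hrS : ∀ m ∈ LinearMap.range g, S m ∈ LinearMap.range g := by
    obtain ⟨j, hj⟩ := hAS 1
    rw [pow_one] at hj
    have hj' : ∀ m, S (A m) = (A ^ j) (S m) := by
      intro m
      have := LinearMap.congr_fun hj (S m)
      simp only [Module.End.mul_apply, hSS] at this
      rw [this, hSS]
    have hD : ∀ m ∈ (LinearMap.range g).comap S, A m ∈ (LinearMap.range g).comap S := by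
      intro m hm
      rw [Submodule.mem_comap, hj']
      exact hstabA _ hrA j _ hm
    have hvD : v ∈ (LinearMap.range g).comap S := by
      rw [Submodule.mem_comap, hSv]
      exact Submodule.smul_mem _ _ hvr
    rintro _ ⟨x, rfl⟩
    rw [← Submodule.mem_comap, hgs]
    exact Submodule.sum_mem _ fun i _ => Submodule.smul_mem _ _ (hstab _ hD _ _ hvD)
  -- The kernel of `h` is cut out by the forms `φ ∘ A ^ i` as well as by the `φ ∘ N ^ i`. In the
  -- first description stability is visible: `φ (A ^ i S m) = φ (S A ^ j m)`, and `φ` is an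
  -- eigenform of `S`.
  have hkS : ∀ m ∈ LinearMap.ker h, S m ∈ LinearMap.ker h := by
    intro m hm
    have h1 : ∀ i : ℕ, φ ((A ^ i) m) = 0 := by
      intro i
      have := congrFun (LinearMap.mem_ker.1 (hstabA _ hkA i m hm)) 0
      rwa [hh, Fin.val_zero, pow_zero] at this
    let D : Submodule k V := ⨅ i : ℕ, LinearMap.ker (φ ∘ₗ (A ^ i))
    have hD : ∀ w, w ∈ D ↔ ∀ i : ℕ, φ ((A ^ i) w) = 0 := by intro w; simp [D]
    have hDA : ∀ w ∈ D, A w ∈ D := by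
      intro w hw
      rw [hD] at hw ⊢
      intro i
      rw [← Module.End.mul_apply, ← pow_succ]
      exact hw _
    have hSD : S m ∈ D := by
      rw [hD]
      intro i
      obtain ⟨j, hj⟩ := hAS i
      rw [← Module.End.mul_apply, hj, Module.End.mul_apply, hφS, h1, mul_zero]
    rw [LinearMap.mem_ker]
    ext i
    rw [hh]
    have := (hD _).1 (hstab D hDA i _ hSD) 0
    rwa [pow_zero] at this
  -- Indecomposability leaves only one summand, and the image of `g` contains `v ≠ 0`.
  have hk : LinearMap.ker h = ⊥ := by
    refine (hind _ _ hrA hrS hkA hkS hcompl).resolve_left fun hbot => ?_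
    rw [hbot, Submodule.mem_bot] at hvr
    exact hv (by rw [hvr, map_zero])
  have hgsurj : Function.Surjective g := by
    rw [← LinearMap.range_eq_top, ← codisjoint_iff.1 hcompl.codisjoint, hk, sup_bot_eq]
  refine ⟨r, LinearEquiv.ofBijective g ⟨hginj, hgsurj⟩, η, hgA, ?_, fun m hm => ?_⟩
  · change S (g _) = _ • g _
    rw [hgl, hSv]
  · by_contra hlt
    exact hr' (pow_eq_zero_of_le (by omega) hm)

/-- An indecomposable representation of a dihedral group on which the rotation has the single
eigenvalue `c = ± 1` is given by `a ↦ A`, `b ↦ ± T` in some basis. -/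
lemma exists_jordanMatrix_involutionMatrix_equiv [FiniteDimensional k V] [Nontrivial V]
    (h2 : (2 : k) ≠ 0) {A B : Module.End k V} {c : k} (hc : c ^ 2 = 1)
    (hA : IsNilpotent (A - c • 1)) {n : ℕ} (hn : n ≠ 0) (hAn : A ^ n = 1) (hB : B * B = 1)
    (hAB : A * B * A = B)
    (hind : ∀ D₁ D₂ : Submodule k V, (∀ m ∈ D₁, A m ∈ D₁) → (∀ m ∈ D₁, B m ∈ D₁) →
      (∀ m ∈ D₂, A m ∈ D₂) → (∀ m ∈ D₂, B m ∈ D₂) → IsCompl D₁ D₂ → D₁ = ⊥ ∨ D₂ = ⊥) :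
    ∃ (r : ℕ) (f : (Fin (r + 1) → k) ≃ₗ[k] V) (η : ℤˣ),
      (∀ x, f (jordanMatrix (r + 1) c *ᵥ x) = A (f x)) ∧
      (∀ x, f (((η : ℤ) : k) • involutionMatrix (r + 1) c *ᵥ x) = B (f x)) ∧
      ∀ m : ℕ, (A - c • 1) ^ m = 0 → r + 1 ≤ m := by
  -- After this shift of the exponent, `A ^ n` is the inverse of `A`.
  obtain ⟨n, rfl⟩ := Nat.exists_eq_succ_of_ne_zero hn
  have hAn' : A * A ^ n = 1 := by rw [← pow_succ']; exact hAn
  have hnA : A ^ n * A = 1 := by rw [← pow_succ]; exact hAn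
  -- The splitting is made with the involution `A B` and not with `B`, because the last basis vector
  -- of the model is an eigenvector of the product of the block with `T`.
  have hS : (A * B) * (A * B) = 1 := by rw [← mul_assoc, hAB, hB]
  have hAS : A * (A * B) = A * B * A ^ n := by
    calc A * (A * B) = A * (A * B * A) * A ^ n := by
          rw [mul_assoc A, mul_assoc (A * B), hAn', mul_one]
      _ = A * B * A ^ n := by rw [hAB]
  have hAi : ∀ i : ℕ, A ^ i * (A * B) = A * B * A ^ (n * i) := by
    intro i
    induction i with
    | zero => simp
    | succ i ih =>
      rw [pow_succ, mul_assoc, hAS, ← mul_assoc, ih, mul_assoc, ← pow_add, Nat.mul_succ]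
  have hBS : ∀ m, B m = (A ^ n) ((A * B) m) := by
    intro m
    rw [← Module.End.mul_apply, ← mul_assoc, hnA, one_mul]
  have hpow : ∀ D : Submodule k V, (∀ m ∈ D, A m ∈ D) → ∀ i : ℕ, ∀ m ∈ D, (A ^ i) m ∈ D := by
    intro D hD i
    induction i with
    | zero => intro m hm; simpa using hm
    | succ i ih =>
      intro m hm
      rw [pow_succ, Module.End.mul_apply]
      exact ih _ (hD m hm)
  obtain ⟨r, f, η, hf, hfS, hr⟩ := exists_jordanMatrix_equiv h2 hA hS (fun i => ⟨_, hAi i⟩) (by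
    intro D₁ D₂ a1 s1 a2 s2 hD
    refine hind D₁ D₂ a1 ?_ a2 ?_ hD
    · intro m hm; rw [hBS]; exact hpow _ a1 _ _ (s1 m hm)
    · intro m hm; rw [hBS]; exact hpow _ a2 _ _ (s2 m hm))
  have hAinj : Function.Injective A := by
    intro x y hxy
    have := congrArg (A ^ n) hxy
    simpa only [← Module.End.mul_apply, hnA, Module.End.one_apply] using this
  -- On the last basis vector `A B` acts by `η` and the block times `T` acts by `c = ± 1`. Hence `B`
  -- has to be `η c T`.
  obtain ⟨η', hη'⟩ : ∃ η' : ℤˣ, ((η' : ℤ) : k) = ((η : ℤ) : k) * c := by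
    rcases mul_self_eq_one_iff.1 ((sq c).symm.trans hc) with rfl | rfl
    · exact ⟨η, by simp⟩
    · exact ⟨-η, by simp⟩
  refine ⟨r, f, η', hf, ?_, hr⟩
  -- The vectors on which `η' T` and `B` agree. This space is stable under the block because both
  -- satisfy `A B A = B`, and it contains the generator.
  let D : Submodule k (Fin (r + 1) → k) :=
    LinearMap.ker (((η' : ℤ) : k) • (f.toLinearMap ∘ₗ (involutionMatrix (r + 1) c).mulVecLin) -
      B ∘ₗ f.toLinearMap)
  have hD : ∀ x, x ∈ D ↔ f (((η' : ℤ) : k) • involutionMatrix (r + 1) c *ᵥ x) = B (f x) := by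
    intro x
    simp [D, sub_eq_zero]
  have hJTJ : ∀ x, jordanMatrix (r + 1) c *ᵥ (involutionMatrix (r + 1) c *ᵥ
      (jordanMatrix (r + 1) c *ᵥ x)) = involutionMatrix (r + 1) c *ᵥ x := by
    intro x
    rw [mulVec_mulVec, mulVec_mulVec, jordanMatrix_mul_involutionMatrix_mul _ _ hc]
  have htop : D = ⊤ := by
    apply eq_top_of_single_last_mem (c := c)
    · intro x hx
      rw [hD] at hx ⊢
      apply hAinj
      rw [map_smul, map_smul, ← hf, hJTJ, ← map_smul, hx, hf]
      exact (LinearMap.congr_fun hAB (f x)).symm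
    · rw [hD]
      apply hAinj
      rw [map_smul, map_smul, ← hf, jordanMatrix_mulVec_involutionMatrix_mulVec_single_last hc,
        map_smul, smul_smul, hη', mul_assoc, ← sq, hc, mul_one, ← hfS]
      rfl
  intro x
  rw [← hD, htop]
  trivial

end JordanBlocks

/-! ## Yetter-Drinfeld modules over a group algebra as graded representations -/

noncomputable section

namespace YDModule

variable {k : Type u} {G : Type v} [Field k] [Group G]

lemma deltaFunction_mul_of_ne {G : Type v} {g h : G} (hgh : g ≠ h) :
    (deltaFunction g * deltaFunction h : GroupFunctions k G) = 0 := by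
  classical
  funext x
  change (if g = x then (1 : k) else 0) * (if h = x then 1 else 0) = 0
  by_cases h1 : g = x
  · rw [if_neg (fun h2 : h = x => hgh (h1.trans h2.symm)), mul_zero]
  · rw [if_neg h1, zero_mul]

lemma eq_sum_deltaFunction {G : Type v} [Fintype G] (f : GroupFunctions k G) :
    f = ∑ g : G, f g • deltaFunction g := by
  classical
  funext x
  have : (∑ g : G, f g • (deltaFunction g : GroupFunctions k G)) x =
      ∑ g : G, f g * (if g = x then (1 : k) else 0) :=
    Finset.sum_apply x Finset.univ (fun g => (f g • deltaFunction g : G → k))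
  rw [this, Finset.sum_eq_single x]
  · rw [if_pos rfl]; exact (mul_one _).symm
  · intro g _ hg; rw [if_neg hg]; exact mul_zero _
  · exact fun h => absurd (Finset.mem_univ x) h

lemma sum_deltaFunction {G : Type v} [Fintype G] : ∑ g : G, (deltaFunction g : GroupFunctions k G) = 1 := by
  rw [eq_sum_deltaFunction (1 : GroupFunctions k G)]
  refine Finset.sum_congr rfl fun g _ => ?_
  change _ = (1 : k) • deltaFunction g
  rw [one_smul]

lemma smul_deltaFunction (x g : G) :
    (x • deltaFunction g : GroupFunctions k G) = deltaFunction (x * g * x⁻¹) := by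
  classical
  funext y
  change (if g = x⁻¹ * y * x then (1 : k) else 0) = if x * g * x⁻¹ = y then 1 else 0
  congr 1
  rw [eq_iff_iff]
  constructor
  · rintro rfl; group
  · rintro rfl; group

section

variable (X : YDModule.{u, max u v, w} k (MonoidAlgebra k G))

/-- The representation of `G` on a Yetter-Drinfeld `kG`-module. -/
def rep : Representation k G X.carrier :=
  (X.action : MonoidAlgebra k G →* Module.End k X.carrier).comp (MonoidAlgebra.of k G)

/-- The projection to the component of degree `g` of a Yetter-Drinfeld `kG`-module. -/
def degreeProj (g : G) : Module.End k X.carrier := X.dualAction (deltaFunction g)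

lemma degreeProj_of_ne {g h : G} (hgh : g ≠ h) (m : X.carrier) :
    X.degreeProj g (X.degreeProj h m) = 0 := by
  rw [degreeProj, degreeProj, ← Module.End.mul_apply, ← map_mul, deltaFunction_mul_of_ne hgh,
    map_zero, LinearMap.zero_apply]

lemma degreeProj_apply_self (g : G) (m : X.carrier) :
    X.degreeProj g (X.degreeProj g m) = X.degreeProj g m := by
  classical
  have : (deltaFunction g * deltaFunction g : GroupFunctions k G) = deltaFunction g := by
    funext x
    change (if g = x then (1 : k) else 0) * (if g = x then 1 else 0) = if g = x then 1 else 0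
    split_ifs <;> simp
  rw [degreeProj, ← Module.End.mul_apply, ← map_mul, this]

lemma sum_degreeProj [Fintype G] (m : X.carrier) : ∑ g, X.degreeProj g m = m := by
  simp only [degreeProj]
  rw [← LinearMap.sum_apply, ← map_sum, sum_deltaFunction, map_one, Module.End.one_apply]

lemma doubleAction_single (h : G) (f : GroupFunctions k G) :
    X.doubleAction (SkewMonoidAlgebra.single h f) = X.dualAction f * X.rep h :=
  SkewMonoidAlgebra.liftNC_single _ _ _ _

/-- This is the identity `(1 ⊗ x)(φ_g ⊗ 1) = φ_{x g x⁻¹} ⊗ x` in the quantum double, evaluated on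
`m`. -/
lemma rep_degreeProj (x g : G) (m : X.carrier) :
    X.rep x (X.degreeProj g m) = X.degreeProj (x * g * x⁻¹) (X.rep x m) := by
  have h1 := X.doubleAction_single x 1
  have h2 := X.doubleAction_single 1 (deltaFunction g)
  have h3 := X.doubleAction_single x (deltaFunction (x * g * x⁻¹))
  rw [map_one, one_mul] at h1
  rw [map_one, mul_one] at h2
  have h4 : (SkewMonoidAlgebra.single x (deltaFunction (x * g * x⁻¹)) : QuantumDouble k G) =
      SkewMonoidAlgebra.single x 1 * SkewMonoidAlgebra.single 1 (deltaFunction g) := by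
    rw [SkewMonoidAlgebra.single_mul_single, one_mul, mul_one, smul_deltaFunction]
  rw [h4, map_mul, h1, h2] at h3
  exact LinearMap.congr_fun h3 m

lemma degreeProj_apply (g : G) (m : X.carrier) :
    X.degreeProj g m = TensorProduct.rid k X.carrier
      ((deltaFunction g : GroupFunctions k G).pairing.lTensor X.carrier (X.coaction m)) := rfl

/-- For finite `G` the coaction is recovered from the degree projections, so colinearity and
subcomodules can be tested on them. -/
lemma coaction_eq_sum [Fintype G] (m : X.carrier) :
    X.coaction m = ∑ g, X.degreeProj g m ⊗ₜ[k] MonoidAlgebra.single g (1 : k) := by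
  classical
  simp only [degreeProj_apply]
  generalize X.coaction m = z
  induction z using TensorProduct.induction_on with
  | zero => simp
  | add a b ha hb =>
    conv_lhs => rw [ha, hb]
    rw [← Finset.sum_add_distrib]
    simp only [map_add, TensorProduct.add_tmul]
  | tmul a c =>
    induction c using MonoidAlgebra.induction_linear with
    | zero => simp
    | add b c hb hc =>
      rw [TensorProduct.tmul_add]
      conv_lhs => rw [hb, hc]
      rw [← Finset.sum_add_distrib]
      simp only [map_add, TensorProduct.add_tmul]
    | single y c =>
      rw [Finset.sum_eq_single y]
      · rw [LinearMap.lTensor_tmul, GroupFunctions.pairing_single, TensorProduct.rid_tmul]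
        simp [deltaFunction, TensorProduct.smul_tmul]
      · intro g _ hg
        rw [LinearMap.lTensor_tmul, GroupFunctions.pairing_single, TensorProduct.rid_tmul]
        simp [deltaFunction, hg]
      · simp

lemma degreeProj_eq_self {g : G} {m : X.carrier}
    (hm : X.coaction m = m ⊗ₜ MonoidAlgebra.single g 1) : X.degreeProj g m = m := by
  rw [degreeProj_apply, hm, LinearMap.lTensor_tmul, GroupFunctions.pairing_single,
    TensorProduct.rid_tmul]
  simp [deltaFunction]

variable {X}

lemma action_mem {W : Submodule k X.carrier} (hW : ∀ x, ∀ m ∈ W, X.rep x m ∈ W)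
    (h : MonoidAlgebra k G) {m : X.carrier} (hm : m ∈ W) : X.action h m ∈ W := by
  induction h using MonoidAlgebra.induction_linear with
  | zero => simp
  | add a b ha hb => rw [map_add]; exact W.add_mem ha hb
  | single y c =>
    have : (MonoidAlgebra.single y c : MonoidAlgebra k G) = c • MonoidAlgebra.single y 1 := by simp
    rw [this, map_smul]
    exact W.smul_mem c (hW y m hm)

lemma isSub_iff [Fintype G] {W : Submodule k X.carrier} :
    X.IsSub W ↔ IsGradedSub X.rep X.degreeProj W := by
  constructor
  · rintro ⟨h1, h2⟩
    refine ⟨fun x m hm => h1 _ m hm, fun g m hm => ?_⟩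
    obtain ⟨z, hz⟩ := h2 m hm
    rw [degreeProj_apply, ← hz]
    clear hz
    induction z using TensorProduct.induction_on with
    | zero => simp
    | add a b ha hb => simp only [map_add]; exact W.add_mem ha hb
    | tmul a c =>
      simp only [LinearMap.rTensor_tmul, LinearMap.lTensor_tmul, TensorProduct.rid_tmul]
      exact W.smul_mem _ a.2
  · rintro ⟨h1, h2⟩
    refine ⟨fun h m hm => action_mem h1 h hm, fun m hm => ?_⟩
    rw [coaction_eq_sum]
    exact Submodule.sum_mem _ fun g _ => ⟨⟨_, h2 g m hm⟩ ⊗ₜ MonoidAlgebra.single g 1, rfl⟩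

lemma isIndecomposable_iff [Fintype G] :
    X.IsIndecomposable ↔ IsGradedIndecomposable X.rep X.degreeProj := by
  simp only [IsIndecomposable, IsGradedIndecomposable, isSub_iff]

variable {Y : YDModule.{u, max u v, w'} k (MonoidAlgebra k G)}

lemma isIso_iff [Fintype G] : IsIso X Y ↔ ∃ e : X.carrier ≃ₗ[k] Y.carrier,
    (∀ x m, e (X.rep x m) = Y.rep x (e m)) ∧
      ∀ g m, e (X.degreeProj g m) = Y.degreeProj g (e m) := by
  constructor
  · rintro ⟨e, h1, h2⟩
    refine ⟨e, fun x m => h1 _ m, fun g m => ?_⟩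
    rw [degreeProj_apply, degreeProj_apply, h2]
    generalize X.coaction m = z
    induction z using TensorProduct.induction_on with
    | zero => simp
    | add a b ha hb => simp only [map_add, ha, hb]
    | tmul a c => simp
  · rintro ⟨e, h1, h2⟩
    refine ⟨e, fun h m => ?_, fun m => ?_⟩
    · induction h using MonoidAlgebra.induction_linear with
      | zero => simp
      | add a b ha hb => simp only [map_add, LinearMap.add_apply, ha, hb]
      | single y c =>
        have : (MonoidAlgebra.single y c : MonoidAlgebra k G) = c • MonoidAlgebra.single y 1 := by
          simp
        rw [this, map_smul, map_smul, LinearMap.smul_apply, LinearMap.smul_apply, map_smul]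
        exact congrArg (c • ·) (h1 y m)
    · rw [coaction_eq_sum, coaction_eq_sum, map_sum]
      refine Finset.sum_congr rfl fun g _ => ?_
      rw [LinearMap.rTensor_tmul, ← h2]
      rfl

/-! ### Modules over the quantum double -/

variable (X) in
/-- The identity map from a Yetter-Drinfeld module to the module over the quantum double. -/
def toDouble : X.carrier ≃+ X.Double := AddEquiv.refl X.carrier

lemma smul_toDouble (a : QuantumDouble k G) (m : X.carrier) :
    a • toDouble X m = toDouble X (X.doubleAction a m) := rfl

/-- The quantum double acts by combinations of degree projections and group elements. Stability
under these two kinds of operators is therefore stability under the whole algebra. -/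
lemma doubleAction_eq_sum [Fintype G] (a : QuantumDouble k G) (m : X.carrier) :
    X.doubleAction a m =
      ∑ h ∈ a.support, ∑ g, (a.coeff h) g • X.degreeProj g (X.rep h m) := by
  conv_lhs => rw [← SkewMonoidAlgebra.sum_single a]
  rw [SkewMonoidAlgebra.sum_def', map_sum, LinearMap.sum_apply]
  refine Finset.sum_congr rfl fun h _ => ?_
  rw [doubleAction_single]
  conv_lhs => rw [eq_sum_deltaFunction (a.coeff h)]
  rw [map_sum, Finset.sum_mul, LinearMap.sum_apply]
  refine Finset.sum_congr rfl fun g _ => ?_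
  rw [map_smul]
  rfl

lemma doubleAction_single_one (h : G) : X.doubleAction (SkewMonoidAlgebra.single h 1) = X.rep h := by
  rw [doubleAction_single, map_one, one_mul]

lemma doubleAction_single_deltaFunction (g : G) :
    X.doubleAction (SkewMonoidAlgebra.single 1 (deltaFunction g)) = X.degreeProj g := by
  rw [doubleAction_single, map_one, mul_one]; rfl

/-- A graded subrepresentation, as a submodule over the quantum double. -/
def doubleSubmodule [Fintype G] (W : Submodule k X.carrier)
    (hW : IsGradedSub X.rep X.degreeProj W) : Submodule (QuantumDouble k G) X.Double where
  carrier := {m | (toDouble X).symm m ∈ W}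
  add_mem' ha hb := W.add_mem ha hb
  zero_mem' := W.zero_mem
  smul_mem' a m hm := by
    obtain ⟨m, rfl⟩ := (toDouble X).surjective m
    rw [Set.mem_ofPred_eq, AddEquiv.symm_apply_apply] at hm
    rw [Set.mem_ofPred_eq, smul_toDouble, AddEquiv.symm_apply_apply, doubleAction_eq_sum]
    exact W.sum_mem fun h _ => W.sum_mem fun g _ => W.smul_mem _ (hW.2 g _ (hW.1 h m hm))

/-- The underlying subspace of a submodule over the quantum double. -/
def ofDoubleSubmodule (W : Submodule (QuantumDouble k G) X.Double) : Submodule k X.carrier where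
  carrier := {m | toDouble X m ∈ W}
  add_mem' ha hb := W.add_mem ha hb
  zero_mem' := W.zero_mem
  smul_mem' c m hm := by
    have := W.smul_mem (x := toDouble X m) (algebraMap k (QuantumDouble k G) c) hm
    rwa [smul_toDouble, AlgHom.commutes, Module.algebraMap_end_apply] at this

lemma mem_doubleSubmodule [Fintype G] {W : Submodule k X.carrier}
    {hW : IsGradedSub X.rep X.degreeProj W} {m : X.Double} :
    m ∈ doubleSubmodule W hW ↔ (toDouble X).symm m ∈ W := Iff.rfl

lemma mem_ofDoubleSubmodule {W : Submodule (QuantumDouble k G) X.Double} {m : X.carrier} :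
    m ∈ ofDoubleSubmodule W ↔ toDouble X m ∈ W := Iff.rfl

lemma isGradedSub_ofDoubleSubmodule (W : Submodule (QuantumDouble k G) X.Double) :
    IsGradedSub X.rep X.degreeProj (ofDoubleSubmodule W) := by
  constructor
  · intro x m hm
    have := W.smul_mem (x := toDouble X m) (SkewMonoidAlgebra.single x 1) hm
    rwa [smul_toDouble, doubleAction_single_one] at this
  · intro g m hm
    have := W.smul_mem (x := toDouble X m) (SkewMonoidAlgebra.single 1 (deltaFunction g)) hm
    rwa [smul_toDouble, doubleAction_single_deltaFunction] at this

/-- Subspaces over `k` and submodules over `D(kG)` live in lattices over different rings, so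
complements are compared along an additive bijection. -/
lemma isCompl_of_mem_iff {R S A B : Type*} [Ring R] [Ring S] [AddCommGroup A] [AddCommGroup B]
    [Module R A] [Module S B] (e : A ≃+ B) {W₁ W₂ : Submodule R A} {W₁' W₂' : Submodule S B}
    (h1 : ∀ a, a ∈ W₁ ↔ e a ∈ W₁') (h2 : ∀ a, a ∈ W₂ ↔ e a ∈ W₂') (h : IsCompl W₁ W₂) :
    IsCompl W₁' W₂' := by
  constructor
  · rw [Submodule.disjoint_def]
    intro b hb1 hb2
    obtain ⟨a, rfl⟩ := e.surjective b
    rw [Submodule.disjoint_def.1 h.disjoint a ((h1 a).2 hb1) ((h2 a).2 hb2), map_zero]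
  · rw [codisjoint_iff, eq_top_iff]
    intro b _
    obtain ⟨a, rfl⟩ := e.surjective b
    obtain ⟨x, hx, y, hy, rfl⟩ : ∃ x ∈ W₁, ∃ y ∈ W₂, x + y = a := by
      rw [← Submodule.mem_sup, codisjoint_iff.1 h.codisjoint]; trivial
    rw [map_add]
    exact Submodule.add_mem_sup ((h1 x).1 hx) ((h2 y).1 hy)

lemma eq_bot_of_mem_iff {R S A B : Type*} [Ring R] [Ring S] [AddCommGroup A] [AddCommGroup B]
    [Module R A] [Module S B] (e : A ≃+ B) {W : Submodule R A} {W' : Submodule S B}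
    (h1 : ∀ a, a ∈ W ↔ e a ∈ W') (h : W = ⊥) : W' = ⊥ := by
  rw [eq_bot_iff]
  intro b hb
  obtain ⟨a, rfl⟩ := e.surjective b
  rw [← h1, h, Submodule.mem_bot] at hb
  rw [hb, map_zero]
  exact zero_mem _

lemma isIndecomposableModule_double_iff [Fintype G] :
    IsIndecomposableModule (QuantumDouble k G) X.Double ↔ X.IsIndecomposable := by
  rw [isIndecomposable_iff]
  refine and_congr Iff.rfl ⟨fun h W₁ W₂ h1 h2 hc => ?_, fun h W₁ W₂ hc => ?_⟩
  · exact (h (doubleSubmodule W₁ h1) (doubleSubmodule W₂ h2)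
      (isCompl_of_mem_iff (toDouble X) (fun _ => by simp [mem_doubleSubmodule])
        (fun _ => by simp [mem_doubleSubmodule]) hc)).imp
      (eq_bot_of_mem_iff (toDouble X).symm fun _ => mem_doubleSubmodule)
      (eq_bot_of_mem_iff (toDouble X).symm fun _ => mem_doubleSubmodule)
  · exact (h (ofDoubleSubmodule W₁) (ofDoubleSubmodule W₂) (isGradedSub_ofDoubleSubmodule W₁)
      (isGradedSub_ofDoubleSubmodule W₂)
      (isCompl_of_mem_iff (toDouble X).symm (fun _ => by simp [mem_ofDoubleSubmodule])
        (fun _ => by simp [mem_ofDoubleSubmodule]) hc)).imp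
      (eq_bot_of_mem_iff (toDouble X) fun _ => mem_ofDoubleSubmodule)
      (eq_bot_of_mem_iff (toDouble X) fun _ => mem_ofDoubleSubmodule)

lemma nonempty_double_linearEquiv_iff [Fintype G] :
    Nonempty (X.Double ≃ₗ[QuantumDouble k G] Y.Double) ↔ IsIso X Y := by
  rw [isIso_iff]
  constructor
  · rintro ⟨e⟩
    let e' : X.carrier ≃+ Y.carrier :=
      (toDouble X).trans (e.toAddEquiv.trans (toDouble Y).symm)
    have he : ∀ a : QuantumDouble k G, ∀ m,
        e' (X.doubleAction a m) = Y.doubleAction a (e' m) := by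
      intro a m
      change (toDouble Y).symm (e (a • toDouble X m)) = _
      rw [map_smul]
      rfl
    refine ⟨e'.toLinearEquiv fun c m => ?_, fun x m => ?_, fun g m => ?_⟩
    · have := he (algebraMap k _ c) m
      rwa [AlgHom.commutes, AlgHom.commutes, Module.algebraMap_end_apply,
        Module.algebraMap_end_apply] at this
    · have := he (SkewMonoidAlgebra.single x 1) m
      rwa [doubleAction_single_one, doubleAction_single_one] at this
    · have := he (SkewMonoidAlgebra.single 1 (deltaFunction g)) m
      rwa [doubleAction_single_deltaFunction, doubleAction_single_deltaFunction] at this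
  · rintro ⟨e, h1, h2⟩
    refine ⟨((toDouble X).symm.trans ((e : X.carrier ≃+ Y.carrier).trans (toDouble Y))).toLinearEquiv
      fun a m => ?_⟩
    obtain ⟨m, rfl⟩ := (toDouble X).surjective m
    rw [smul_toDouble]
    simp only [AddEquiv.trans_apply, AddEquiv.symm_apply_apply, smul_toDouble,
      LinearEquiv.coe_addEquiv_apply]
    rw [doubleAction_eq_sum, doubleAction_eq_sum]
    simp only [map_sum, map_smul, h1, h2]

end

/-! ### From homogeneous data and from `D(kG)`-modules to Yetter-Drinfeld modules -/

section OfHomogeneous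

variable {M : Type w} [AddCommGroup M] [Module k M] (ρ : Representation k G M)
    (δ : M →ₗ[k] M ⊗[k] MonoidAlgebra k G) (S : Set M) (hS : Submodule.span k S = ⊤)
    (hδ : ∀ m ∈ S, ∃ g : G, ∀ x : G,
      δ (ρ x m) = ρ x m ⊗ₜ[k] MonoidAlgebra.single (x * g * x⁻¹) (1 : k))

/-- The identity map to the Yetter-Drinfeld module `ofHomogeneous`. -/
def toOfHomogeneous : M ≃ₗ[k] (ofHomogeneous ρ δ S hS hδ).carrier := LinearEquiv.refl k M

lemma rep_toOfHomogeneous (x : G) (m : M) :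
    (ofHomogeneous ρ δ S hS hδ).rep x (toOfHomogeneous ρ δ S hS hδ m) =
      toOfHomogeneous ρ δ S hS hδ (ρ x m) := by
  change ρ.asAlgebraHom (MonoidAlgebra.single x 1) m = ρ x m
  simp

lemma degreeProj_toOfHomogeneous {g : G} {m : M} (hm : δ m = m ⊗ₜ MonoidAlgebra.single g 1) :
    (ofHomogeneous ρ δ S hS hδ).degreeProj g (toOfHomogeneous ρ δ S hS hδ m) =
      toOfHomogeneous ρ δ S hS hδ m :=
  degreeProj_eq_self _ hm

end OfHomogeneous

/-- The Yetter-Drinfeld module given by a module over the quantum double. -/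
lemma exists_double_linearEquiv [Fintype G] (M : Type w) [AddCommGroup M] [Module k M]
    [Module (QuantumDouble k G) M] [IsScalarTower k (QuantumDouble k G) M] :
    ∃ X : YDModule.{u, max u v, w} k (MonoidAlgebra k G),
      Nonempty (X.carrier ≃ₗ[k] M) ∧ Nonempty (X.Double ≃ₗ[QuantumDouble k G] M) := by
  have : SMulCommClass k (QuantumDouble k G) M := IsScalarTower.to_smulCommClass
  let L : QuantumDouble k G →ₐ[k] Module.End k M := Algebra.lsmul k k M
  have hL : ∀ a m, L a m = a • m := fun _ _ => rfl
  let ρ : Representation k G M :=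
    { toFun := fun x => L (SkewMonoidAlgebra.single x 1)
      map_one' := by rw [← SkewMonoidAlgebra.one_def, map_one]
      map_mul' := fun x y => by
        rw [← map_mul, SkewMonoidAlgebra.single_mul_single, smul_one, mul_one] }
  let P : G → Module.End k M := fun g => L (SkewMonoidAlgebra.single 1 (deltaFunction g))
  have hPP : ∀ g h m, g ≠ h → P g (P h m) = 0 := by
    intro g h m hgh
    change (L _ * L _) m = 0
    rw [← map_mul, SkewMonoidAlgebra.single_mul_single, one_smul, deltaFunction_mul_of_ne hgh,
      SkewMonoidAlgebra.single_zero, map_zero, LinearMap.zero_apply]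
  have hsum : ∀ m, ∑ g, P g m = m := by
    intro m
    have : ∑ g, P g = 1 := by
      change ∑ g, L (SkewMonoidAlgebra.singleAddHom 1 (deltaFunction g)) = 1
      rw [← map_sum, ← map_sum, sum_deltaFunction]
      change L (SkewMonoidAlgebra.single 1 1) = 1
      rw [← SkewMonoidAlgebra.one_def, map_one]
    rw [← LinearMap.sum_apply, this, Module.End.one_apply]
  have hself : ∀ g m, P g (P g m) = P g m := by
    intro g m
    have h1 := hsum (P g m)
    rwa [Finset.sum_eq_single g (fun j _ hj => hPP _ _ m hj) (by simp)] at h1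
  have hρP : ∀ x g m, ρ x (P g m) = P (x * g * x⁻¹) (ρ x m) := by
    intro x g m
    change (L _ * L _) m = (L _ * L _) m
    rw [← map_mul, ← map_mul, SkewMonoidAlgebra.single_mul_single,
      SkewMonoidAlgebra.single_mul_single, smul_deltaFunction, one_smul, one_mul, mul_one, mul_one,
      one_mul]
  -- The elements `φ_g ⊗ 1` act as complementary projections, and the coaction records these as
  -- degrees: `m ↦ ∑ P g m ⊗ g`. The homogeneous vectors span, as `ofHomogeneous` demands.
  let δ : M →ₗ[k] M ⊗[k] MonoidAlgebra k G :=
    ∑ g, (TensorProduct.mk k M (MonoidAlgebra k G)).flip (MonoidAlgebra.single g 1) ∘ₗ P g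
  have hδ : ∀ m, δ m = ∑ g, P g m ⊗ₜ[k] MonoidAlgebra.single g (1 : k) := by
    intro m; simp [δ]
  have hδP : ∀ g m, δ (P g m) = P g m ⊗ₜ[k] MonoidAlgebra.single g (1 : k) := by
    intro g m
    rw [hδ, Finset.sum_eq_single g, hself]
    · intro j _ hj; rw [hPP _ _ _ hj, TensorProduct.zero_tmul]
    · simp
  have hS : Submodule.span k {m | ∃ g m', m = P g m'} = ⊤ := by
    rw [eq_top_iff]
    intro m _
    rw [← hsum m]
    exact Submodule.sum_mem _ fun g _ => Submodule.subset_span ⟨g, m, rfl⟩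
  have hS' : ∀ m ∈ {m | ∃ g m', m = P g m'}, ∃ g : G, ∀ x : G,
      δ (ρ x m) = ρ x m ⊗ₜ[k] MonoidAlgebra.single (x * g * x⁻¹) (1 : k) := by
    rintro _ ⟨g, m, rfl⟩
    exact ⟨g, fun x => by rw [hρP, hδP]⟩
  let X : YDModule.{u, max u v, w} k (MonoidAlgebra k G) := ofHomogeneous ρ δ _ hS hS'
  let ι : M ≃ₗ[k] X.carrier := toOfHomogeneous ρ δ _ hS hS'
  have hrep : ∀ x m, X.rep x (ι m) = ι (ρ x m) := rep_toOfHomogeneous ρ δ _ hS hS'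
  have hdeg : ∀ g m, X.degreeProj g (ι m) = ι (P g m) := by
    intro g m
    have h1 : ∀ h, X.degreeProj h (ι (P h m)) = ι (P h m) :=
      fun h => degreeProj_toOfHomogeneous ρ δ _ hS hS' (hδP h m)
    have h2 : ∀ h, h ≠ g → X.degreeProj g (ι (P h m)) = 0 := by
      intro h hh
      rw [← h1 h]
      exact X.degreeProj_of_ne hh.symm _
    conv_lhs => rw [← hsum m, map_sum, map_sum]
    rw [Finset.sum_eq_single g (fun h _ hh => h2 h hh) (by simp), h1]
  refine ⟨X, ⟨ι.symm⟩, ⟨((toDouble X).symm.trans (ι.symm : X.carrier ≃+ M)).toLinearEquiv ?_⟩⟩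
  intro a m
  obtain ⟨m, rfl⟩ := (toDouble X).surjective m
  obtain ⟨m, rfl⟩ := ι.surjective m
  rw [smul_toDouble]
  simp only [AddEquiv.trans_apply, AddEquiv.symm_apply_apply, LinearEquiv.coe_addEquiv_apply,
    LinearEquiv.symm_apply_apply]
  rw [LinearEquiv.symm_apply_eq, doubleAction_eq_sum, ← hL]
  conv_rhs => rw [← SkewMonoidAlgebra.sum_single a]
  rw [SkewMonoidAlgebra.sum_def', map_sum, LinearMap.sum_apply, map_sum]
  refine Finset.sum_congr rfl fun h _ => ?_
  -- Expanding the function in the basis `φ_g` gives `f ⊗ h = ∑ f(g) (φ_g ⊗ 1)(1 ⊗ h)`, which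
  -- reduces linearity over the double to the projections and the group.
  have e : (SkewMonoidAlgebra.single h (a.coeff h) : QuantumDouble k G) =
      ∑ g, (a.coeff h) g • (SkewMonoidAlgebra.single 1 (deltaFunction g) *
        SkewMonoidAlgebra.single h 1) := by
    conv_lhs => rw [eq_sum_deltaFunction (a.coeff h)]
    change SkewMonoidAlgebra.singleAddHom h _ = _
    rw [map_sum]
    refine Finset.sum_congr rfl fun g _ => ?_
    rw [SkewMonoidAlgebra.single_mul_single, one_smul, one_mul, mul_one,
      SkewMonoidAlgebra.smul_single]
    rfl
  rw [e, map_sum, LinearMap.sum_apply, map_sum]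
  refine Finset.sum_congr rfl fun g _ => ?_
  rw [map_smul, map_mul, hrep, hdeg, LinearMap.smul_apply, map_smul]
  rfl

end YDModule

end

/-! ## The weight decomposition of a Yetter-Drinfeld module over `kD_n` -/

noncomputable section

/-! ### Projections to eigenspaces of operators of finite order -/

section Projections

variable {k M : Type*} [Field k] [AddCommGroup M] [Module k M]

/-- A family of maps that sums to the identity is a grading if the image of each member consists of
vectors that satisfy a condition which forces all other members to vanish on them. -/
lemma isGrading_of_components {G Ω : Type*} [Group G] [MulAction G Ω] [Fintype Ω]
    {ρ : Representation k G M} {P : Ω → Module.End k M} (C : Ω → M → Prop)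
    (h1 : ∀ i m, C i (P i m)) (h2 : ∀ i j m, i ≠ j → C j m → P i m = 0)
    (h3 : ∀ m, ∑ i, P i m = m) (h4 : ∀ x i m, C i m → C (x • i) (ρ x m)) : IsGrading ρ P := by
  have hself : ∀ i m, C i m → P i m = m := by
    intro i m hm
    have := h3 m
    rwa [Finset.sum_eq_single i (fun j _ hj => h2 j i m hj hm) (by simp)] at this
  refine ⟨fun hij m => h2 _ _ _ hij (h1 _ m), h3, fun x i m => ?_⟩
  conv_rhs => rw [← h3 m, map_sum, map_sum]
  rw [Finset.sum_eq_single i, hself _ _ (h4 x i _ (h1 i m))]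
  · intro j _ hj
    exact h2 _ _ _ (fun e => hj (MulAction.injective x e).symm) (h4 x j _ (h1 j m))
  · simp

/-- The projection to the eigenspace of `T` for the eigenvalue `ζ ^ j`, where `T ^ t = 1`. -/
def eigenProj (T : Module.End k M) (ζ : k) (t : ℕ) (j : ZMod t) : Module.End k M :=
  (t : k)⁻¹ • ∑ i ∈ Finset.range t, ((ζ ^ j.val)⁻¹ • T) ^ i

/-- The projection to the eigenspace of the involution `S` for the eigenvalue `e`. -/
def signProj (S : Module.End k M) (e : ℤˣ) : Module.End k M :=
  (2 : k)⁻¹ • (1 + ((e : ℤ) : k) • S)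

lemma apply_signProj {S : Module.End k M} (hS : S * S = 1) (e : ℤˣ) (m : M) :
    S (signProj S e m) = ((e : ℤ) : k) • signProj S e m := by
  have hSS : S (S m) = m := LinearMap.congr_fun hS m
  simp only [signProj, LinearMap.smul_apply, LinearMap.add_apply, Module.End.one_apply, map_smul,
    map_add, hSS, smul_add, smul_smul]
  rw [mul_left_comm, units_intCast_mul_self, mul_one, mul_comm, add_comm]

lemma signProj_of_ne {S : Module.End k M} {e e' : ℤˣ} (he : e ≠ e') {m : M}
    (hm : S m = ((e' : ℤ) : k) • m) : signProj S e m = 0 := by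
  have : ((e : ℤ) : k) * ((e' : ℤ) : k) = -1 := by
    rcases Int.units_eq_one_or e with rfl | rfl <;> rcases Int.units_eq_one_or e' with rfl | rfl <;>
      simp at he ⊢
  simp [signProj, hm, smul_smul, mul_assoc, this]

lemma sum_signProj (h2 : (2 : k) ≠ 0) (S : Module.End k M) (m : M) :
    ∑ e, signProj S e m = m := by
  rw [show (Finset.univ : Finset ℤˣ) = {1, -1} from rfl, Finset.sum_pair (by decide)]
  simp only [signProj, LinearMap.smul_apply, ← smul_add, LinearMap.add_apply, Module.End.one_apply]
  simp only [Units.val_one, Int.cast_one, one_smul, Units.val_neg, Int.cast_neg, neg_smul]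
  rw [show m + S m + (m + -S m) = (2 : k) • m by rw [two_smul]; abel, smul_smul,
    inv_mul_cancel₀ h2, one_smul]

lemma signProj_mem {S : Module.End k M} {W : Submodule k M} (hW : ∀ m ∈ W, S m ∈ W) (e : ℤˣ) {m : M}
    (hm : m ∈ W) : signProj S e m ∈ W :=
  W.smul_mem _ (W.add_mem hm (W.smul_mem _ (hW m hm)))

lemma map_signProj {M' : Type*} [AddCommGroup M'] [Module k M'] {S : Module.End k M}
    {S' : Module.End k M'} {f : M →ₗ[k] M'} (hf : ∀ m, f (S m) = S' (f m)) (e : ℤˣ) (m : M) :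
    f (signProj S e m) = signProj S' e (f m) := by
  simp [signProj, hf]

variable {T : Module.End k M} {ζ : k} {t : ℕ}

/-- For `Y = ζ ^ (-j) T` one has `Y ^ t = 1`, so multiplication by `Y` only permutes the terms of `∑
Y ^ i`. -/
lemma apply_eigenProj [NeZero t] (hT : T ^ t = 1) (hζ : IsPrimitiveRoot ζ t) (j : ZMod t) (m : M) :
    T (eigenProj T ζ t j m) = ζ ^ j.val • eigenProj T ζ t j m := by
  have hne : ζ ^ j.val ≠ 0 := pow_ne_zero _ (hζ.ne_zero (NeZero.ne t))
  set Y : Module.End k M := (ζ ^ j.val)⁻¹ • T with hY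
  have hYt : Y ^ t = 1 := by
    rw [hY, smul_pow, hT, inv_pow, ← pow_mul, mul_comm, pow_mul, hζ.pow_eq_one, one_pow, inv_one,
      one_smul]
  have hYE : Y * ∑ i ∈ Finset.range t, Y ^ i = ∑ i ∈ Finset.range t, Y ^ i := by
    have h1 := Finset.sum_range_succ (fun i => Y ^ i) t
    rw [Finset.sum_range_succ', hYt, pow_zero, add_left_inj] at h1
    rw [Finset.mul_sum, ← h1]
    exact Finset.sum_congr rfl fun i _ => (pow_succ' Y i).symm
  have hTY : T = ζ ^ j.val • Y := by rw [hY, smul_smul, mul_inv_cancel₀ hne, one_smul]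
  have hE : eigenProj T ζ t j = (t : k)⁻¹ • ∑ i ∈ Finset.range t, Y ^ i := rfl
  rw [hE, ← Module.End.mul_apply, ← LinearMap.smul_apply]
  conv_lhs => rw [hTY]
  rw [smul_mul_assoc, mul_smul_comm, hYE]

/-- On an eigenvector for another eigenvalue the sum becomes the full geometric sum of a `t`-th root
of unity different from `1`, which is zero. -/
lemma eigenProj_of_ne [NeZero t] (hζ : IsPrimitiveRoot ζ t) {j j' : ZMod t} (hj : j ≠ j') {m : M}
    (hm : T m = ζ ^ j'.val • m) : eigenProj T ζ t j m = 0 := by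
  have h0 := hζ.ne_zero (NeZero.ne t)
  have hne : ζ ^ j.val ≠ 0 := pow_ne_zero _ h0
  have hY : ∀ i : ℕ, (((ζ ^ j.val)⁻¹ • T) ^ i) m = ((ζ ^ j.val)⁻¹ * ζ ^ j'.val) ^ i • m := by
    intro i
    induction i with
    | zero => simp
    | succ i ih =>
      rw [pow_succ', Module.End.mul_apply, ih, map_smul, LinearMap.smul_apply, hm, smul_smul,
        smul_smul, pow_succ, mul_assoc]
  simp only [eigenProj, LinearMap.smul_apply, LinearMap.sum_apply, hY]
  rw [← Finset.sum_smul]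
  set x := (ζ ^ j.val)⁻¹ * ζ ^ j'.val with hx
  have hx1 : x - 1 ≠ 0 := by
    rw [sub_ne_zero]
    intro e
    rw [hx, inv_mul_eq_one₀ hne] at e
    exact hj (ZMod.val_injective t (hζ.pow_inj (ZMod.val_lt _) (ZMod.val_lt _) e))
  have hxt : x ^ t = 1 := by
    have hz : ∀ i : ℕ, (ζ ^ i) ^ t = 1 := by
      intro i
      rw [← pow_mul, mul_comm, pow_mul, hζ.pow_eq_one, one_pow]
    rw [hx, mul_pow, inv_pow, hz, hz, inv_one, one_mul]
  have := mul_geom_sum x t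
  rw [hxt, sub_self] at this
  rw [(mul_eq_zero.1 this).resolve_left hx1, zero_smul, smul_zero]

/-- Orthogonality of roots of unity: after exchanging the sums only the power `T ^ 0` survives, with
coefficient `t / t`. -/
lemma sum_eigenProj [NeZero t] (ht : (t : k) ≠ 0) (hζ : IsPrimitiveRoot ζ t) (m : M) :
    ∑ j, eigenProj T ζ t j m = m := by
  have h0 := hζ.ne_zero (NeZero.ne t)
  have hsum : ∀ i ∈ Finset.range t, ∑ j : ZMod t, ((ζ ^ j.val)⁻¹) ^ i =
      if i = 0 then (t : k) else 0 := by
    intro i hi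
    have e : ∑ j : ZMod t, ((ζ ^ j.val)⁻¹) ^ i = ∑ j ∈ Finset.range t, ((ζ ^ i)⁻¹) ^ j := by
      have h1 : ∀ j : ZMod t, ((ζ ^ j.val)⁻¹) ^ i = ((ζ ^ i)⁻¹) ^ j.val := by
        intro j
        rw [inv_pow, inv_pow, ← pow_mul, ← pow_mul, mul_comm]
      simp only [h1]
      obtain ⟨t, rfl⟩ := Nat.exists_eq_succ_of_ne_zero (NeZero.ne t)
      exact Fin.sum_univ_eq_sum_range (fun j => ((ζ ^ i)⁻¹) ^ j) (t + 1)
    rw [e]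
    split_ifs with hi0
    · subst hi0; simp
    · have hx1 : (ζ ^ i)⁻¹ - 1 ≠ 0 := by
        rw [sub_ne_zero, ne_eq, inv_eq_one]
        exact hζ.pow_ne_one_of_pos_of_lt hi0 (Finset.mem_range.1 hi)
      have hxt : ((ζ ^ i)⁻¹) ^ t = 1 := by
        rw [inv_pow, ← pow_mul, mul_comm, pow_mul, hζ.pow_eq_one, one_pow, inv_one]
      have := mul_geom_sum ((ζ ^ i)⁻¹) t
      rw [hxt, sub_self] at this
      exact (mul_eq_zero.1 this).resolve_left hx1
  simp only [eigenProj, LinearMap.smul_apply, LinearMap.sum_apply, smul_pow]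
  rw [← Finset.smul_sum, Finset.sum_comm]
  simp only [← Finset.sum_smul]
  rw [Finset.sum_congr rfl fun i hi => by rw [hsum i hi], Finset.sum_eq_single 0]
  · rw [if_pos rfl, pow_zero, Module.End.one_apply, smul_smul, inv_mul_cancel₀ ht, one_smul]
  · intro i _ hi; rw [if_neg hi, zero_smul]
  · simp [NeZero.ne t]

lemma eigenProj_mem {W : Submodule k M} (hW : ∀ m ∈ W, T m ∈ W) (j : ZMod t) {m : M}
    (hm : m ∈ W) : eigenProj T ζ t j m ∈ W := by
  have h : ∀ i : ℕ, (((ζ ^ j.val)⁻¹ • T) ^ i) m ∈ W := by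
    intro i
    induction i with
    | zero => simpa
    | succ i ih =>
      rw [pow_succ', Module.End.mul_apply]
      exact W.smul_mem _ (hW _ ih)
  simp only [eigenProj, LinearMap.smul_apply, LinearMap.sum_apply]
  exact W.smul_mem _ (W.sum_mem fun i _ => h i)

/-- Used both for isomorphisms between two modules and for an operator on one module that commutes
with `T`. -/
lemma map_eigenProj {M' : Type*} [AddCommGroup M'] [Module k M'] {T' : Module.End k M'}
    {f : M →ₗ[k] M'} (hf : ∀ m, f (T m) = T' (f m)) (j : ZMod t) (m : M) :
    f (eigenProj T ζ t j m) = eigenProj T' ζ t j (f m) := by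
  have h : ∀ i : ℕ, f ((((ζ ^ j.val)⁻¹ • T) ^ i) m) = (((ζ ^ j.val)⁻¹ • T') ^ i) (f m) := by
    intro i
    induction i with
    | zero => simp
    | succ i ih =>
      rw [pow_succ', pow_succ', Module.End.mul_apply, Module.End.mul_apply, ← ih]
      simp [hf]
  simp only [eigenProj, LinearMap.smul_apply, LinearMap.sum_apply, map_smul, map_sum, h]

end Projections

/-! ### The set of weights and the action of `D_n` on it -/

open DihedralGroup

/-- The weights of a Yetter-Drinfeld module over `kD_n`. A vector has weight `inl (l, j)` if it has
degree `a ^ l` and `a` acts on it with the generalized eigenvalue `ξ ^ j`. It has weight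
`inr (c, e₁, e₂)` if it has degree `sr c` and `a ^ {n/2}` and `sr c` act on it by `e₁` and `e₂`. -/
def DihedralWeight (n t : ℕ) : Type := (ZMod n × ZMod t) ⊕ (ZMod n × ℤˣ × ℤˣ)

namespace DihedralWeight

variable {n t : ℕ}

instance [NeZero n] [NeZero t] : Fintype (DihedralWeight n t) :=
  inferInstanceAs (Fintype ((ZMod n × ZMod t) ⊕ (ZMod n × ℤˣ × ℤˣ)))

/-- The weight `inl (l, j)`. -/
def rot (l : ZMod n) (j : ZMod t) : DihedralWeight n t := Sum.inl (l, j)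

/-- The weight `inr (c, e₁, e₂)`. -/
def refl (c : ZMod n) (e₁ e₂ : ℤˣ) : DihedralWeight n t := Sum.inr (c, e₁, e₂)

lemma rot_inj {l l' : ZMod n} {j j' : ZMod t} : rot l j = rot l' j' ↔ l = l' ∧ j = j' :=
  Sum.inl_injective.eq_iff.trans Prod.mk_inj

lemma refl_inj {c c' : ZMod n} {e₁ e₂ e₁' e₂' : ℤˣ} :
    (refl c e₁ e₂ : DihedralWeight n t) = refl c' e₁' e₂' ↔ c = c' ∧ e₁ = e₁' ∧ e₂ = e₂' :=
  Sum.inr_injective.eq_iff.trans (Prod.mk_inj.trans (and_congr_right' Prod.mk_inj))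

lemma rot_ne_refl {l c : ZMod n} {j : ZMod t} {e₁ e₂ : ℤˣ} : rot l j ≠ refl c e₁ e₂ :=
  Sum.inl_ne_inr

/-- The action of `D_n` on the weights. -/
def act : DihedralGroup n → DihedralWeight n t → DihedralWeight n t
  | r _, .inl (l, j) => rot l j
  | sr _, .inl (l, j) => rot (-l) (-j)
  | r i, .inr (c, e) => .inr (c - 2 * i, e)
  | sr i, .inr (c, e) => .inr (2 * i - c, e)

/-- On degrees this is conjugation. A reflection inverts `a`, which negates the exponent `j` of the
eigenvalue. The signs do not change, because `a ^ (n / 2)` is central and the second sign belongs to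
the conjugated reflection. -/
instance : MulAction (DihedralGroup n) (DihedralWeight n t) where
  smul := act
  one_smul := by
    rintro (⟨l, j⟩ | ⟨c, e⟩)
    · rfl
    · change Sum.inr (c - 2 * 0, e) = _
      rw [mul_zero, sub_zero]
  mul_smul := by
    rintro (x | x) (y | y) (⟨l, j⟩ | ⟨c, e⟩)
    · rfl
    · change Sum.inr (c - 2 * (x + y), e) = Sum.inr (c - 2 * y - 2 * x, e)
      congr 2; ring
    · rfl
    · change Sum.inr (2 * (y - x) - c, e) = Sum.inr (2 * y - c - 2 * x, e)
      congr 2; ring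
    · rfl
    · change Sum.inr (2 * (x + y) - c, e) = Sum.inr (2 * x - (c - 2 * y), e)
      congr 2; ring
    · change rot l j = rot (- -l) (- -j)
      rw [neg_neg, neg_neg]
    · change Sum.inr (c - 2 * (y - x), e) = Sum.inr (2 * x - (2 * y - c), e)
      congr 2; ring

lemma r_smul_rot (i l : ZMod n) (j : ZMod t) : (r i : DihedralGroup n) • rot l j = rot l j := rfl

lemma sr_smul_rot (i l : ZMod n) (j : ZMod t) :
    (sr i : DihedralGroup n) • rot l j = rot (-l) (-j) := rfl

lemma r_smul_refl (i c : ZMod n) (e₁ e₂ : ℤˣ) :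
    (r i : DihedralGroup n) • (refl c e₁ e₂ : DihedralWeight n t) = refl (c - 2 * i) e₁ e₂ := rfl

lemma sr_smul_refl (i c : ZMod n) (e₁ e₂ : ℤˣ) :
    (sr i : DihedralGroup n) • (refl c e₁ e₂ : DihedralWeight n t) = refl (2 * i - c) e₁ e₂ := rfl

lemma smul_refl (x : DihedralGroup n) (c : ZMod n) (e₁ e₂ : ℤˣ) :
    ∃ c', x * sr c * x⁻¹ = sr c' ∧
      x • (refl c e₁ e₂ : DihedralWeight n t) = refl c' e₁ e₂ := by
  rcases x with i | i
  · refine ⟨c - 2 * i, ?_, r_smul_refl _ _ _ _⟩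
    rw [inv_r, r_mul_sr, sr_mul_r]
    congr 1; ring
  · refine ⟨2 * i - c, ?_, sr_smul_refl _ _ _ _⟩
    rw [inv_sr, sr_mul_sr, r_mul_sr]
    congr 1; ring

end DihedralWeight

/-! ### The weight grading of a Yetter-Drinfeld module -/

namespace EvenDihedralSetting

open DihedralWeight YDModule

variable {k : Type u} [Field k] {p s t n : ℕ} {ξ : k}

lemma t_ne_zero (h : EvenDihedralSetting k p s t n ξ) : t ≠ 0 := by
  rintro rfl
  exact h.not_dvd (dvd_zero _)

lemma natCast_t_ne_zero (h : EvenDihedralSetting k p s t n ξ) : (t : k) ≠ 0 := by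
  have := h.charP
  rw [Ne, CharP.cast_eq_zero_iff k p]
  exact h.not_dvd

lemma two_ne_zero (h : EvenDihedralSetting k p s t n ξ) : (2 : k) ≠ 0 := by
  have := h.charP
  intro h2
  have : ((2 : ℕ) : k) = 0 := by exact_mod_cast h2
  rw [CharP.cast_eq_zero_iff k p] at this
  exact h.ne_two ((Nat.prime_dvd_prime_iff_eq h.prime Nat.prime_two).1 this)

/-- Since `p ^ s` is prime to `t`, the eigenvalue of `a ^ (p ^ s)` still determines the exponent `j`
modulo `t`. -/
lemma primitive_pow (h : EvenDihedralSetting k p s t n ξ) : IsPrimitiveRoot (ξ ^ p ^ s) t :=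
  h.primitive.pow_of_coprime _
    (Nat.Coprime.pow_left s ((Nat.Prime.coprime_iff_not_dvd h.prime).2 h.not_dvd))

section

variable {X : YDModule.{u, u, w} k (MonoidAlgebra k (DihedralGroup n))}
  {Y : YDModule.{u, u, w'} k (MonoidAlgebra k (DihedralGroup n))}

/-- Passing to the power `p ^ s` removes the unipotent part of `a`: what remains has order dividing
`t`, which is invertible in `k`, so the module splits into its eigenspaces. -/
lemma rep_pow_eq_one (h : EvenDihedralSetting k p s t n ξ) : X.rep (r ((p ^ s : ℕ) : ZMod n)) ^ t = 1 := by
  rw [← map_pow]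
  have : (r ((p ^ s : ℕ) : ZMod n) : DihedralGroup n) ^ t = 1 := by
    rw [r_pow, ← Nat.cast_mul, ← h.n_eq, ZMod.natCast_self]; rfl
  rw [this, map_one]

/-- The projection to a weight component. -/
def weightProj (X : YDModule.{u, u, w} k (MonoidAlgebra k (DihedralGroup n))) (p s t : ℕ) (ξ : k) :
    DihedralWeight n t → Module.End k X.carrier
  | .inl (l, j) => eigenProj (X.rep (r ((p ^ s : ℕ) : ZMod n))) (ξ ^ p ^ s) t j *
      X.degreeProj (r l)
  | .inr (c, e₁, e₂) => signProj (X.rep (sr c)) e₂ *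
      (signProj (X.rep (r ((n / 2 : ℕ) : ZMod n))) e₁ * X.degreeProj (sr c))

/-- The vectors of a given weight. -/
def IsWeightVector (X : YDModule.{u, u, w} k (MonoidAlgebra k (DihedralGroup n))) (p s t : ℕ)
    (ξ : k) : DihedralWeight n t → X.carrier → Prop
  | .inl (l, j), m => X.degreeProj (r l) m = m ∧
      X.rep (r ((p ^ s : ℕ) : ZMod n)) m = (ξ ^ p ^ s) ^ j.val • m
  | .inr (c, e₁, e₂), m => X.degreeProj (sr c) m = m ∧
      X.rep (r ((n / 2 : ℕ) : ZMod n)) m = ((e₁ : ℤ) : k) • m ∧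
      X.rep (sr c) m = ((e₂ : ℤ) : k) • m

lemma degreeProj_rotation_rep (l i : ZMod n) (m : X.carrier) :
    X.degreeProj (r l) (X.rep (r i) m) = X.rep (r i) (X.degreeProj (r l) m) := by
  rw [rep_degreeProj, inv_r, r_mul_r, r_mul_r, add_neg_cancel_comm]

lemma degreeProj_rep_of_commute {g x : DihedralGroup n} (hgx : x * g = g * x) (m : X.carrier) :
    X.degreeProj g (X.rep x m) = X.rep x (X.degreeProj g m) := by
  rw [rep_degreeProj, hgx, mul_inv_cancel_right]

lemma half_mul_comm (h : EvenDihedralSetting k p s t n ξ) (x : DihedralGroup n) :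
    r ((n / 2 : ℕ) : ZMod n) * x = x * r ((n / 2 : ℕ) : ZMod n) :=
  (Subgroup.mem_center_iff.1 (rotation_half_mem_center h.even) x).symm

lemma rep_half_mul_self (h : EvenDihedralSetting k p s t n ξ) :
    X.rep (r ((n / 2 : ℕ) : ZMod n)) * X.rep (r ((n / 2 : ℕ) : ZMod n)) = 1 := by
  rw [← map_mul, r_mul_r, half_add_half h.even, ← one_def, map_one]

lemma rep_sr_mul_self (c : ZMod n) : X.rep (sr c) * X.rep (sr c) = 1 := by
  rw [← map_mul, sr_mul_self, map_one]

lemma isWeightVector_weightProj (h : EvenDihedralSetting k p s t n ξ) (i : DihedralWeight n t)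
    (m : X.carrier) : IsWeightVector X p s t ξ i (weightProj X p s t ξ i m) := by
  have := h.neZero
  have : NeZero t := ⟨h.t_ne_zero⟩
  rcases i with ⟨l, j⟩ | ⟨c, e₁, e₂⟩
  · refine ⟨?_, apply_eigenProj h.rep_pow_eq_one h.primitive_pow _ _⟩
    change X.degreeProj (r l) (eigenProj _ _ _ _ (X.degreeProj (r l) m)) =
      eigenProj _ _ _ _ (X.degreeProj (r l) m)
    rw [map_eigenProj (fun m => degreeProj_rotation_rep l _ m), degreeProj_apply_self]
  · refine ⟨?_, ?_, apply_signProj (rep_sr_mul_self c) _ _⟩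
    · change X.degreeProj (sr c) (signProj _ _ (signProj _ _ (X.degreeProj (sr c) m))) =
        signProj _ _ (signProj _ _ (X.degreeProj (sr c) m))
      rw [map_signProj (fun m => degreeProj_rep_of_commute rfl m),
        map_signProj (fun m => degreeProj_rep_of_commute (h.half_mul_comm _) m),
        degreeProj_apply_self]
    · change X.rep _ (signProj _ _ (signProj _ _ (X.degreeProj (sr c) m))) =
        _ • signProj _ _ (signProj _ _ (X.degreeProj (sr c) m))
      -- The reflection commutes with the central element `a ^ (n / 2)`, so projecting to its
      -- eigenspace preserves the first sign.
      rw [map_signProj (S' := X.rep (sr c)), apply_signProj h.rep_half_mul_self, map_smul]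
      intro m
      rw [← Module.End.mul_apply, ← Module.End.mul_apply, ← map_mul, ← map_mul, h.half_mul_comm]

lemma weightProj_of_ne (h : EvenDihedralSetting k p s t n ξ) {i i' : DihedralWeight n t}
    (hi : i ≠ i') {m : X.carrier} (hm : IsWeightVector X p s t ξ i' m) :
    weightProj X p s t ξ i m = 0 := by
  have := h.neZero
  have : NeZero t := ⟨h.t_ne_zero⟩
  have hdeg : ∀ {g g'}, g ≠ g' → X.degreeProj g' m = m → X.degreeProj g m = 0 := by
    intro g g' hg hm
    rw [← hm, degreeProj_of_ne _ hg]
  rcases i with ⟨l, j⟩ | ⟨c, e₁, e₂⟩ <;> rcases i' with ⟨l', j'⟩ | ⟨c', e₁', e₂'⟩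
  · change eigenProj _ _ _ _ (X.degreeProj (r l) m) = 0
    by_cases hl : l = l'
    · subst hl
      rw [hm.1]
      refine eigenProj_of_ne h.primitive_pow ?_ hm.2
      rintro rfl; exact hi rfl
    · rw [hdeg (fun e => hl (r.inj e)) hm.1, map_zero]
  · change eigenProj _ _ _ _ (X.degreeProj (r l) m) = 0
    rw [hdeg (by simp) hm.1, map_zero]
  · change signProj _ _ (signProj _ _ (X.degreeProj (sr c) m)) = 0
    rw [hdeg (by simp) hm.1, map_zero, map_zero]
  · change signProj _ _ (signProj _ _ (X.degreeProj (sr c) m)) = 0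
    by_cases hc : c = c'
    · subst hc
      rw [hm.1]
      by_cases he₁ : e₁ = e₁'
      · subst he₁
        have he₂ : e₂ ≠ e₂' := by rintro rfl; exact hi rfl
        apply signProj_of_ne he₂
        rw [map_signProj (S' := X.rep (r ((n / 2 : ℕ) : ZMod n))), hm.2.2, map_smul]
        intro m
        rw [← Module.End.mul_apply, ← Module.End.mul_apply, ← map_mul, ← map_mul, h.half_mul_comm]
      · rw [signProj_of_ne he₁ hm.2.1, map_zero]
    · rw [hdeg (fun e => hc (sr.inj e)) hm.1, map_zero, map_zero]

lemma sum_weightProj_rot [NeZero t] (h : EvenDihedralSetting k p s t n ξ) (l : ZMod n)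
    (m : X.carrier) : ∑ j, weightProj X p s t ξ (rot l j) m = X.degreeProj (r l) m :=
  sum_eigenProj h.natCast_t_ne_zero h.primitive_pow _

lemma sum_weightProj_refl (h : EvenDihedralSetting k p s t n ξ) (c : ZMod n) (m : X.carrier) :
    ∑ e₁, ∑ e₂, weightProj X p s t ξ (refl c e₁ e₂) m = X.degreeProj (sr c) m := by
  have : ∀ e₁, ∑ e₂, weightProj X p s t ξ (refl c e₁ e₂) m =
      signProj (X.rep (r ((n / 2 : ℕ) : ZMod n))) e₁ (X.degreeProj (sr c) m) :=
    fun e₁ => sum_signProj h.two_ne_zero _ _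
  simp only [this]
  exact sum_signProj h.two_ne_zero _ _

lemma sum_weightProj [NeZero n] [NeZero t] (h : EvenDihedralSetting k p s t n ξ) (m : X.carrier) :
    ∑ i, weightProj X p s t ξ i m = m := by
  have h1 := X.sum_degreeProj m
  have h2 : ∑ g, X.degreeProj g m =
      ∑ l : ZMod n, X.degreeProj (r l) m + ∑ c : ZMod n, X.degreeProj (sr c) m := by
    refine Eq.trans ?_ (Fintype.sum_sum_type (fun z : ZMod n ⊕ ZMod n =>
      X.degreeProj (Sum.elim r sr z : DihedralGroup n) m))
    refine (Fintype.sum_equiv ⟨Sum.elim r sr, fun g => match g with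
      | r l => Sum.inl l
      | sr c => Sum.inr c, ?_, ?_⟩ _ _ fun z => rfl).symm
    · rintro (l | c) <;> rfl
    · rintro (l | c) <;> rfl
  rw [h2] at h1
  conv_rhs => rw [← h1]
  refine (Fintype.sum_sum_type (fun i : (ZMod n × ZMod t) ⊕ (ZMod n × ℤˣ × ℤˣ) =>
    weightProj X p s t ξ i m)).trans ?_
  rw [Fintype.sum_prod_type, Fintype.sum_prod_type]
  congr 1
  · exact Finset.sum_congr rfl fun l _ => h.sum_weightProj_rot l m
  · refine Finset.sum_congr rfl fun c _ => ?_
    rw [Fintype.sum_prod_type]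
    exact h.sum_weightProj_refl c m

lemma IsWeightVector.smul (h : EvenDihedralSetting k p s t n ξ) (x : DihedralGroup n)
    {i : DihedralWeight n t} {m : X.carrier} (hm : IsWeightVector X p s t ξ i m) :
    IsWeightVector X p s t ξ (x • i) (X.rep x m) := by
  have := h.neZero
  have : NeZero t := ⟨h.t_ne_zero⟩
  have hcomm : ∀ {y z : DihedralGroup n}, y * x = x * z → ∀ m,
      X.rep y (X.rep x m) = X.rep x (X.rep z m) := by
    intro y z hyz m
    rw [← Module.End.mul_apply, ← Module.End.mul_apply, ← map_mul, ← map_mul, hyz]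
  have hdeg : ∀ {g}, X.degreeProj g m = m →
      X.degreeProj (x * g * x⁻¹) (X.rep x m) = X.rep x m := by
    intro g hg
    rw [← rep_degreeProj, hg]
  rcases i with ⟨l, j⟩ | ⟨c, e₁, e₂⟩
  · have h1 := hdeg hm.1
    rcases x with x | x
    · rw [inv_r, r_mul_r, r_mul_r, add_neg_cancel_comm] at h1
      refine ⟨h1, ?_⟩
      rw [hcomm (z := r ((p ^ s : ℕ) : ZMod n)) (by rw [r_mul_r, r_mul_r, add_comm]), hm.2, map_smul]
    · rw [inv_sr, sr_mul_r, sr_mul_sr, sub_add_cancel_left] at h1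
      refine ⟨h1, ?_⟩
      rw [hcomm (z := r (-((p ^ s : ℕ) : ZMod n))) (by rw [r_mul_sr, sr_mul_r, sub_eq_add_neg]),
        ← map_smul]
      congr 1
      -- Moving `a ^ (p ^ s)` past a reflection inverts it, and on `m` the inverse acts by the
      -- inverse eigenvalue, which has exponent `-j`.
      have h0 : (ξ ^ p ^ s) ^ (-j).val * (ξ ^ p ^ s) ^ j.val = 1 := by
        rw [← pow_val_add h.primitive_pow.pow_eq_one]; simp
      have h3 := congrArg (fun y => (ξ ^ p ^ s) ^ (-j).val •
        X.rep (r (-((p ^ s : ℕ) : ZMod n))) y) hm.2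
      beta_reduce at h3
      rw [← Module.End.mul_apply, ← map_mul, r_mul_r, neg_add_cancel, ← one_def, map_one,
        Module.End.one_apply, map_smul, smul_smul, h0, one_smul] at h3
      exact h3.symm
  · obtain ⟨c', h3, h4⟩ := smul_refl (t := t) x c e₁ e₂
    change IsWeightVector X p s t ξ (x • refl c e₁ e₂) _
    rw [h4]
    have h1 := hdeg hm.1
    rw [h3] at h1
    refine ⟨h1, ?_, ?_⟩
    · rw [hcomm (h.half_mul_comm x), hm.2.1, map_smul]
    · rw [hcomm (z := sr c) (by rw [← h3]; group), hm.2.2, map_smul]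

lemma isGrading_weightProj [NeZero n] [NeZero t] (h : EvenDihedralSetting k p s t n ξ) :
    IsGrading X.rep (weightProj X p s t ξ) :=
  isGrading_of_components (IsWeightVector X p s t ξ) h.isWeightVector_weightProj
    (fun _ _ _ hi hm => h.weightProj_of_ne hi hm) h.sum_weightProj
    fun x _ _ hm => IsWeightVector.smul h x hm

lemma weightProj_eq_self_iff [NeZero n] [NeZero t] (h : EvenDihedralSetting k p s t n ξ)
    {i : DihedralWeight n t} {m : X.carrier} :
    weightProj X p s t ξ i m = m ↔ IsWeightVector X p s t ξ i m := by
  constructor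
  · intro e
    rw [← e]
    exact h.isWeightVector_weightProj i m
  · intro hm
    have h1 := h.sum_weightProj m
    rwa [Finset.sum_eq_single i (fun j _ hj => h.weightProj_of_ne hj hm) (by simp)] at h1

/-- The degree projections are sums of weight projections. Conversely the weight projections are
built from degree projections and the group action. So both gradings have the same graded
subrepresentations. -/
lemma isGradedSub_weightProj_iff [NeZero n] [NeZero t] (h : EvenDihedralSetting k p s t n ξ)
    {W : Submodule k X.carrier} : IsGradedSub X.rep (weightProj X p s t ξ) W ↔ X.IsSub W := by
  rw [isSub_iff]
  refine and_congr_right fun hρ => ⟨fun hP => ?_, fun hP => ?_⟩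
  · rintro (l | c) m hm
    · rw [← h.sum_weightProj_rot]
      exact W.sum_mem fun j _ => hP _ m hm
    · rw [← h.sum_weightProj_refl]
      exact W.sum_mem fun e₁ _ => W.sum_mem fun e₂ _ => hP _ m hm
  · rintro (⟨l, j⟩ | ⟨c, e₁, e₂⟩) m hm
    · exact eigenProj_mem (hρ _) _ (hP _ m hm)
    · exact signProj_mem (hρ _) _ (signProj_mem (hρ _) _ (hP _ m hm))

lemma isGradedIndecomposable_weightProj_iff [NeZero n] [NeZero t]
    (h : EvenDihedralSetting k p s t n ξ) :
    IsGradedIndecomposable X.rep (weightProj X p s t ξ) ↔ X.IsIndecomposable := by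
  simp only [IsIndecomposable, IsGradedIndecomposable, h.isGradedSub_weightProj_iff]

lemma isIso_iff_weightProj [NeZero n] [NeZero t] (h : EvenDihedralSetting k p s t n ξ) :
    IsIso X Y ↔ ∃ e : X.carrier ≃ₗ[k] Y.carrier, (∀ x m, e (X.rep x m) = Y.rep x (e m)) ∧
      ∀ i m, e (weightProj X p s t ξ i m) = weightProj Y p s t ξ i (e m) := by
  rw [isIso_iff]
  refine exists_congr fun e => and_congr_right fun hρ => ⟨fun hP => ?_, fun hP => ?_⟩
  · rintro (⟨l, j⟩ | ⟨c, e₁, e₂⟩) m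
    · refine (map_eigenProj (f := e.toLinearMap) (hρ _) _ _).trans ?_
      exact congrArg _ (hP _ m)
    · refine (map_signProj (f := e.toLinearMap) (hρ _) _ _).trans (congrArg _ ?_)
      refine (map_signProj (f := e.toLinearMap) (hρ _) _ _).trans (congrArg _ ?_)
      exact hP _ m
  · rintro (l | c) m
    · rw [← h.sum_weightProj_rot, ← h.sum_weightProj_rot, map_sum]
      exact Finset.sum_congr rfl fun j _ => hP _ m
    · rw [← h.sum_weightProj_refl, ← h.sum_weightProj_refl, map_sum]
      refine Finset.sum_congr rfl fun e₁ _ => ?_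
      rw [map_sum]
      exact Finset.sum_congr rfl fun e₂ _ => hP _ m

end

end EvenDihedralSetting

end

noncomputable section

namespace EvenDihedralSetting

open DihedralWeight YDModule DihedralGroup Matrix

variable {k : Type u} [Field k] {p s t n : ℕ} {ξ : k}

/-! ## The label of a Yetter-Drinfeld module -/

section Label

variable {X : YDModule.{u, u, w} k (MonoidAlgebra k (DihedralGroup n))}
  {Y : YDModule.{u, u, w'} k (MonoidAlgebra k (DihedralGroup n))}

/-- The conditions on the parametrization `f` of a weight component in `HasLabel`. -/
def IsCompatible (X : YDModule.{u, u, w} k (MonoidAlgebra k (DihedralGroup n))) (ξ : k) {m : ℕ}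
    (η : ℤˣ) (f : (Fin m → k) →ₗ[k] X.carrier) : DihedralWeight n t → Prop
  | .inl (l, j) => (∀ x, f (jordanMatrix m (ξ ^ j.val) *ᵥ x) = X.rep (r 1) (f x)) ∧
      (-l = l → -j = j → ∀ x,
        f (((η : ℤ) : k) • involutionMatrix m (ξ ^ j.val) *ᵥ x) = X.rep (sr 0) (f x))
  | .inr _ => m = 1

/-- `X` is generated by the component of weight `i`, on which `a` acts by a Jordan block of size `m`
if the weight is `rot l j`, on which moreover `b` acts by `η T` if the weight is fixed by `b`, and
which is one-dimensional if the weight is `refl c e₁ e₂`. -/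
def HasLabel (X : YDModule.{u, u, w} k (MonoidAlgebra k (DihedralGroup n))) (p s : ℕ) (ξ : k)
    (i : DihedralWeight n t) (m : ℕ) (η : ℤˣ) : Prop :=
  ∃ f : (Fin m → k) →ₗ[k] X.carrier, Function.Injective f ∧
    (∀ x, IsWeightVector X p s t ξ i (f x)) ∧
    (∀ W : Submodule k X.carrier, (∀ g x, X.rep g (f x) ∈ W) → W = ⊤) ∧ IsCompatible X ξ η f i

lemma rep_r_eq_pow [NeZero n] (i : ZMod n) : X.rep (r i) = X.rep (r 1) ^ i.val := by
  rw [← map_pow, r_one_pow, ZMod.natCast_zmod_val]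

lemma rep_r_natCast (i : ℕ) : X.rep (r (i : ZMod n)) = X.rep (r 1) ^ i := by
  rw [← map_pow, r_one_pow]

lemma map_pow_mulVec {V : Type*} [AddCommGroup V] [Module k V] {m : ℕ}
    {J : Matrix (Fin m) (Fin m) k} {A : Module.End k V} {f : (Fin m → k) →ₗ[k] V}
    (hf : ∀ x, f (J *ᵥ x) = A (f x)) (i : ℕ) (x : Fin m → k) : f (J ^ i *ᵥ x) = (A ^ i) (f x) := by
  induction i generalizing x with
  | zero => simp
  | succ i ih => rw [pow_succ, pow_succ, ← mulVec_mulVec, ih, hf, Module.End.mul_apply]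

lemma rep_sr_eq (i : ZMod n) : X.rep (sr i) = X.rep (sr 0) * X.rep (r i) := by
  rw [← map_mul, sr_mul_r, zero_add]

/-- The value at `x` of the sign character of the stabilizer of `refl c e₁ e₂`. -/
def kleinValue (c : ZMod n) (e₁ e₂ : ℤˣ) : DihedralGroup n → ℤˣ
  | r i => if i = 0 then 1 else e₁
  | sr i => (if i = c then 1 else e₁) * e₂

/-- The stabilizer consists of `1`, `a ^ (n / 2)`, the reflection `sr c` and their product, and the
weight prescribes the scalars of the two generators. -/
lemma rep_weightVector_refl [NeZero n] (h : EvenDihedralSetting k p s t n ξ) {c : ZMod n}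
    {e₁ e₂ : ℤˣ} {x : DihedralGroup n}
    (hx : x • (refl c e₁ e₂ : DihedralWeight n t) = refl c e₁ e₂) {m : X.carrier}
    (hm : IsWeightVector X p s t ξ (refl c e₁ e₂) m) :
    X.rep x m = ((kleinValue c e₁ e₂ x : ℤ) : k) • m := by
  have hh := hm.2.1
  have hs := hm.2.2
  rcases x with i | i
  · rw [r_smul_refl, refl_inj] at hx
    change _ = (((if i = 0 then 1 else e₁ : ℤˣ) : ℤ) : k) • m
    rcases eq_zero_or_eq_half h.even (i := i) (by linear_combination -hx.1) with rfl | rfl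
    · rw [if_pos rfl, ← one_def, map_one]; simp
    · rw [if_neg (half_ne_zero h.even), hh]
  · rw [sr_smul_refl, refl_inj] at hx
    change _ = ((((if i = c then 1 else e₁) * e₂ : ℤˣ) : ℤ) : k) • m
    rcases eq_zero_or_eq_half h.even (i := i - c) (by linear_combination hx.1) with h0 | h0
    · obtain rfl := sub_eq_zero.1 h0
      rw [if_pos rfl, one_mul, hs]
    · have hi : i = c + ((n / 2 : ℕ) : ZMod n) := by rw [← h0]; ring
      have hne : i ≠ c := by
        intro e
        rw [e, sub_self] at h0
        exact half_ne_zero h.even h0.symm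
      rw [if_neg hne, hi, ← sr_mul_r, map_mul, Module.End.mul_apply, hh, map_smul, hs, smul_smul,
        Units.val_mul, Int.cast_mul]

lemma r_of_smul_rot {l : ZMod n} {j : ZMod t} {x : DihedralGroup n}
    (hx : x • (rot l j : DihedralWeight n t) = rot l j) :
    (∃ i, x = r i) ∨ ((∃ i, x = sr i) ∧ -l = l ∧ -j = j) := by
  rcases x with i | i
  · exact Or.inl ⟨i, rfl⟩
  · rw [sr_smul_rot, rot_inj] at hx
    exact Or.inr ⟨⟨i, rfl⟩, hx⟩

/-- The stabilizer of the weight acts on the parametrized component in a way that depends only on the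
label. -/
lemma exists_rep_eq [NeZero n] (h : EvenDihedralSetting k p s t n ξ) {i : DihedralWeight n t} {m : ℕ}
    {η : ℤˣ} (x : DihedralGroup n) (hx : x • i = i) (y : Fin m → k) :
    ∃ y' : Fin m → k,
      (∀ (X : YDModule.{u, u, w} k (MonoidAlgebra k (DihedralGroup n)))
        (f : (Fin m → k) →ₗ[k] X.carrier), (∀ x, IsWeightVector X p s t ξ i (f x)) →
        IsCompatible X ξ η f i → X.rep x (f y) = f y') ∧
      (∀ (X : YDModule.{u, u, w'} k (MonoidAlgebra k (DihedralGroup n)))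
        (f : (Fin m → k) →ₗ[k] X.carrier), (∀ x, IsWeightVector X p s t ξ i (f x)) →
        IsCompatible X ξ η f i → X.rep x (f y) = f y') := by
  -- In each case `y'` is given by a formula in the label alone, hence is the same for every module.
  -- The two conjuncts allow modules in two different universes.
  rcases i with ⟨l, j⟩ | ⟨c, e₁, e₂⟩
  · rcases r_of_smul_rot hx with ⟨i, rfl⟩ | ⟨⟨i, rfl⟩, hl, hj⟩
    · refine ⟨jordanMatrix m (ξ ^ j.val) ^ i.val *ᵥ y, ?_, ?_⟩ <;>
      · intro X f _ hf
        rw [rep_r_eq_pow, map_pow_mulVec hf.1]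
    · refine ⟨((η : ℤ) : k) • involutionMatrix m (ξ ^ j.val) *ᵥ
        (jordanMatrix m (ξ ^ j.val) ^ i.val *ᵥ y), ?_, ?_⟩ <;>
      · intro X f _ hf
        rw [hf.2 hl hj, map_pow_mulVec hf.1, rep_sr_eq, rep_r_eq_pow, Module.End.mul_apply]
  · refine ⟨((kleinValue c e₁ e₂ x : ℤ) : k) • y, ?_, ?_⟩ <;>
    · intro X f hw _
      rw [h.rep_weightVector_refl hx (hw y), map_smul]

lemma isGenerated_of_hasLabel [NeZero n] [NeZero t] (h : EvenDihedralSetting k p s t n ξ)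
    {i : DihedralWeight n t} {m : ℕ} {η : ℤˣ} {f : (Fin m → k) →ₗ[k] X.carrier}
    (hinj : Function.Injective f) (hw : ∀ x, IsWeightVector X p s t ξ i (f x))
    (hspan : ∀ W : Submodule k X.carrier, (∀ g x, X.rep g (f x) ∈ W) → W = ⊤)
    (hf : IsCompatible X ξ η f i) : IsGenerated X.rep (weightProj X p s t ξ) i f := by
  refine ⟨hinj, fun x => h.weightProj_eq_self_iff.2 (hw x), fun x hx y => ?_, hspan⟩
  obtain ⟨y', hy', -⟩ := exists_rep_eq.{u, w, w} h (η := η) x hx y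
  exact ⟨y', hy' X f hw hf⟩

/-- Yetter-Drinfeld modules with the same label are isomorphic. -/
lemma isIso_of_hasLabel (h : EvenDihedralSetting k p s t n ξ) {i : DihedralWeight n t} {m : ℕ}
    {η : ℤˣ} (hX : HasLabel X p s ξ i m η) (hY : HasLabel Y p s ξ i m η) : IsIso X Y := by
  have := h.neZero
  have : NeZero t := ⟨h.t_ne_zero⟩
  obtain ⟨f, hinj, hw, hspan, hf⟩ := hX
  obtain ⟨f', hinj', hw', hspan', hf'⟩ := hY
  rw [h.isIso_iff_weightProj]
  refine (h.isGenerated_of_hasLabel hinj hw hspan hf).exists_linearEquiv h.isGrading_weightProj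
    h.isGrading_weightProj (h.isGenerated_of_hasLabel hinj' hw' hspan' hf') fun x hx y => ?_
  obtain ⟨y', hy', hy''⟩ := exists_rep_eq.{u, w, w'} h (η := η) x hx y
  exact ⟨y', hy' X f hw hf, hy'' Y f' hw' hf'⟩

lemma HasLabel.of_isIso (h : EvenDihedralSetting k p s t n ξ) {i : DihedralWeight n t} {m : ℕ}
    {η : ℤˣ} (hXY : IsIso X Y) (hY : HasLabel Y p s ξ i m η) : HasLabel X p s ξ i m η := by
  have := h.neZero
  have : NeZero t := ⟨h.t_ne_zero⟩
  rw [h.isIso_iff_weightProj] at hXY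
  obtain ⟨e, he, heP⟩ := hXY
  obtain ⟨f, hinj, hw, hspan, hf⟩ := hY
  have he' : ∀ g y, e.symm (Y.rep g y) = X.rep g (e.symm y) := by
    intro g y
    rw [LinearEquiv.symm_apply_eq, he, e.apply_symm_apply]
  refine ⟨e.symm.toLinearMap ∘ₗ f, e.symm.injective.comp hinj, fun x => ?_, fun W hW => ?_, ?_⟩
  · rw [← h.weightProj_eq_self_iff]
    apply e.injective
    rw [heP, LinearMap.comp_apply, LinearEquiv.coe_coe, e.apply_symm_apply]
    exact h.weightProj_eq_self_iff.2 (hw x)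
  · have := hspan (W.comap e.symm.toLinearMap) fun g x => by
      have := hW g x
      rw [LinearMap.comp_apply, LinearEquiv.coe_coe, ← he'] at this
      exact this
    rw [eq_top_iff]
    intro y _
    have hy : e y ∈ W.comap e.symm.toLinearMap := this ▸ Submodule.mem_top
    simpa using hy
  · rcases i with ⟨l, j⟩ | ⟨c, e₁, e₂⟩
    · refine ⟨fun x => ?_, fun hl hj x => ?_⟩
      · rw [LinearMap.comp_apply, hf.1, LinearMap.comp_apply, LinearEquiv.coe_coe, he']
      · rw [LinearMap.comp_apply, hf.2 hl hj, LinearMap.comp_apply, LinearEquiv.coe_coe, he']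
    · exact hf

/-- The module is the sum of the finitely many translates of a finite-dimensional component. -/
lemma finiteDimensional_of_hasLabel (h : EvenDihedralSetting k p s t n ξ) {i : DihedralWeight n t}
    {m : ℕ} {η : ℤˣ} (hX : HasLabel X p s ξ i m η) : FiniteDimensional k X.carrier := by
  have := h.neZero
  obtain ⟨f, -, -, hspan, -⟩ := hX
  have := hspan (⨆ g : DihedralGroup n, LinearMap.range (X.rep g ∘ₗ f)) fun g x =>
    Submodule.mem_iSup_of_mem g ⟨x, rfl⟩
  have hfin : FiniteDimensional k
      (⨆ g : DihedralGroup n, LinearMap.range (X.rep g ∘ₗ f) : Submodule k X.carrier) :=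
    inferInstance
  rw [this] at hfin
  exact Module.finite_def.2 ((Submodule.fg_top _).1 (Module.finite_def.1 hfin) )

lemma isIndecomposable_of_hasLabel (h : EvenDihedralSetting k p s t n ξ) {i : DihedralWeight n t}
    {m : ℕ} (hm : m ≠ 0) {η : ℤˣ} (hX : HasLabel X p s ξ i m η) : X.IsIndecomposable := by
  have := h.neZero
  have : NeZero t := ⟨h.t_ne_zero⟩
  obtain ⟨m, rfl⟩ := Nat.exists_eq_succ_of_ne_zero hm
  obtain ⟨f, hinj, hw, hspan, hf⟩ := hX
  rw [← h.isGradedIndecomposable_weightProj_iff]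
  refine (h.isGenerated_of_hasLabel hinj hw hspan hf).isGradedIndecomposable
    h.isGrading_weightProj fun D₁ D₂ h1 h2 hD => ?_
  rcases i with ⟨l, j⟩ | ⟨c, e₁, e₂⟩
  · exact eq_bot_or_eq_bot_of_jordanMatrix (c := ξ ^ j.val)
      (fun x hx => h1 (r 1) (r_smul_rot _ _ _) x hx _ (hf.1 x).symm)
      (fun x hx => h2 (r 1) (r_smul_rot _ _ _) x hx _ (hf.1 x).symm) hD
  · obtain rfl : m = 0 := by
      have : m + 1 = 1 := hf
      omega
    -- A line is treated as a Jordan block of size one with eigenvalue `0`, for which every subspace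
    -- is stable.
    have h0 : ∀ x : Fin 1 → k, jordanMatrix 1 0 *ᵥ x = 0 := by
      intro x
      ext i
      rw [Subsingleton.elim i (Fin.last 0), jordanMatrix_mulVec_last, zero_mul]
      rfl
    exact eq_bot_or_eq_bot_of_jordanMatrix (c := 0) (fun x _ => by rw [h0]; exact zero_mem _)
      (fun x _ => by rw [h0]; exact zero_mem _) hD

lemma isSimple_of_hasLabel (h : EvenDihedralSetting k p s t n ξ) {i : DihedralWeight n t}
    {η : ℤˣ} (hX : HasLabel X p s ξ i 1 η) : X.IsSimple := by
  have := h.neZero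
  have : NeZero t := ⟨h.t_ne_zero⟩
  refine ⟨(h.isIndecomposable_of_hasLabel one_ne_zero hX).1, fun W hW => ?_⟩
  obtain ⟨f, hinj, hw, hspan, hf⟩ := hX
  have : IsSimpleModule k (Fin 1 → k) := isSimpleModule_iff_finrank_eq_one.2 (by simp)
  exact (h.isGenerated_of_hasLabel hinj hw hspan hf).eq_bot_or_eq_top h.isGrading_weightProj
    eq_bot_or_eq_top (h.isGradedSub_weightProj_iff.2 hW)

/-- The label is unique up to the choice of the weight in its orbit. -/
lemma HasLabel.mem_orbit (h : EvenDihedralSetting k p s t n ξ) {i i' : DihedralWeight n t}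
    {m m' : ℕ} {η η' : ℤˣ} (hm : m ≠ 0) (hX : HasLabel X p s ξ i m η)
    (hX' : HasLabel X p s ξ i' m' η') : i' ∈ MulAction.orbit (DihedralGroup n) i := by
  have := h.neZero
  have : NeZero t := ⟨h.t_ne_zero⟩
  have : Nontrivial X.carrier := (h.isIndecomposable_of_hasLabel hm hX).1
  obtain ⟨f, hinj, hw, hspan, hf⟩ := hX
  obtain ⟨f', hinj', hw', hspan', hf'⟩ := hX'
  exact (h.isGenerated_of_hasLabel hinj hw hspan hf).mem_orbit h.isGrading_weightProj
    (h.isGenerated_of_hasLabel hinj' hw' hspan' hf')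

/-- Both parametrizations have the whole component of weight `i` as image, so they differ by an
isomorphism of coordinate spaces that respects the matrices. Dimensions give the block size. The
action on the top of the block gives the sign at weights fixed by `b`; at other weights the sign
carries no information. -/
lemma HasLabel.unique (h : EvenDihedralSetting k p s t n ξ) {i : DihedralWeight n t}
    {m m' : ℕ} {η η' : ℤˣ} (hm : m ≠ 0) (hX : HasLabel X p s ξ i m η)
    (hX' : HasLabel X p s ξ i m' η') :
    m = m' ∧ ∀ l j, i = rot l j → -l = l → -j = j → η = η' := by
  have := h.neZero
  have : NeZero t := ⟨h.t_ne_zero⟩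
  obtain ⟨f, hinj, hw, hspan, hf⟩ := hX
  obtain ⟨f', hinj', hw', hspan', hf'⟩ := hX'
  have hr : ∀ x, ∃ y, f x = f' y := by
    intro x
    obtain ⟨y, hy⟩ := (h.isGenerated_of_hasLabel hinj' hw' hspan' hf').apply_mem_range
      h.isGrading_weightProj (f x)
    rw [h.weightProj_eq_self_iff.2 (hw x)] at hy
    exact ⟨y, hy⟩
  have hr' : ∀ x, ∃ y, f' x = f y := by
    intro x
    obtain ⟨y, hy⟩ := (h.isGenerated_of_hasLabel hinj hw hspan hf).apply_mem_range
      h.isGrading_weightProj (f' x)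
    rw [h.weightProj_eq_self_iff.2 (hw' x)] at hy
    exact ⟨y, hy⟩
  have hrange : LinearMap.range f = LinearMap.range f' := by
    apply le_antisymm
    · rintro _ ⟨x, rfl⟩
      obtain ⟨y, hy⟩ := hr x
      exact ⟨y, hy.symm⟩
    · rintro _ ⟨x, rfl⟩
      obtain ⟨y, hy⟩ := hr' x
      exact ⟨y, hy.symm⟩
  let e : (Fin m → k) ≃ₗ[k] (Fin m' → k) :=
    (LinearEquiv.ofInjective f hinj).trans
      ((LinearEquiv.ofEq _ _ hrange).trans (LinearEquiv.ofInjective f' hinj').symm)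
  have he : ∀ x, f' (e x) = f x := by
    intro x
    have : LinearEquiv.ofInjective f' hinj' (e x) =
        LinearEquiv.ofEq _ _ hrange (LinearEquiv.ofInjective f hinj x) := by
      simp only [e, LinearEquiv.trans_apply, LinearEquiv.apply_symm_apply]
    exact congrArg Subtype.val this
  have hmm : m = m' := by simpa using e.finrank_eq
  subst hmm
  refine ⟨rfl, ?_⟩
  rintro l j rfl hl hj
  obtain ⟨m, rfl⟩ := Nat.exists_eq_succ_of_ne_zero hm
  have := sign_eq_of_linearEquiv (c := ξ ^ j.val) (η := ((η : ℤ) : k)) (η' := ((η' : ℤ) : k)) e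
    (fun x => hinj' (by rw [he, hf.1, hf'.1, he])) (fun x => hinj' (by
      rw [he, hf.2 hl hj, hf'.2 hl hj, he]))
  by_contra hne
  have h2 := h.two_ne_zero
  rcases Int.units_eq_one_or η with rfl | rfl <;> rcases Int.units_eq_one_or η' with rfl | rfl
  · exact hne rfl
  · simp only [Units.val_one, Int.cast_one, Units.val_neg, Int.cast_neg] at this
    exact h2 (by linear_combination this)
  · simp only [Units.val_one, Int.cast_one, Units.val_neg, Int.cast_neg] at this
    exact h2 (by linear_combination -this)
  · exact hne rfl

end Label

end EvenDihedralSetting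

end

noncomputable section

namespace EvenDihedralSetting

open DihedralWeight YDModule DihedralGroup Matrix

variable {k : Type u} [Field k] {p s t n : ℕ} {ξ : k}

/-! ## Every indecomposable module has a label -/

section Existence

variable {X : YDModule.{u, u, w} k (MonoidAlgebra k (DihedralGroup n))}

/-- Additivity of the Frobenius power for commuting elements. It links eigenvectors of `a ^ (p ^ s)`
to generalized eigenvectors of `a`, and it is the source of the bound `p ^ s` on block sizes. -/
lemma sub_smul_one_pow (h : EvenDihedralSetting k p s t n ξ) {R : Type*} [Ring R]
    [Algebra k R] (A : R) (c : k) :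
    (A - c • 1) ^ p ^ s = A ^ p ^ s - c ^ p ^ s • 1 := by
  have := Fact.mk h.prime
  have := h.charP
  -- The zero ring is set aside because it does not have characteristic `p`.
  rcases subsingleton_or_nontrivial R with hR | hR
  · exact Subsingleton.elim _ _
  have : CharP R p := charP_of_injective_algebraMap (algebraMap k R).injective p
  rw [sub_pow_char_pow_of_commute p s ((Commute.one_right A).smul_right c), smul_pow, one_pow]

/-- The weights that are fixed by `b` and whose degree is a rotation. -/
def IsFixed : DihedralWeight n t → Prop
  | .inl (l, j) => -l = l ∧ -j = j
  | .inr _ => False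

/-- The weights whose degree is a reflection. -/
def IsReflection : DihedralWeight n t → Prop
  | .inl _ => False
  | .inr _ => True

/-- A nonzero weight component of an indecomposable Yetter-Drinfeld module determines a label. -/
lemma exists_hasLabel [FiniteDimensional k X.carrier] (h : EvenDihedralSetting k p s t n ξ)
    (hX : X.IsIndecomposable) {i : DihedralWeight n t}
    (hi : ∃ m, weightProj X p s t ξ i m ≠ 0) :
    ∃ (m : ℕ) (η : ℤˣ), 1 ≤ m ∧ m ≤ p ^ s ∧ (IsReflection i → m = 1) ∧ (¬ IsFixed i → η = 1) ∧
      HasLabel X p s ξ i m η := by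
  have := h.neZero
  have : NeZero t := ⟨h.t_ne_zero⟩
  have hX' := h.isGradedIndecomposable_weightProj_iff.2 hX
  have hgen := h.isGrading_weightProj.isGenerated_of_indecomposable hX' hi
  have hind := fun D₁ D₂ h1 h2 hD =>
    hgen.eq_bot_or_eq_bot_of_indecomposable (D₁ := D₁) (D₂ := D₂) h.isGrading_weightProj hX' h1 h2 hD
  have hw : ∀ v : LinearMap.range (weightProj X p s t ξ i),
      IsWeightVector X p s t ξ i (v : X.carrier) := fun v =>
    h.weightProj_eq_self_iff.1 (hgen.apply_self v)
  set V := LinearMap.range (weightProj X p s t ξ i) with hV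
  have hne : Nontrivial V := by
    obtain ⟨m, hm⟩ := hi
    exact ⟨⟨⟨_, m, rfl⟩, 0, fun e => hm (congrArg Subtype.val e)⟩⟩
  have hst : ∀ x : DihedralGroup n, x • i = i → ∀ v ∈ V, X.rep x v ∈ V := by
    intro x hx v hv
    obtain ⟨v', hv'⟩ := hgen.stable x hx ⟨v, hv⟩
    change X.rep x v = v' at hv'
    rw [hv']
    exact v'.2
  have hspan : ∀ {m : ℕ} (f : (Fin m → k) ≃ₗ[k] V) (W : Submodule k X.carrier),
      (∀ g x, X.rep g (f x) ∈ W) → W = ⊤ := by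
    intro m f W hW
    refine hgen.eq_top W fun g v => ?_
    obtain ⟨x, rfl⟩ := f.surjective v
    exact hW g x
  rcases i with ⟨l, j⟩ | ⟨c, e₁, e₂⟩
  · let A : Module.End k V := (X.rep (r 1)).restrict (hst (r 1) (r_smul_rot _ _ _))
    have hA : ∀ (i : ℕ) (v : V), (((A ^ i) v : V) : X.carrier) = X.rep (r (i : ZMod n)) v := by
      intro i v
      rw [rep_r_natCast]
      induction i generalizing v with
      | zero => simp
      | succ i ih => rw [pow_succ, pow_succ, Module.End.mul_apply, ih]; rfl
    have hAr : ∀ (i : ZMod n) (v : V), (((A ^ i.val) v : V) : X.carrier) = X.rep (r i) v := by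
      intro i v
      rw [hA, ZMod.natCast_zmod_val]
    -- On the weight component `a ^ (p ^ s)` is the scalar `ξ ^ (j p ^ s)`. This exponent later
    -- bounds the size of the block.
    have hnil : (A - ξ ^ j.val • 1) ^ p ^ s = 0 := by
      rw [h.sub_smul_one_pow, sub_eq_zero]
      ext v
      rw [hA, (hw v).2, ← pow_mul, ← pow_mul, mul_comm]
      rfl
    have hpow : ∀ D : Submodule k V, (∀ m ∈ D, A m ∈ D) → ∀ i : ℕ, ∀ m ∈ D, (A ^ i) m ∈ D := by
      intro D hD i
      induction i with
      | zero => intro m hm; simpa using hm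
      | succ i ih =>
        intro m hm
        rw [pow_succ, Module.End.mul_apply]
        exact ih _ (hD m hm)
    -- The stabilizer is all of `D_n` if the weight is fixed by `b`, and then `ξ ^ j = ± 1`.
    -- Otherwise it is `C_n`.
    by_cases hfix : -l = l ∧ -j = j
    · let B : Module.End k V := (X.rep (sr 0)).restrict (hst (sr 0) (by
        rw [show (Sum.inl (l, j) : DihedralWeight n t) = rot l j from rfl, sr_smul_rot, hfix.1,
          hfix.2]))
      have hB : ∀ v, ((B v : V) : X.carrier) = X.rep (sr 0) v := fun v => rfl
      have hc : (ξ ^ j.val) ^ 2 = 1 := by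
        rw [sq, ← pow_val_add h.primitive.pow_eq_one]
        have : j + j = 0 := by linear_combination -hfix.2
        rw [this, ZMod.val_zero, pow_zero]
      have hAn : A ^ n = 1 := by
        ext v
        rw [hA, ZMod.natCast_self, ← one_def, map_one]
        rfl
      have hBB : B * B = 1 := by
        ext v
        rw [Module.End.mul_apply, hB, hB, ← Module.End.mul_apply, rep_sr_mul_self]
        rfl
      have hABA : A * B * A = B := by
        ext v
        have h1 : ∀ v : V, ((A v : V) : X.carrier) = X.rep (r 1) v := fun v => rfl
        rw [Module.End.mul_apply, Module.End.mul_apply, h1, hB, h1, hB, ← Module.End.mul_apply,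
          ← Module.End.mul_apply, ← map_mul, ← map_mul, r_mul_sr, sr_mul_r]
        simp
      obtain ⟨m, f, η, hfJ, hfT, hm⟩ := exists_jordanMatrix_involutionMatrix_equiv h.two_ne_zero hc
        ⟨_, hnil⟩ (NeZero.ne n) hAn hBB hABA (by
          intro D₁ D₂ a1 b1 a2 b2 hD
          have key : ∀ D : Submodule k V, (∀ m ∈ D, A m ∈ D) → (∀ m ∈ D, B m ∈ D) →
              ∀ x : DihedralGroup n, x • (rot l j : DihedralWeight n t) = rot l j →
              ∀ v ∈ D, ∃ v' ∈ D, X.rep x (V.subtype v) = V.subtype v' := by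
            intro D a b x _ v hv
            rcases x with x | x
            · exact ⟨_, hpow D a x.val v hv, (hAr x v).symm⟩
            · refine ⟨_, b _ (hpow D a x.val v hv), ?_⟩
              change _ = ((B _ : V) : X.carrier)
              rw [hB, hAr, ← Module.End.mul_apply, ← rep_sr_eq]
              rfl
          exact hind D₁ D₂ (key D₁ a1 b1) (key D₂ a2 b2) hD)
      exact ⟨m + 1, η, by omega, hm _ hnil, fun hh => hh.elim, fun hh => absurd hfix hh,
        V.subtype ∘ₗ f.toLinearMap, Subtype.val_injective.comp f.injective, fun x => hw (f x),
        hspan f, fun x => congrArg Subtype.val (hfJ x), fun _ _ x => congrArg Subtype.val (hfT x)⟩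
    -- With the identity as involution the splitting lemma says that an indecomposable
    -- representation of `C_n` with one eigenvalue is a Jordan block. The sign in the label is set
    -- to `1` by convention.
    · obtain ⟨m, f, η, hfJ, -, hm⟩ := exists_jordanMatrix_equiv h.two_ne_zero ⟨_, hnil⟩
        (one_mul (1 : Module.End k V)) (fun i => ⟨i, by rw [mul_one, one_mul]⟩) (by
          intro D₁ D₂ a1 _ a2 _ hD
          have key : ∀ D : Submodule k V, (∀ m ∈ D, A m ∈ D) →
              ∀ x : DihedralGroup n, x • (rot l j : DihedralWeight n t) = rot l j →
              ∀ v ∈ D, ∃ v' ∈ D, X.rep x (V.subtype v) = V.subtype v' := by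
            intro D a x hx v hv
            rcases r_of_smul_rot hx with ⟨i, rfl⟩ | ⟨-, hh⟩
            · exact ⟨_, hpow D a i.val v hv, (hAr i v).symm⟩
            · exact absurd hh hfix
          exact hind D₁ D₂ (key D₁ a1) (key D₂ a2) hD)
      exact ⟨m + 1, 1, by omega, hm _ hnil, fun hh => hh.elim, fun _ => rfl,
        V.subtype ∘ₗ f.toLinearMap, Subtype.val_injective.comp f.injective, fun x => hw (f x),
        hspan f, fun x => congrArg Subtype.val (hfJ x), fun hl hj => absurd ⟨hl, hj⟩ hfix⟩
  -- The stabilizer acts by scalars, so every subspace of the component is stable. The splitting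
  -- lemma for the identity operator, with nilpotency exponent `1`, then forces dimension one.
  · have hnil : ((1 : Module.End k V) - (1 : k) • 1) ^ 1 = 0 := by simp
    obtain ⟨m, f, η, -, -, hm⟩ := exists_jordanMatrix_equiv h.two_ne_zero ⟨_, hnil⟩
        (one_mul (1 : Module.End k V)) (fun i => ⟨i, by rw [mul_one, one_mul]⟩) (by
          intro D₁ D₂ _ _ _ _ hD
          have key : ∀ D : Submodule k V,
              ∀ x : DihedralGroup n, x • (refl c e₁ e₂ : DihedralWeight n t) = refl c e₁ e₂ →
              ∀ v ∈ D, ∃ v' ∈ D, X.rep x (V.subtype v) = V.subtype v' := by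
            intro D x hx v hv
            exact ⟨_, D.smul_mem _ hv, h.rep_weightVector_refl hx (hw v)⟩
          exact hind D₁ D₂ (key D₁) (key D₂) hD)
    have hm1 := hm 1 hnil
    exact ⟨m + 1, 1, by omega, hm1.trans (Nat.one_le_pow _ _ h.prime.pos), fun _ => by omega,
      fun _ => rfl, V.subtype ∘ₗ f.toLinearMap, Subtype.val_injective.comp f.injective,
      fun x => hw (f x), hspan f, (by omega : m + 1 = 1)⟩

end Existence

end EvenDihedralSetting

end

noncomputable section

/-! ## Induced representations -/

namespace Representation

variable {k G N : Type*} [Field k] [Group G] {H : Subgroup G} [AddCommGroup N] [Module k N]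
  (ρ : Representation k H N)

/-- As `mk x y` stands for `x⁻¹ ⊗ y`, this is the balancing relation `x⁻¹ c⁻¹ ⊗ c y = x⁻¹ ⊗ y`. -/
lemma IndV.mk_mul_apply (c : H) (x : G) (y : N) :
    IndV.mk H.subtype ρ ((c : G) * x) (ρ c y) = IndV.mk H.subtype ρ x y := by
  have := Coinvariants.mk_self_apply (tprod ((leftRegular k G).comp H.subtype) ρ) c
    (MonoidAlgebra.single x 1 ⊗ₜ y)
  simpa using this

lemma ind_apply_mk_one (x : G) (y : N) :
    ind H.subtype ρ x (IndV.mk H.subtype ρ 1 y) = IndV.mk H.subtype ρ x⁻¹ y := by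
  rw [ind_mk, one_mul]

lemma ind_coe_apply_mk_one (c : H) (y : N) :
    ind H.subtype ρ (c : G) (IndV.mk H.subtype ρ 1 y) = IndV.mk H.subtype ρ 1 (ρ c y) := by
  rw [ind_apply_mk_one, ← IndV.mk_mul_apply ρ c, mul_inv_cancel]

lemma IndV.eq_top {W : Submodule k (IndV H.subtype ρ)} (hW : ∀ x y, IndV.mk H.subtype ρ x y ∈ W) :
    W = ⊤ := by
  have h0 : W.mkQ = 0 := by
    apply IndV.hom_ext
    intro x
    ext y
    simpa using hW x y
  rw [eq_top_iff]
  intro m _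
  simpa using LinearMap.congr_fun h0 m

/-- The induced module retracts onto the summand of the trivial coset, which gives a left inverse.
-/
lemma IndV.mk_one_injective : Function.Injective (IndV.mk H.subtype ρ 1) := by
  classical
  -- The retraction is `mk x y ↦ ρ(x)⁻¹ y` for `x` in `H` and zero otherwise; the next claim is its
  -- invariance, which lets it descend to coinvariants.
  let φ : G → Module.End k N := fun x => if hx : x ∈ H then ρ ⟨x, hx⟩⁻¹ else 0
  have hφ : ∀ (c : H) (x : G) (y : N), φ ((c : G) * x) (ρ c y) = φ x y := by
    intro c x y
    by_cases hx : x ∈ H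
    · have hcx : (c : G) * x ∈ H := H.mul_mem c.2 hx
      simp only [φ, dif_pos hx, dif_pos hcx]
      rw [← Module.End.mul_apply, ← map_mul]
      congr 2
      have : (⟨(c : G) * x, hcx⟩ : H) = c * ⟨x, hx⟩ := rfl
      rw [this]
      group
    · have hcx : (c : G) * x ∉ H := fun hh => hx ((H.mul_mem_cancel_left c.2).1 hh)
      simp only [φ, dif_neg hx, dif_neg hcx]
      rfl
  let L : IndV H.subtype ρ →ₗ[k] N := Coinvariants.lift _
    (TensorProduct.lift
      ((Finsupp.lsum k fun x : G => LinearMap.toSpanSingleton k _ (φ x)) ∘ₗ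
        (MonoidAlgebra.coeffLinearEquiv k).toLinearMap))
    (by
      intro c
      apply TensorProduct.ext
      apply MonoidAlgebra.lhom_ext'
      intro x
      apply LinearMap.ext_ring
      ext y
      simpa using hφ c x y)
  have hL : ∀ y, L (IndV.mk H.subtype ρ 1 y) = y := by
    intro y
    have : φ 1 y = y := by
      have h1 : (⟨1, H.one_mem⟩ : H)⁻¹ = 1 := inv_one
      simp only [φ, dif_pos H.one_mem]
      rw [h1, map_one, Module.End.one_apply]
    simpa [L] using this
  exact Function.LeftInverse.injective hL

end Representation

namespace EvenDihedralSetting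

open DihedralWeight YDModule DihedralGroup Matrix

variable {k : Type u} [Field k] {p s t n : ℕ} {ξ : k}

/-! ## The labels of the listed modules -/

lemma one_lt (h : EvenDihedralSetting k p s t n ξ) : 1 < n := by
  have h1 := h.neZero.ne
  obtain ⟨m, hm⟩ := h.even
  omega

lemma val_one (h : EvenDihedralSetting k p s t n ξ) : (1 : ZMod n).val = 1 := by
  have := Fact.mk h.one_lt
  exact ZMod.val_one n

lemma jordanMatrix_sub (m : ℕ) (c : k) : jordanMatrix m c - c • 1 = jordanMatrix m 0 := by
  ext i j
  by_cases hij : i = j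
  · subst hij; simp [jordanMatrix]
  · simp [jordanMatrix, hij]

/-- The nilpotent part of a block does not depend on the eigenvalue. Its power with exponent `p ^ s`
vanishes by the case of eigenvalue `1`, where the power of the block is already known to be the
identity. -/
lemma jordanMatrix_pow_eq_smul (h : EvenDihedralSetting k p s t n ξ) {m : ℕ} (hm : m ≤ p ^ s)
    (c : k) : jordanMatrix m c ^ p ^ s = c ^ p ^ s • 1 := by
  have := Fact.mk h.prime
  have := h.charP
  have h1 := jordanMatrix_pow_eq_one (k := k) (t := 1) hm 1 (one_pow 1)
  rw [mul_one] at h1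
  rw [← sub_eq_zero, ← h.sub_smul_one_pow, jordanMatrix_sub, ← jordanMatrix_sub m 1,
    h.sub_smul_one_pow, h1, one_pow, one_smul, sub_self]

section

variable {X : YDModule.{u, u, w} k (MonoidAlgebra k (DihedralGroup n))}

/-- The eigenvalue condition of the weight need not be checked separately: a block of size at most
`p ^ s` has a scalar as its power with exponent `p ^ s`. -/
lemma hasLabel_rot (h : EvenDihedralSetting k p s t n ξ) {l : ZMod n} {j : ZMod t} {m : ℕ} {η : ℤˣ}
    (hm : m ≤ p ^ s) {c : k} (hc : ξ ^ j.val = c) {f : (Fin m → k) →ₗ[k] X.carrier}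
    (hinj : Function.Injective f) (hdeg : ∀ x, X.degreeProj (r l) (f x) = f x)
    (hJ : ∀ x, f (jordanMatrix m c *ᵥ x) = X.rep (r 1) (f x))
    (hT : -l = l → -j = j → ∀ x,
      f (((η : ℤ) : k) • involutionMatrix m c *ᵥ x) = X.rep (sr 0) (f x))
    (hspan : ∀ W : Submodule k X.carrier, (∀ g x, X.rep g (f x) ∈ W) → W = ⊤) :
    HasLabel X p s ξ (rot l j) m η := by
  subst hc
  refine ⟨f, hinj, fun x => ⟨hdeg x, ?_⟩, hspan, hJ, hT⟩
  rw [rep_r_natCast, ← map_pow_mulVec hJ, h.jordanMatrix_pow_eq_smul hm, smul_mulVec, one_mulVec,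
    map_smul, ← pow_mul, ← pow_mul, mul_comm]

lemma phiRep_r (h : EvenDihedralSetting k p s t n ξ) {m : ℕ} (hm : m ≤ p ^ s) {c : k}
    (hc : c ^ 2 = 1) (e : ℤˣ) (x : Fin m → k) :
    h.phiRep m hm c hc e (r 1) x = jordanMatrix m c *ᵥ x := by
  have : h.phiRep m hm c hc e (r 1) x = jordanMatrix m c ^ (1 : ZMod n).val *ᵥ x := rfl
  rw [this, h.val_one, pow_one]

lemma phiRep_sr (h : EvenDihedralSetting k p s t n ξ) {m : ℕ} (hm : m ≤ p ^ s) {c : k}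
    (hc : c ^ 2 = 1) (e : ℤˣ) (x : Fin m → k) :
    h.phiRep m hm c hc e (sr 0) x = ((e : ℤ) : k) • involutionMatrix m c *ᵥ x := by
  have : h.phiRep m hm c hc e (sr 0) x =
    ((((e : ℤ) : k) • involutionMatrix m c) * jordanMatrix m c ^ (0 : ZMod n).val) *ᵥ x := rfl
  rw [this, ZMod.val_zero, pow_zero, mul_one, smul_mulVec]

lemma rhoRep_r (h : EvenDihedralSetting k p s t n ξ) {H : Subgroup (DihedralGroup n)}
    (hH : ∀ i, sr i ∉ H) {m : ℕ} (hm : m ≤ p ^ s) (j : ℕ) (h1 : r 1 ∈ H) (x : Fin m → k) :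
    h.rhoRep H hH m hm j ⟨r 1, h1⟩ x = jordanMatrix m (ξ ^ j) *ᵥ x := by
  have : h.rhoRep H hH m hm j ⟨r 1, h1⟩ x = jordanMatrix m (ξ ^ j) ^ (1 : ZMod n).val *ᵥ x := rfl
  rw [this, h.val_one, pow_one]

section

variable {M : Type w} [AddCommGroup M] [Module k M] {z : DihedralGroup n}
  (hz : z ∈ Subgroup.center (DihedralGroup n)) (ρ : Representation k (DihedralGroup n) M)

/-- The identity map to the Yetter-Drinfeld module `YDModule.central`. -/
def toCentral : M ≃ₗ[k] (YDModule.central z hz ρ).carrier := toOfHomogeneous _ _ _ _ _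

lemma rep_toCentral (x : DihedralGroup n) (m : M) :
    (YDModule.central z hz ρ).rep x (toCentral hz ρ m) = toCentral hz ρ (ρ x m) :=
  rep_toOfHomogeneous _ _ _ _ _ _ _

lemma degreeProj_toCentral (m : M) :
    (YDModule.central z hz ρ).degreeProj z (toCentral hz ρ m) = toCentral hz ρ m :=
  degreeProj_toOfHomogeneous _ _ _ _ _ rfl

end

section

variable {N : Type w} [AddCommGroup N] [Module k N] (g : DihedralGroup n)
  (ρ : Representation k (Subgroup.centralizer {g}) N)

/-- The identity map to the Yetter-Drinfeld module `YDModule.induced`. -/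
def toInduced : Representation.IndV (Subgroup.centralizer {g}).subtype ρ ≃ₗ[k]
    (YDModule.induced g ρ).carrier := toOfHomogeneous _ _ _ _ _

lemma rep_toInduced (x : DihedralGroup n)
    (m : Representation.IndV (Subgroup.centralizer {g}).subtype ρ) :
    (YDModule.induced g ρ).rep x (toInduced g ρ m) = toInduced g ρ (Representation.ind _ ρ x m) :=
  rep_toOfHomogeneous _ _ _ _ _ _ _

lemma degreeProj_toInduced (y : N) :
    (YDModule.induced g ρ).degreeProj g
      (toInduced g ρ (Representation.IndV.mk (Subgroup.centralizer {g}).subtype ρ 1 y)) =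
      toInduced g ρ (Representation.IndV.mk (Subgroup.centralizer {g}).subtype ρ 1 y) := by
  refine degreeProj_toOfHomogeneous _ _ _ _ _ ?_
  rw [inducedCoaction_mk, inv_one, one_mul, mul_one]

lemma eq_top_of_toInduced {W : Submodule k (YDModule.induced g ρ).carrier}
    (hW : ∀ x y, (YDModule.induced g ρ).rep x (toInduced g ρ
      (Representation.IndV.mk (Subgroup.centralizer {g}).subtype ρ 1 y)) ∈ W) : W = ⊤ := by
  have : W.comap (toInduced g ρ).toLinearMap = ⊤ := by
    apply Representation.IndV.eq_top
    intro x y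
    have := hW x⁻¹ y
    rwa [rep_toInduced, Representation.ind_apply_mk_one, inv_inv] at this
  rw [eq_top_iff]
  intro m _
  obtain ⟨m, rfl⟩ := (toInduced g ρ).surjective m
  have hm : m ∈ W.comap (toInduced g ρ).toLinearMap := this ▸ Submodule.mem_top
  exact hm

end

/-- The degree is central and `a` has one eigenvalue, so the whole module is a single weight
component. -/
lemma hasLabel_phiRep (h : EvenDihedralSetting k p s t n ξ) {l : ZMod n} {z : DihedralGroup n}
    (hz : z ∈ Subgroup.center (DihedralGroup n)) (hl : z = r l) {j : ZMod t} {m : ℕ}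
    (hm : m ≤ p ^ s) {c : k} (hc : c ^ 2 = 1) (hj : ξ ^ j.val = c) (e : ℤˣ) :
    HasLabel (YDModule.central z hz (h.phiRep m hm c hc e)) p s ξ (rot l j) m e := by
  subst hl
  refine h.hasLabel_rot hm hj (f := (toCentral hz _).toLinearMap) (toCentral hz _).injective
    (fun x => degreeProj_toCentral hz _ x) (fun x => ?_) (fun _ _ x => ?_) fun W hW => ?_
  · rw [LinearEquiv.coe_coe, rep_toCentral, h.phiRep_r]
  · rw [LinearEquiv.coe_coe, rep_toCentral, h.phiRep_sr]
  · rw [eq_top_iff]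
    intro y _
    obtain ⟨x, rfl⟩ := (toCentral hz (h.phiRep m hm c hc e)).surjective y
    have := hW 1 x
    rwa [map_one] at this

/-- The generating component is `1 ⊗ Q`; the other coset of `C_n` carries the weight with exponent
`-i`. As the two exponents differ, the sign condition is vacuous. -/
lemma hasLabel_ind_rhoRep (h : EvenDihedralSetting k p s t n ξ) {l : ZMod n} {z : DihedralGroup n}
    (hz : z ∈ Subgroup.center (DihedralGroup n)) (hl : z = r l) {i m : ℕ} (hi : i < t)
    (hit : -(i : ZMod t) ≠ i) (hm : m ≤ p ^ s) :
    HasLabel (YDModule.central z hz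
      (Representation.ind (Subgroup.zpowers (DihedralGroup.r 1 : DihedralGroup n)).subtype
        (h.rhoRep _ sr_notMem_zpowers m hm i))) p s ξ (rot l (i : ZMod t)) m 1 := by
  subst hl
  have h1 : (r 1 : DihedralGroup n) ∈ Subgroup.zpowers (r 1 : DihedralGroup n) :=
    Subgroup.mem_zpowers _
  have hr := h.rhoRep_r sr_notMem_zpowers hm i h1
  generalize h.rhoRep _ sr_notMem_zpowers m hm i = ρ at hr
  let e := toCentral hz
    (Representation.ind (Subgroup.zpowers (r 1 : DihedralGroup n)).subtype ρ)
  refine h.hasLabel_rot hm (c := ξ ^ i) (by rw [ZMod.val_natCast_of_lt hi])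
    (f := e.toLinearMap ∘ₗ Representation.IndV.mk _ ρ 1)
    (e.injective.comp (Representation.IndV.mk_one_injective ρ))
    (fun x => degreeProj_toCentral hz _ _) (fun x => ?_) (fun _ hh => absurd hh hit) fun W hW => ?_
  · refine Eq.trans ?_ (rep_toCentral hz _ _ _).symm
    rw [← hr x]
    exact congrArg e (Representation.ind_coe_apply_mk_one ρ ⟨r 1, h1⟩ x).symm
  · have hW' : W.comap e.toLinearMap = ⊤ := by
      apply Representation.IndV.eq_top
      intro x y
      have hxy := hW x⁻¹ y
      have hy : (YDModule.central _ hz _).rep x⁻¹ (e (Representation.IndV.mk _ ρ 1 y)) =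
          e (Representation.IndV.mk _ ρ x y) := by
        rw [rep_toCentral, Representation.ind_apply_mk_one, inv_inv]
      exact hy ▸ hxy
    rw [eq_top_iff]
    intro y _
    obtain ⟨y, rfl⟩ := e.surjective y
    have hy : y ∈ W.comap e.toLinearMap := hW' ▸ Submodule.mem_top
    exact hy

/-- Again `1 ⊗ Q` is the generating component. The degree `a ^ l` is not fixed by reflections, so no
sign enters and the exponent `j` is unrestricted. -/
lemma hasLabel_induced_rhoRep (h : EvenDihedralSetting k p s t n ξ) {l j m : ℕ} (hl : 1 ≤ l)
    (hl' : l ≤ n / 2 - 1) (hj : j < t) (hm : m ≤ p ^ s) (hln : -(l : ZMod n) ≠ l) :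
    HasLabel (YDModule.induced (r ((l : ℕ) : ZMod n) : DihedralGroup n)
      (h.rhoRep _ (sr_notMem_centralizer hl hl') m hm j)) p s ξ
      (rot (l : ZMod n) (j : ZMod t)) m 1 := by
  have h1 : (r 1 : DihedralGroup n) ∈
      Subgroup.centralizer {(r ((l : ℕ) : ZMod n) : DihedralGroup n)} := by
    rw [Subgroup.mem_centralizer_singleton_iff, r_mul_r, r_mul_r, add_comm]
  have hr := h.rhoRep_r (sr_notMem_centralizer hl hl') hm j h1
  generalize h.rhoRep _ (sr_notMem_centralizer hl hl') m hm j = ρ at hr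
  refine h.hasLabel_rot hm (c := ξ ^ j) (by rw [ZMod.val_natCast_of_lt hj])
    (f := (toInduced _ ρ).toLinearMap ∘ₗ Representation.IndV.mk _ ρ 1)
    ((toInduced _ _).injective.comp (Representation.IndV.mk_one_injective ρ))
    (fun x => degreeProj_toInduced _ _ _) (fun x => ?_) (fun hh => absurd hh hln)
    fun W hW => eq_top_of_toInduced _ _ hW
  refine Eq.trans ?_ (rep_toInduced _ _ _ _).symm
  rw [← hr x]
  exact congrArg (toInduced _ ρ) (Representation.ind_coe_apply_mk_one ρ ⟨r 1, h1⟩ x).symm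

lemma kleinRep_apply [NeZero n] (hn : Even n) (c : ZMod n) (e₁ e₂ : ℤˣ)
    (x : Subgroup.centralizer {(sr c : DihedralGroup n)}) (y : k) :
    kleinRep k hn c e₁ e₂ x y = ((kleinValue c e₁ e₂ x.1 : ℤ) : k) • y := by
  obtain ⟨x | x, hx⟩ := x <;> rfl

/-- The centralizer acts on the line `1 ⊗ k` through its sign character, and the values at `a ^ (n /
2)` and `sr c` are the two signs of the weight. -/
lemma hasLabel_induced_kleinRep [NeZero n] (h : EvenDihedralSetting k p s t n ξ) (c : ZMod n)
    (e₁ e₂ : ℤˣ) :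
    HasLabel (YDModule.induced (sr c : DihedralGroup n) (kleinRep k h.even c e₁ e₂)) p s ξ
      (refl c e₁ e₂ : DihedralWeight n t) 1 1 := by
  set ρ := kleinRep k h.even c e₁ e₂ with hρ
  have hmem : ∀ x (hx : x ∈ Subgroup.centralizer {(sr c : DihedralGroup n)}) (y : k),
      (YDModule.induced (sr c : DihedralGroup n) ρ).rep x
        (toInduced _ ρ (Representation.IndV.mk _ ρ 1 y)) =
      ((kleinValue c e₁ e₂ x : ℤ) : k) • toInduced _ ρ (Representation.IndV.mk _ ρ 1 y) := by
    intro x hx y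
    rw [rep_toInduced]
    have := Representation.ind_coe_apply_mk_one ρ ⟨x, hx⟩ y
    rw [hρ, kleinRep_apply, map_smul] at this
    rw [← map_smul]
    exact congrArg _ this
  refine ⟨(toInduced _ _).toLinearMap ∘ₗ Representation.IndV.mk _ ρ 1 ∘ₗ LinearMap.proj 0,
    ((toInduced _ _).injective.comp (Representation.IndV.mk_one_injective ρ)).comp ?_,
    fun x => ⟨degreeProj_toInduced _ _ _, ?_, ?_⟩,
    fun W hW => eq_top_of_toInduced _ _ fun g y => hW g fun _ => y, rfl⟩
  · intro x y hxy
    ext i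
    rw [Subsingleton.elim i 0]
    exact hxy
  · refine (hmem _ ?_ (x 0)).trans ?_
    · rw [Subgroup.mem_centralizer_singleton_iff, h.half_mul_comm]
    · simp only [kleinValue, if_neg (half_ne_zero h.even)]
      rfl
  · refine (hmem _ ?_ (x 0)).trans ?_
    · rw [Subgroup.mem_centralizer_singleton_iff]
    · simp only [kleinValue, if_true, one_mul]
      rfl

end

/-- The labels of the listed modules in the central degree `r l`. -/
def centralLabel (n : ℕ) (l : ZMod n) {q t : ℕ} : DihedralIndex q t → DihedralWeight n t × ℕ × ℤˣ
  | .V0 m => (rot l 0, m, 1)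
  | .V0' m => (rot l 0, m, -1)
  | .VHalf m => (rot l ((t / 2 : ℕ) : ZMod t), m, 1)
  | .VHalf' m => (rot l ((t / 2 : ℕ) : ZMod t), m, -1)
  | .W m i => (rot l ((i : ℕ) : ZMod t), m, 1)

/-- The labels of the listed modules. -/
def label {q t n : ℕ} : YDIndex q t n → DihedralWeight n t × ℕ × ℤˣ
  | .degreeOne x => centralLabel n 0 x
  | .degreeHalf x => centralLabel n ((n / 2 : ℕ) : ZMod n) x
  | .V e₁ e₂ => (refl 0 e₁ e₂, 1, 1)
  | .U e₁ e₂ => (refl (-1) e₁ e₂, 1, 1)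
  | .Q m j l => (rot ((l : ℕ) : ZMod n) ((j : ℕ) : ZMod t), m, 1)

lemma neg_natCast_ne {m i : ℕ} (h1 : 1 ≤ i) (h2 : i ≤ m / 2 - 1) : -(i : ZMod m) ≠ i := by
  intro e
  have h3 : ((2 * i : ℕ) : ZMod m) = 0 := by
    push_cast
    linear_combination -e
  rw [ZMod.natCast_eq_zero_iff] at h3
  have := Nat.le_of_dvd (by omega) h3
  omega

lemma hasLabel_centralModule (h : EvenDihedralSetting k p s t n ξ) {l : ZMod n}
    {z : DihedralGroup n} (hz : z ∈ Subgroup.center (DihedralGroup n)) (hl : z = r l)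
    (x : DihedralIndex (p ^ s) t) :
    HasLabel (h.centralModule z hz x) p s ξ (centralLabel n l x).1 (centralLabel n l x).2.1
      (centralLabel n l x).2.2 := by
  have ht := h.t_ne_zero
  have h0 : ξ ^ (0 : ZMod t).val = 1 := by rw [ZMod.val_zero, pow_zero]
  have hh : ξ ^ ((t / 2 : ℕ) : ZMod t).val = ξ ^ (t / 2) := by
    rw [ZMod.val_natCast_of_lt (by omega)]
  rcases x with m | m | m | m | ⟨m, i⟩
  · exact h.hasLabel_phiRep hz hl m.2.2 _ h0 1
  · exact h.hasLabel_phiRep hz hl m.2.2 _ h0 (-1)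
  · exact h.hasLabel_phiRep hz hl m.2.2 _ hh 1
  · exact h.hasLabel_phiRep hz hl m.2.2 _ hh (-1)
  · have h1 := i.2.1
    have h2 := i.2.2
    exact h.hasLabel_ind_rhoRep hz hl (by omega) (neg_natCast_ne h1 h2) m.2.2

lemma hasLabel_ydModule (h : EvenDihedralSetting k p s t n ξ) (x : YDIndex (p ^ s) t n) :
    HasLabel (h.ydModule x) p s ξ (label x).1 (label x).2.1 (label x).2.2 := by
  have := h.neZero
  rcases x with x | x | ⟨e₁, e₂⟩ | ⟨e₁, e₂⟩ | ⟨m, j, l⟩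
  · exact h.hasLabel_centralModule _ one_def x
  · exact h.hasLabel_centralModule _ rfl x
  · exact h.hasLabel_induced_kleinRep 0 e₁ e₂
  · exact h.hasLabel_induced_kleinRep (-1) e₁ e₂
  · exact h.hasLabel_induced_rhoRep l.2.1 l.2.2 j.2 m.2.2 (neg_natCast_ne l.2.1 l.2.2)

end EvenDihedralSetting

end

noncomputable section

/-! ## Representatives of the orbits of weights -/

/-- For `a ≠ 0` the representatives of `a` and `-a` add up to `m`, so if neither exceeds `m / 2`
they coincide. This makes the canonical representative of a pair `± a` unique. -/
lemma ZMod.neg_eq_self_of_val_le {m : ℕ} [NeZero m] {a : ZMod m} (h1 : a.val ≤ m / 2)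
    (h2 : (-a).val ≤ m / 2) : -a = a := by
  by_cases ha : a = 0
  · rw [ha, neg_zero]
  · apply ZMod.val_injective
    rw [ZMod.neg_val, if_neg ha] at h2 ⊢
    omega

/-- Reduction modulo `2`. It keeps apart the two conjugacy classes of reflections, which are
distinguished by the parity of the index. -/
lemma ZMod.two_mul_ne_one {m : ℕ} (hm : Even m) (i : ZMod m) : 2 * i ≠ 1 := by
  intro h
  have := congrArg (ZMod.castHom hm.two_dvd (ZMod 2)) h
  rw [map_mul, map_one, map_ofNat] at this
  have h2 : (2 : ZMod 2) = 0 := rfl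
  rw [h2, zero_mul] at this
  exact zero_ne_one this

lemma ZMod.natCast_inj_of_lt {m i j : ℕ} (hi : i < m) (hj : j < m) :
    (i : ZMod m) = j ↔ i = j :=
  ⟨fun e => by rw [← ZMod.val_natCast_of_lt hi, e, ZMod.val_natCast_of_lt hj], fun e => by rw [e]⟩

lemma ZMod.neg_half {m : ℕ} (hm : Even m) : -((m / 2 : ℕ) : ZMod m) = ((m / 2 : ℕ) : ZMod m) := by
  linear_combination -half_add_half hm

namespace DihedralWeight

open DihedralGroup

variable {n t : ℕ}

/-- The chosen representatives of the orbits of the weights under `D_n`. -/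
def IsCanonical : DihedralWeight n t → Prop
  | .inl (l, j) => l.val ≤ n / 2 ∧ (-l = l → j.val ≤ t / 2)
  | .inr (c, _, _) => c = 0 ∨ c = -1

lemma isCanonical_rot {l : ZMod n} {j : ZMod t} :
    IsCanonical (rot l j) ↔ l.val ≤ n / 2 ∧ (-l = l → j.val ≤ t / 2) := Iff.rfl

lemma isCanonical_refl {c : ZMod n} {e₁ e₂ : ℤˣ} :
    IsCanonical (refl c e₁ e₂ : DihedralWeight n t) ↔ c = 0 ∨ c = -1 := Iff.rfl

/-- An orbit contains at most one canonical weight. For rotations the orbit is `± (l, j)`: the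
normalization of `l` decides unless `-l = l`, and then that of `j` does. For reflections the parity
of `c` is invariant and separates `0` from `-1`. -/
lemma IsCanonical.smul_eq [NeZero n] [NeZero t] (hn : Even n) {i : DihedralWeight n t}
    (hi : IsCanonical i) {x : DihedralGroup n} (hx : IsCanonical (x • i)) : x • i = i := by
  rcases i with ⟨l, j⟩ | ⟨c, e₁, e₂⟩
  · change IsCanonical (rot l j) at hi
    change IsCanonical (x • rot l j) at hx
    change x • rot l j = rot l j
    rcases x with x | x
    · rw [r_smul_rot]
    · rw [sr_smul_rot, isCanonical_rot] at hx
      rw [isCanonical_rot] at hi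
      have h1 := ZMod.neg_eq_self_of_val_le hi.1 hx.1
      rw [sr_smul_rot, rot_inj]
      exact ⟨h1, ZMod.neg_eq_self_of_val_le (hi.2 h1) (hx.2 (congrArg _ h1))⟩
  · change IsCanonical (refl c e₁ e₂) at hi
    change IsCanonical (x • refl c e₁ e₂) at hx
    change x • refl c e₁ e₂ = refl c e₁ e₂
    rcases x with x | x
    · rw [r_smul_refl, isCanonical_refl] at hx
      rw [r_smul_refl, refl_inj]
      have h1 := ZMod.two_mul_ne_one hn x
      have h2 := ZMod.two_mul_ne_one hn (-x)
      rw [isCanonical_refl] at hi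
      refine ⟨?_, rfl, rfl⟩
      rcases hi with rfl | rfl <;> rcases hx with hx | hx
      · exact hx
      · exact absurd (by linear_combination -hx) h1
      · exact absurd (by linear_combination hx) h2
      · exact hx
    · rw [sr_smul_refl, isCanonical_refl] at hx
      rw [sr_smul_refl, refl_inj]
      have h2 := ZMod.two_mul_ne_one hn (-x)
      rw [isCanonical_refl] at hi
      refine ⟨?_, rfl, rfl⟩
      rcases hi with rfl | rfl <;> rcases hx with hx | hx
      · exact hx
      · exact absurd (by linear_combination -hx) h2
      · exact absurd (by linear_combination -hx) h2
      · exact hx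

lemma exists_isCanonical_smul [NeZero n] [NeZero t] (i : DihedralWeight n t) :
    ∃ x : DihedralGroup n, IsCanonical (x • i) := by
  have hval : ∀ {m : ℕ} [NeZero m] (a : ZMod m), ¬ a.val ≤ m / 2 → (-a).val ≤ m / 2 := by
    intro m _ a ha
    rw [ZMod.neg_val]
    split_ifs
    · exact Nat.zero_le _
    · omega
  rcases i with ⟨l, j⟩ | ⟨c, e₁, e₂⟩
  · change ∃ x : DihedralGroup n, IsCanonical (x • rot l j)
    by_cases hl : l.val ≤ n / 2
    · by_cases hj : -l = l → j.val ≤ t / 2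
      · exact ⟨r 0, isCanonical_rot.2 ⟨hl, hj⟩⟩
      · push Not at hj
        refine ⟨sr 0, isCanonical_rot.2 ⟨?_, fun _ => hval _ (not_le.2 hj.2)⟩⟩
        rw [hj.1]
        exact hl
    -- After negation the condition on `j` is vacuous: `-l` fixed by negation would mean `-l = l`,
    -- and `l` was too large.
    · refine ⟨sr 0, isCanonical_rot.2 ⟨hval _ hl, fun h => ?_⟩⟩
      have h' : -l = l := h.symm.trans (neg_neg l)
      have := hval _ hl
      rw [h'] at this
      exact absurd this hl
  · change ∃ x : DihedralGroup n, IsCanonical (x • refl c e₁ e₂)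
    -- The rotation `r i` shifts the index by `-2 i`, so an even index is moved to `0` and an odd
    -- one to `-1`.
    rcases Nat.even_or_odd' c.val with ⟨q, hq | hq⟩
    · refine ⟨r q, isCanonical_refl.2 (Or.inl ?_)⟩
      rw [← ZMod.natCast_zmod_val c, hq]
      push_cast
      ring
    · refine ⟨r (q + 1), isCanonical_refl.2 (Or.inr ?_)⟩
      rw [← ZMod.natCast_zmod_val c, hq]
      push_cast
      ring

end DihedralWeight

/-! ## The list of labels -/

namespace EvenDihedralSetting

open DihedralWeight YDModule DihedralGroup

variable {k : Type u} [Field k] {p s t n : ℕ} {ξ : k}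

lemma centralLabel_fst {q : ℕ} (l : ZMod n) (x : DihedralIndex q t) :
    ∃ j, (centralLabel n l x).1 = rot l j := by
  cases x <;> exact ⟨_, rfl⟩

lemma centralLabel_injective {q : ℕ} [NeZero t] (ht : Even t) (l : ZMod n) :
    Function.Injective (centralLabel n l : DihedralIndex q t → _) := by
  have h0 := half_ne_zero ht
  have ht0 := NeZero.ne t
  have h1 : ∀ i : Set.Icc 1 (t / 2 - 1), ((i : ℕ) : ZMod t) ≠ 0 := by
    intro i
    obtain ⟨i, hi1, hi2⟩ := i
    rw [← Nat.cast_zero, Ne, ZMod.natCast_inj_of_lt (by dsimp only; omega) (by omega)]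
    dsimp only; omega
  have h2 : ∀ i : Set.Icc 1 (t / 2 - 1), ((i : ℕ) : ZMod t) ≠ ((t / 2 : ℕ) : ZMod t) := by
    intro i
    obtain ⟨i, hi1, hi2⟩ := i
    rw [Ne, ZMod.natCast_inj_of_lt (by dsimp only; omega) (by omega)]
    dsimp only; omega
  have h3 : ∀ i i' : Set.Icc 1 (t / 2 - 1), ((i : ℕ) : ZMod t) = ((i' : ℕ) : ZMod t) → i = i' := by
    intro i i' hi
    obtain ⟨i, hi1, hi2⟩ := i
    obtain ⟨i', hi1', hi2'⟩ := i'
    rw [ZMod.natCast_inj_of_lt (by dsimp only; omega) (by dsimp only; omega)] at hi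
    exact Subtype.ext hi
  have hu : (1 : ℤˣ) ≠ -1 := by decide
  rintro (m | m | m | m | ⟨m, i⟩) (m' | m' | m' | m' | ⟨m', i'⟩) e <;>
    simp only [centralLabel, Prod.mk.injEq, rot_inj, true_and, and_true, hu, hu.symm, and_false,
      h0, h0.symm, h1, (h1 _).symm, h2, (h2 _).symm, false_and] at e
  · rw [Subtype.ext e]
  · rw [Subtype.ext e]
  · rw [Subtype.ext e]
  · rw [Subtype.ext e]
  · rw [Subtype.ext e.2, h3 _ _ e.1]

lemma label_injective (h : EvenDihedralSetting k p s t n ξ) :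
    Function.Injective (label : YDIndex (p ^ s) t n → _) := by
  have := h.neZero
  have : NeZero t := ⟨h.t_ne_zero⟩
  have hn0 := NeZero.ne n
  have h0 := half_ne_zero h.even
  have h1 : ∀ i : Set.Icc 1 (n / 2 - 1), ((i : ℕ) : ZMod n) ≠ 0 := by
    intro i
    obtain ⟨i, hi1, hi2⟩ := i
    rw [← Nat.cast_zero, Ne, ZMod.natCast_inj_of_lt (by dsimp only; omega) (by omega)]
    dsimp only; omega
  have h2 : ∀ i : Set.Icc 1 (n / 2 - 1), ((i : ℕ) : ZMod n) ≠ ((n / 2 : ℕ) : ZMod n) := by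
    intro i
    obtain ⟨i, hi1, hi2⟩ := i
    rw [Ne, ZMod.natCast_inj_of_lt (by dsimp only; omega) (by omega)]
    dsimp only; omega
  have h3 : ∀ i i' : Set.Icc 1 (n / 2 - 1), ((i : ℕ) : ZMod n) = ((i' : ℕ) : ZMod n) → i = i' := by
    intro i i' hi
    obtain ⟨i, hi1, hi2⟩ := i
    obtain ⟨i', hi1', hi2'⟩ := i'
    rw [ZMod.natCast_inj_of_lt (by dsimp only; omega) (by dsimp only; omega)] at hi
    exact Subtype.ext hi
  have h4 : (0 : ZMod n) ≠ -1 := fun e =>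
    ZMod.two_mul_ne_one h.even 0 (by linear_combination -e)
  have hc : ∀ (l l' : ZMod n) (x y : DihedralIndex (p ^ s) t),
      centralLabel n l x = centralLabel n l' y → l = l' := by
    intro l l' x y e
    obtain ⟨j, hj⟩ := centralLabel_fst l x
    obtain ⟨j', hj'⟩ := centralLabel_fst l' y
    exact (rot_inj.1 (hj.symm.trans ((congrArg Prod.fst e).trans hj'))).1
  have hr : ∀ (l c : ZMod n) (x : DihedralIndex (p ^ s) t) (e₁ e₂ : ℤˣ) (m : ℕ) (η : ℤˣ),
      centralLabel n l x ≠ (refl c e₁ e₂, m, η) := by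
    intro l c x e₁ e₂ m η e
    obtain ⟨j, hj⟩ := centralLabel_fst l x
    exact rot_ne_refl (hj.symm.trans (congrArg Prod.fst e))
  have hq : ∀ (l l' : ZMod n) (x : DihedralIndex (p ^ s) t) (j : ZMod t) (m : ℕ) (η : ℤˣ),
      centralLabel n l x = (rot l' j, m, η) → l = l' := by
    intro l l' x j m η e
    obtain ⟨j, hj⟩ := centralLabel_fst l x
    exact (rot_inj.1 (hj.symm.trans (congrArg Prod.fst e))).1
  rintro (x | x | ⟨e₁, e₂⟩ | ⟨e₁, e₂⟩ | ⟨m, j, l⟩) (y | y | ⟨e₁', e₂'⟩ | ⟨e₁', e₂'⟩ | ⟨m', j', l'⟩) e <;>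
    simp only [label] at e
  · rw [centralLabel_injective h.even_t _ e]
  · exact absurd (hc _ _ _ _ e).symm h0
  · exact absurd e (hr _ _ _ _ _ _ _)
  · exact absurd e (hr _ _ _ _ _ _ _)
  · exact absurd (hq _ _ _ _ _ _ e).symm (h1 l')
  · exact absurd (hc _ _ _ _ e) h0
  · rw [centralLabel_injective h.even_t _ e]
  · exact absurd e (hr _ _ _ _ _ _ _)
  · exact absurd e (hr _ _ _ _ _ _ _)
  · exact absurd (hq _ _ _ _ _ _ e).symm (h2 l')
  · exact absurd e.symm (hr _ _ _ _ _ _ _)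
  · exact absurd e.symm (hr _ _ _ _ _ _ _)
  · obtain ⟨-, rfl, rfl⟩ := refl_inj.1 (congrArg Prod.fst e)
    rfl
  · exact absurd (refl_inj.1 (congrArg Prod.fst e)).1 h4
  · exact absurd (congrArg Prod.fst e).symm rot_ne_refl
  · exact absurd e.symm (hr _ _ _ _ _ _ _)
  · exact absurd e.symm (hr _ _ _ _ _ _ _)
  · exact absurd (refl_inj.1 (congrArg Prod.fst e)).1.symm h4
  · obtain ⟨-, rfl, rfl⟩ := refl_inj.1 (congrArg Prod.fst e)
    rfl
  · exact absurd (congrArg Prod.fst e).symm rot_ne_refl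
  · exact absurd (hq _ _ _ _ _ _ e.symm).symm (h1 l)
  · exact absurd (hq _ _ _ _ _ _ e.symm).symm (h2 l)
  · exact absurd (congrArg Prod.fst e) rot_ne_refl
  · exact absurd (congrArg Prod.fst e) rot_ne_refl
  · obtain ⟨hl, hj⟩ := rot_inj.1 (congrArg Prod.fst e)
    rw [ZMod.natCast_inj_of_lt j.2 j'.2] at hj
    rw [Subtype.ext (congrArg (fun z => z.2.1) e), h3 _ _ hl, Fin.ext hj]

lemma isCanonical_label (h : EvenDihedralSetting k p s t n ξ) (x : YDIndex (p ^ s) t n) :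
    IsCanonical (label x).1 := by
  have hn0 := h.neZero.ne
  have ht0 := h.t_ne_zero
  have hc : ∀ l : ZMod n, l.val ≤ n / 2 → ∀ x : DihedralIndex (p ^ s) t,
      IsCanonical (centralLabel n l x).1 := by
    intro l hl x
    have hh : ((t / 2 : ℕ) : ZMod t).val ≤ t / 2 := by
      rw [ZMod.val_natCast_of_lt (by omega)]
    have h0 : (0 : ZMod t).val ≤ t / 2 := by
      rw [ZMod.val_zero]; omega
    rcases x with m | m | m | m | ⟨m, i, hi1, hi2⟩
    · exact ⟨hl, fun _ => h0⟩
    · exact ⟨hl, fun _ => h0⟩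
    · exact ⟨hl, fun _ => hh⟩
    · exact ⟨hl, fun _ => hh⟩
    · refine ⟨hl, fun _ => ?_⟩
      rw [ZMod.val_natCast_of_lt (by dsimp only; omega)]
      dsimp only; omega
  rcases x with x | x | ⟨e₁, e₂⟩ | ⟨e₁, e₂⟩ | ⟨m, j, l, hl1, hl2⟩
  · exact hc _ (by rw [ZMod.val_zero]; omega) x
  · exact hc _ (by rw [ZMod.val_natCast_of_lt (by omega)]) x
  · exact Or.inl rfl
  · exact Or.inr rfl
  · refine ⟨?_, fun e => absurd e (neg_natCast_ne hl1 hl2)⟩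
    rw [ZMod.val_natCast_of_lt (by dsimp only; omega)]
    dsimp only; omega

lemma label_ne_zero {q : ℕ} (x : YDIndex q t n) : (label x).2.1 ≠ 0 := by
  have hc : ∀ (l : ZMod n) (x : DihedralIndex q t), (centralLabel n l x).2.1 ≠ 0 := by
    rintro l (m | m | m | m | ⟨m, i⟩) <;> exact Nat.one_le_iff_ne_zero.1 m.2.1
  rcases x with x | x | ⟨e₁, e₂⟩ | ⟨e₁, e₂⟩ | ⟨m, j, l⟩
  · exact hc _ x
  · exact hc _ x
  · exact one_ne_zero
  · exact one_ne_zero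
  · exact Nat.one_le_iff_ne_zero.1 m.2.1

/-- Away from the weights fixed by `b` the module does not determine the sign. The convention that
the sign is `1` there is what makes the label an invariant. -/
lemma label_eq_one (h : EvenDihedralSetting k p s t n ξ) (x : YDIndex (p ^ s) t n)
    (hx : ¬ IsFixed (label x).1) : (label x).2.2 = 1 := by
  have hc : ∀ l : ZMod n, -l = l → ∀ x : DihedralIndex (p ^ s) t,
      ¬ IsFixed (centralLabel n l x).1 → (centralLabel n l x).2.2 = 1 := by
    rintro l hl (m | m | m | m | ⟨m, i⟩) hx
    · rfl
    · exact absurd ⟨hl, neg_zero⟩ hx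
    · rfl
    · exact absurd ⟨hl, ZMod.neg_half h.even_t⟩ hx
    · rfl
  rcases x with x | x | ⟨e₁, e₂⟩ | ⟨e₁, e₂⟩ | ⟨m, j, l⟩
  · exact hc _ neg_zero x hx
  · exact hc _ (ZMod.neg_half h.even) x hx
  · rfl
  · rfl
  · rfl

/-- The exponents with `-j = j` are `0` and `t / 2`, and these account for the four families with
signs. Every other canonical exponent lies strictly between them and belongs to an induced module.
-/
lemma exists_centralLabel_eq {q : ℕ} [NeZero t] (ht : Even t) (l : ZMod n) {j : ZMod t}
    (hj : j.val ≤ t / 2) {m : ℕ} (hm1 : 1 ≤ m) (hm : m ≤ q) {η : ℤˣ} (hη : -j ≠ j → η = 1) :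
    ∃ x : DihedralIndex q t, centralLabel n l x = (rot l j, m, η) := by
  by_cases hjj : -j = j
  · rcases eq_zero_or_eq_half ht (i := j) (by linear_combination -hjj) with rfl | rfl <;>
      rcases Int.units_eq_one_or η with rfl | rfl
    · exact ⟨.V0 ⟨m, hm1, hm⟩, rfl⟩
    · exact ⟨.V0' ⟨m, hm1, hm⟩, rfl⟩
    · exact ⟨.VHalf ⟨m, hm1, hm⟩, rfl⟩
    · exact ⟨.VHalf' ⟨m, hm1, hm⟩, rfl⟩
  · obtain rfl := hη hjj
    have h0 : j.val ≠ 0 := by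
      intro e
      rw [ZMod.val_eq_zero] at e
      exact hjj (by rw [e, neg_zero])
    have h1 : j.val ≠ t / 2 := by
      intro e
      rw [← ZMod.natCast_zmod_val j, e] at hjj
      exact hjj (ZMod.neg_half ht)
    refine ⟨.W ⟨m, hm1, hm⟩ ⟨j.val, by omega, by omega⟩, ?_⟩
    change (rot l ((j.val : ℕ) : ZMod t), m, 1) = _
    rw [ZMod.natCast_zmod_val]

/-- This is the completeness of the list on the level of labels: `l = 0` and `l = n / 2` are the
central rotation degrees, the remaining canonical `l` lie strictly between, and `c = 0`, `c = -1`
are the two classes of reflections. -/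
lemma exists_label_eq (h : EvenDihedralSetting k p s t n ξ) {i : DihedralWeight n t}
    (hi : IsCanonical i) {m : ℕ} (hm1 : 1 ≤ m) (hm : m ≤ p ^ s) (hr : IsReflection i → m = 1)
    {η : ℤˣ} (hη : ¬ IsFixed i → η = 1) :
    ∃ x : YDIndex (p ^ s) t n, label x = (i, m, η) := by
  have := h.neZero
  have : NeZero t := ⟨h.t_ne_zero⟩
  rcases i with ⟨l, j⟩ | ⟨c, e₁, e₂⟩
  · by_cases hl : -l = l
    · obtain ⟨x, hx⟩ : ∃ x : DihedralIndex (p ^ s) t, centralLabel n l x = (rot l j, m, η) :=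
        exists_centralLabel_eq h.even_t l (hi.2 hl) hm1 hm fun hj => hη fun hf => hj hf.2
      rcases eq_zero_or_eq_half h.even (i := l) (by linear_combination -hl) with rfl | rfl
      · exact ⟨.degreeOne x, hx⟩
      · exact ⟨.degreeHalf x, hx⟩
    · obtain rfl := hη fun hf => hl hf.1
      have h0 : l.val ≠ 0 := by
        intro e
        rw [ZMod.val_eq_zero] at e
        exact hl (by rw [e, neg_zero])
      have h1 : l.val ≠ n / 2 := by
        intro e
        rw [← ZMod.natCast_zmod_val l, e] at hl
        exact hl (ZMod.neg_half h.even)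
      have h2 : l.val ≤ n / 2 := hi.1
      refine ⟨.Q ⟨m, hm1, hm⟩ ⟨j.val, ZMod.val_lt j⟩ ⟨l.val, by omega, by omega⟩, ?_⟩
      change (rot ((l.val : ℕ) : ZMod n) ((j.val : ℕ) : ZMod t), m, 1) = _
      rw [ZMod.natCast_zmod_val, ZMod.natCast_zmod_val]
      rfl
  · obtain rfl := hr trivial
    obtain rfl := hη id
    have hc : c = 0 ∨ c = -1 := hi
    rcases hc with rfl | rfl
    · exact ⟨.V e₁ e₂, rfl⟩
    · exact ⟨.U e₁ e₂, rfl⟩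

/-! ## The classification -/

lemma isIndecomposable_ydModule (h : EvenDihedralSetting k p s t n ξ) (x : YDIndex (p ^ s) t n) :
    (h.ydModule x).IsIndecomposable :=
  h.isIndecomposable_of_hasLabel (label_ne_zero x) (h.hasLabel_ydModule x)

lemma eq_of_isIso_ydModule (h : EvenDihedralSetting k p s t n ξ) {x y : YDIndex (p ^ s) t n}
    (hxy : IsIso (h.ydModule x) (h.ydModule y)) : x = y := by
  have := h.neZero
  have : NeZero t := ⟨h.t_ne_zero⟩
  have hx := h.hasLabel_ydModule x
  have hy := HasLabel.of_isIso h hxy (h.hasLabel_ydModule y)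
  obtain ⟨g, hg⟩ := HasLabel.mem_orbit h (label_ne_zero x) hx hy
  -- The two weights lie in one orbit and both are canonical, hence they are equal.
  have hi : (label y).1 = (label x).1 := by
    have hc := h.isCanonical_label y
    rw [← hg] at hc ⊢
    exact (h.isCanonical_label x).smul_eq h.even hc
  rw [hi] at hy
  obtain ⟨hm, hη⟩ := HasLabel.unique h (label_ne_zero x) hx hy
  refine h.label_injective (Prod.ext hi.symm (Prod.ext hm ?_))
  by_cases hf : IsFixed (label x).1
  · generalize (label x).1 = i at hf hη
    rcases i with ⟨l, j⟩ | i
    · exact hη l j rfl hf.1 hf.2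
    · exact hf.elim
  · rw [h.label_eq_one x hf, h.label_eq_one y (hi ▸ hf)]

lemma exists_isIso_ydModule (h : EvenDihedralSetting k p s t n ξ)
    {M : YDModule.{u, u, w} k (MonoidAlgebra k (DihedralGroup n))} [FiniteDimensional k M.carrier]
    (hM : M.IsIndecomposable) : ∃ x, IsIso M (h.ydModule x) := by
  have := h.neZero
  have : NeZero t := ⟨h.t_ne_zero⟩
  have := hM.1
  have hP := h.isGrading_weightProj (X := M)
  obtain ⟨i, v, hv⟩ := hP.exists_apply_ne_zero
  obtain ⟨g, hg⟩ := exists_isCanonical_smul i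
  -- The group element `g` carries the nonzero component of weight `i` isomorphically to that of the
  -- canonical weight, so the label can be read off there.
  have hne : ∃ v, weightProj M p s t ξ (g • i) v ≠ 0 := by
    refine ⟨M.rep g v, fun e => hv ?_⟩
    rw [← hP.map_apply] at e
    rw [← map_zero (M.rep g)] at e
    exact (M.rep.apply_bijective g).1 e
  obtain ⟨m, η, hm1, hm, hr, hη, hl⟩ := h.exists_hasLabel hM hne
  obtain ⟨x, hx⟩ := h.exists_label_eq hg hm1 hm hr hη
  refine ⟨x, h.isIso_of_hasLabel hl ?_⟩
  have := h.hasLabel_ydModule x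
  rwa [hx] at this

end EvenDihedralSetting

lemma IsIndecomposableModule.of_linearEquiv {R M N : Type*} [Ring R] [AddCommGroup M] [Module R M]
    [AddCommGroup N] [Module R N] (e : M ≃ₗ[R] N) (h : IsIndecomposableModule R N) :
    IsIndecomposableModule R M := by
  have := h.1
  refine ⟨e.toEquiv.nontrivial, fun W₁ W₂ hW => ?_⟩
  have hW' := hW.map (Submodule.orderIsoMapComap e)
  exact (h.2 _ _ hW').imp Submodule.map_eq_bot_iff.1 Submodule.map_eq_bot_iff.1

end

theorem mainTheorem2 {k : Type u} [Field k] [IsAlgClosed k] {p s t n : ℕ} {ξ : k}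
    (h : EvenDihedralSetting k p s t n ξ) :
    ((∀ x, FiniteDimensional k (h.ydModule x).carrier ∧ (h.ydModule x).IsIndecomposable) ∧
      (∀ x y, YDModule.IsIso (h.ydModule x) (h.ydModule y) → x = y) ∧
      (∀ M : YDModule.{u, u, w} k (MonoidAlgebra k (DihedralGroup n)),
        FiniteDimensional k M.carrier → M.IsIndecomposable →
          ∃ x, YDModule.IsIso M (h.ydModule x))) ∧
    (∀ e₁ e₂ : ℤˣ, (h.ydModule (.V e₁ e₂)).IsSimple ∧ (h.ydModule (.U e₁ e₂)).IsSimple) ∧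
    ((∀ x, IsIndecomposableModule (QuantumDouble k (DihedralGroup n)) (h.ydModule x).Double) ∧
      (∀ x y, Nonempty ((h.ydModule x).Double ≃ₗ[QuantumDouble k (DihedralGroup n)]
        (h.ydModule y).Double) → x = y) ∧
      (∀ (M : Type w) [AddCommGroup M] [Module k M] [Module (QuantumDouble k (DihedralGroup n)) M]
        [IsScalarTower k (QuantumDouble k (DihedralGroup n)) M], FiniteDimensional k M →
          IsIndecomposableModule (QuantumDouble k (DihedralGroup n)) M →
          ∃ x, Nonempty (M ≃ₗ[QuantumDouble k (DihedralGroup n)] (h.ydModule x).Double))) := by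
  have := h.neZero
  refine ⟨⟨fun x => ⟨h.finiteDimensional_of_hasLabel (h.hasLabel_ydModule x),
      h.isIndecomposable_ydModule x⟩, fun x y => h.eq_of_isIso_ydModule,
      fun M _ hM => h.exists_isIso_ydModule hM⟩,
    fun e₁ e₂ => ⟨h.isSimple_of_hasLabel (h.hasLabel_ydModule (.V e₁ e₂)),
      h.isSimple_of_hasLabel (h.hasLabel_ydModule (.U e₁ e₂))⟩,
    fun x => YDModule.isIndecomposableModule_double_iff.2 (h.isIndecomposable_ydModule x),
    fun x y hxy => h.eq_of_isIso_ydModule (YDModule.nonempty_double_linearEquiv_iff.1 hxy), ?_⟩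
  intro M _ _ _ _ _ hM
  -- Every module over the double comes from a Yetter-Drinfeld module that is `k`-linearly
  -- isomorphic to it, so finite dimension and the classification carry over.
  obtain ⟨X, ⟨e⟩, ⟨e'⟩⟩ := YDModule.exists_double_linearEquiv (k := k) (G := DihedralGroup n) M
  have := e.symm.finiteDimensional
  have hX := YDModule.isIndecomposableModule_double_iff.1 (hM.of_linearEquiv e')
  obtain ⟨x, hx⟩ := h.exists_isIso_ydModule hX
  exact ⟨x, (YDModule.nonempty_double_linearEquiv_iff.2 hx).map e'.symm.trans⟩
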